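/- Let $\lambda>1$ and let $G_\lambda=\mathbb Z\ltimes_\lambda\mathbb R$ be the group with multiplication $(m,t)(n,s)=(m+n,\lambda^m s+t)$. Let $A\in\mathrm{GL}(2,\mathbb Z)$ have the eigenvalue $\lambda$, let $w\neq 0$ satisfy $Aw=\lambda w$, and let $E^s_A\subset\mathbb R^2$ be the contracting eigenline of $A$. An affine action of $G_\lambda$ on $\mathbb T^2=\mathbb R^2/\mathbb Z^2$ is an action of the form $(m,t)\cdot x=B^m x+tv$ with $B\in \mathrm{GL}(2,\mathbb Z)$, $v\ne0$, $Bv=\lambda v$. Let $p\in\mathbb T^2$ be a fixed point of $A$ and let $U$ be any neighbourhood of $p$. Then there exist $\alpha\in(0,1)$ and a locally free $C^{1+\alpha}$ action $\rho$ of $G_\lambda$ on $\mathbb T^2$, with $f=\rho(1,0)$ and $\phi_t=\rho(0,t)$ (so $f\circ\phi_t=\phi_{\lambda t}\circ f$), such that: 1. $f$ is a DA (derived-from-Anosov) diffeomorphism obtained from $A$ near $p$: $f=A$ outside $U$; $f$ is partially hyperbolic with a continuous, $Df$-invariant, dominated splitting $T\mathbb T^2=E^{cs}\oplus E^u$ into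 line bundles, $E^u$ uniformly expanded, where $E^{cs}\equiv E^s_A$; $f$ preserves the linear foliation in the direction $E^s_A$; and the non-wandering set of $f$ is $\Omega(f)=\{p\}\cup\Lambda$, where $p$ is a source and $\Lambda$ is a hyperbolic expanding attractor (the maximal invariant set of a compact trapping region, topologically transitive, uniformly hyperbolic, with topological dimension equal to the dimension of its unstable bundle). 2. The flow $\phi_t$ is generated by a nowhere vanishing $C^{1+\alpha}$ vector field $X$ spanning $E^u$, and its orbits are the leaves of a $C^{1+\alpha}$ foliation $\mathcal F^u$, the unstable foliation of $f$, tangent to $E^u$. The flow preserves the linear foliation in the direction $E^s_A$ and has constant speed transversally to it: $X(x)-w\in E^s_A$ for all $x$. Moreover $D_xf\,X(x)=\lambda X(f(x))$ for all $x$, i.e. $\|Df|_{E^u(x)}\|=\lambda$ for the metric on $E^u$ with $\|X\|=1$. 3. $\rho$ is semi-conjugate to the affine action generated by $A$ and the linear flow $x\mapsto x+tw$: there is a continuous surjection $h:\mathbb T^2\to\mathbb T^2$ with $h(\rho(m,t)x)=A^m h(x)+tw$ for all $(m,t)\in G_\lambda$, $x\in\mathbb T^2$. 4. $\rho$ is not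 topologically conjugate to any affine action of $G_\lambda$ on $\mathbb T^2$: no homeomorphism of $\mathbb T^2$ intertwines $\rho$ with an affine action. -/

import Mathlib

open Set Filter Topology
open scoped NNReal

noncomputable section

/-- The 2-torus `ℝ² / ℤ²`. -/
abbrev Torus2 : Type := UnitAddTorus (Fin 2)

/-- The Euclidean plane, universal cover and tangent space of the 2-torus. -/
abbrev Plane : Type := EuclideanSpace ℝ (Fin 2)

/-- The covering projection `ℝ² → ℝ² / ℤ²`. -/
def torusProj (x : Plane) : Torus2 := fun i => ((x i : ℝ) : UnitAddCircle)

theorem torusProj_add (x y : Plane) : torusProj (x + y) = torusProj x + torusProj y := by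
  funext i; simp [torusProj]

theorem torusProj_zero : torusProj 0 = 0 := by
  funext i; simp [torusProj]

/-- The linear map of the plane given by an integer matrix. -/
def linMap (M : Matrix (Fin 2) (Fin 2) ℤ) : Plane →L[ℝ] Plane :=
  Matrix.toEuclideanCLM (n := Fin 2) (𝕜 := ℝ) (M.map (fun k : ℤ => (k : ℝ)))

theorem linMap_apply (M : Matrix (Fin 2) (Fin 2) ℤ) (x : Plane) (i : Fin 2) :
    linMap M x i = ∑ j, (M i j : ℝ) * x j := by
  simp [linMap, Matrix.mulVec, dotProduct]

/-- The endomorphism of the torus given by an integer matrix. -/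
def torusMul (M : Matrix (Fin 2) (Fin 2) ℤ) (x : Torus2) : Torus2 := fun i => ∑ j, M i j • x j

theorem torusMul_add (M : Matrix (Fin 2) (Fin 2) ℤ) (x y : Torus2) :
    torusMul M (x + y) = torusMul M x + torusMul M y := by
  funext i; simp [torusMul, Finset.sum_add_distrib]

theorem torusMul_one (x : Torus2) : torusMul 1 x = x := by
  funext i; simp [torusMul, Matrix.one_apply, ite_smul]

theorem torusMul_mul (M N : Matrix (Fin 2) (Fin 2) ℤ) (x : Torus2) :
    torusMul (M * N) x = torusMul M (torusMul N x) := by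
  funext i
  simp only [torusMul, Matrix.mul_apply, Fin.sum_univ_two, add_smul, mul_smul, smul_add]
  abel

theorem continuous_torusMul (M : Matrix (Fin 2) (Fin 2) ℤ) : Continuous (torusMul M) := by
  unfold torusMul; fun_prop

theorem torusMul_torusProj (M : Matrix (Fin 2) (Fin 2) ℤ) (x : Plane) :
    torusMul M (torusProj x) = torusProj (linMap M x) := by
  funext i
  simp only [torusMul, torusProj, linMap_apply, Fin.sum_univ_two, AddCircle.coe_add,
    ← zsmul_eq_mul, AddCircle.coe_zsmul]

/-- The automorphism of the torus induced by an element of `GL(2, ℤ)`, as a group action. -/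
def torusAut : GL (Fin 2) ℤ →* (Torus2 ≃ₜ Torus2) where
  toFun A :=
    { toFun := torusMul A.val
      invFun := torusMul (A⁻¹).val
      left_inv := fun x => by
        rw [← torusMul_mul, ← Units.val_mul, inv_mul_cancel, Units.val_one, torusMul_one]
      right_inv := fun x => by
        rw [← torusMul_mul, ← Units.val_mul, mul_inv_cancel, Units.val_one, torusMul_one]
      continuous_toFun := continuous_torusMul _
      continuous_invFun := continuous_torusMul _ }
  map_one' := by ext1 x; exact torusMul_one x
  map_mul' A B := by ext1 x; exact torusMul_mul A.val B.val x

theorem torusAut_apply (A : GL (Fin 2) ℤ) (x : Torus2) : torusAut A x = torusMul A.val x := rfl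

/-! ### The group `ℤ ⋉ ℝ` and its affine actions -/

/-- The group `G_λ = ℤ ⋉_λ ℝ`, with `(m, t) (n, s) = (m + n, λ ^ m s + t)`. -/
@[ext]
structure SolvGroup (lam : Set.Ioi (1 : ℝ)) where
  m : ℤ
  t : ℝ

namespace SolvGroup

variable {lam : Set.Ioi (1 : ℝ)}

theorem lam_ne_zero (lam : Set.Ioi (1 : ℝ)) : (lam : ℝ) ≠ 0 :=
  (zero_lt_one.trans lam.2).ne'

instance : Mul (SolvGroup lam) := ⟨fun g h => ⟨g.m + h.m, (lam : ℝ) ^ g.m * h.t + g.t⟩⟩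
instance : One (SolvGroup lam) := ⟨⟨0, 0⟩⟩
instance : Inv (SolvGroup lam) := ⟨fun g => ⟨-g.m, -((lam : ℝ) ^ (-g.m) * g.t)⟩⟩

theorem mul_def (g h : SolvGroup lam) :
    g * h = ⟨g.m + h.m, (lam : ℝ) ^ g.m * h.t + g.t⟩ := rfl
theorem one_def : (1 : SolvGroup lam) = ⟨0, 0⟩ := rfl
theorem inv_def (g : SolvGroup lam) : g⁻¹ = ⟨-g.m, -((lam : ℝ) ^ (-g.m) * g.t)⟩ := rfl

instance : Group (SolvGroup lam) :=
  Group.ofLeftAxioms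
    (fun a b c => by
      ext
      · simp [mul_def, add_assoc]
      · simp only [mul_def, zpow_add₀ (lam_ne_zero lam)]; ring)
    (fun a => by ext <;> simp [mul_def, one_def])
    (fun a => by ext <;> simp [mul_def, one_def, inv_def])

/-- The topology of the product `ℤ × ℝ`. -/
instance : TopologicalSpace (SolvGroup lam) :=
  TopologicalSpace.induced (fun g => (g.m, g.t)) inferInstance

end SolvGroup

theorem torusAut_zpow_torusProj {lam : Set.Ioi (1 : ℝ)} (A : GL (Fin 2) ℤ) (w : Plane)
    (hA : linMap A.val w = (lam : ℝ) • w) (m : ℤ) (t : ℝ) :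
    (torusAut A ^ m) (torusProj (t • w)) = torusProj (((lam : ℝ) ^ m * t) • w) := by
  have h0 := SolvGroup.lam_ne_zero lam
  have h1 : ∀ s : ℝ, torusAut A (torusProj (s • w)) = torusProj (((lam : ℝ) * s) • w) := by
    intro s
    rw [torusAut_apply, torusMul_torusProj, map_smul, hA, smul_smul, mul_comm]
  have h2 : ∀ s : ℝ, (torusAut A)⁻¹ (torusProj (s • w)) = torusProj (((lam : ℝ)⁻¹ * s) • w) := by
    intro s
    rw [Homeomorph.inv_apply, Homeomorph.symm_apply_eq, h1, mul_inv_cancel_left₀ h0]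
  induction m generalizing t with
  | zero => simp
  | succ n ih => rw [zpow_add_one, Homeomorph.mul_apply, h1, ih, zpow_add_one₀ h0, mul_assoc]
  | pred n ih => rw [zpow_sub_one, Homeomorph.mul_apply, h2, ih, zpow_sub_one₀ h0, mul_assoc]

theorem torusAut_zpow_add (A : GL (Fin 2) ℤ) (m : ℤ) (x y : Torus2) :
    (torusAut A ^ m) (x + y) = (torusAut A ^ m) x + (torusAut A ^ m) y := by
  rw [← map_zpow]; exact torusMul_add _ x y

/-- The affine action of `G_λ` generated by the automorphism `A` and by the linear flow
`x ↦ x + t w`, where `A w = λ w`. -/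
def affineAction {lam : Set.Ioi (1 : ℝ)} (A : GL (Fin 2) ℤ) (w : Plane)
    (hA : linMap A.val w = (lam : ℝ) • w) : SolvGroup lam →* (Torus2 ≃ₜ Torus2) where
  toFun g := (torusAut A ^ g.m).trans (Homeomorph.addRight (torusProj (g.t • w)))
  map_one' := by
    ext1 x
    simp [SolvGroup.one_def, torusProj_zero]
  map_mul' g h := by
    ext1 x
    simp only [SolvGroup.mul_def, Homeomorph.trans_apply, Homeomorph.mul_apply,
      Homeomorph.coe_addRight, torusAut_zpow_add, torusAut_zpow_torusProj A w hA, zpow_add,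
      add_smul, torusProj_add, add_assoc]

/-- An affine action of `G_λ` on the torus: some `B ∈ GL(2, ℤ)` with eigenvalue `λ`, together with
the linear flow along a nonzero `λ`-eigenvector of `B`. -/
def IsAffineAction {lam : Set.Ioi (1 : ℝ)} (σ : SolvGroup lam →* (Torus2 ≃ₜ Torus2)) : Prop :=
  ∃ (B : GL (Fin 2) ℤ) (w : Plane) (hB : linMap B.val w = (lam : ℝ) • w),
    w ≠ 0 ∧ σ = affineAction B w hB

/-- `ρ` is semi-conjugate to `σ`: a continuous surjection intertwines the two actions. -/
def SemiConjugateTo {G : Type*} [Group G] (ρ σ : G →* (Torus2 ≃ₜ Torus2)) : Prop :=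
  ∃ h : Torus2 → Torus2, Continuous h ∧ Function.Surjective h ∧ ∀ g x, h (ρ g x) = σ g (h x)

/-- `ρ` is topologically conjugate to `σ`: a homeomorphism intertwines the two actions. -/
def TopConjugateTo {G : Type*} [Group G] (ρ σ : G →* (Torus2 ≃ₜ Torus2)) : Prop :=
  ∃ h : Torus2 ≃ₜ Torus2, ∀ g x, h (ρ g x) = σ g (h x)

/-- Every point has a discrete stabilizer. -/
def IsLocallyFree {G : Type*} [Group G] [TopologicalSpace G]
    (ρ : G →* (Torus2 ≃ₜ Torus2)) : Prop :=
  ∀ x, ∀ᶠ g in 𝓝 (1 : G), ρ g x = x → g = 1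

/-! ### Regularity `C^{1+α}` -/

/-- `F` is `C^{1+α}` on the open set `S`: it is `C¹` there with locally `α`-Hölder derivative. -/
def IsC1HolderOn {V W : Type*} [NormedAddCommGroup V] [NormedSpace ℝ V]
    [NormedAddCommGroup W] [NormedSpace ℝ W] (α : ℝ≥0) (F : V → W) (S : Set V) : Prop :=
  ContDiffOn ℝ 1 F S ∧ ∀ x ∈ S, ∃ U ∈ 𝓝 x, ∃ C : ℝ≥0, HolderOnWith C α (fderiv ℝ F) U

/-- `F` is a lift to the plane of the self-map `f` of the torus. -/
def IsLift (F : Plane → Plane) (f : Torus2 → Torus2) : Prop :=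
  Continuous F ∧ ∀ x, torusProj (F x) = f (torusProj x)

/-- The action is `C^{1+α}`: on each component `{m} × ℝ` of the group, the action map
`((m, t), x) ↦ ρ (m, t) x` has a lift that is jointly `C^{1+α}` in `(t, x)`. In particular every
`ρ g` is a `C^{1+α}` diffeomorphism. -/
def IsC1HolderAction {lam : Set.Ioi (1 : ℝ)} (α : ℝ≥0)
    (ρ : SolvGroup lam →* (Torus2 ≃ₜ Torus2)) : Prop :=
  ∀ m : ℤ, ∃ Φ : ℝ × Plane → Plane, IsC1HolderOn α Φ univ ∧
    ∀ t x, torusProj (Φ (t, x)) = ρ ⟨m, t⟩ (torusProj x)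

/-- The vector field `X` generates the flow `φ`: its integral curves in the plane project to the
orbits of `φ`. -/
def Generates (X : Torus2 → Plane) (φ : ℝ → Torus2 → Torus2) : Prop :=
  ∀ x : Plane, ∃ γ : ℝ → Plane, γ 0 = x ∧
    ∀ t, torusProj (γ t) = φ t (torusProj x) ∧ HasDerivAt γ (X (torusProj (γ t))) t

/-- The open square `(-1, 1)²`. -/
def openSquare : Set (ℝ × ℝ) := Ioo (-1) 1 ×ˢ Ioo (-1) 1

/-- A `C^{1+α}` one-dimensional foliation of the torus, `leaf x` being the leaf through `x`: a
decomposition into disjoint connected leaves such that around each point there is a `C^{1+α}`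
chart, with inverse `π ∘ ψ`, in which the connected components of the trace of each leaf are the
horizontal segments. -/
def IsC1HolderFoliation (α : ℝ≥0) (leaf : Torus2 → Set Torus2) : Prop :=
  (∀ x, x ∈ leaf x ∧ IsConnected (leaf x)) ∧
  (∀ x y, y ∈ leaf x → leaf y = leaf x) ∧
  ∀ x, ∃ ψ : ℝ × ℝ → Plane, torusProj (ψ 0) = x ∧ IsC1HolderOn α ψ openSquare ∧
    InjOn (torusProj ∘ ψ) openSquare ∧
    (∀ z ∈ openSquare, Function.Bijective (fderiv ℝ ψ z)) ∧
    ∀ z ∈ openSquare,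
      connectedComponentIn
        (openSquare ∩ {z' | torusProj (ψ z') ∈ leaf (torusProj (ψ z))}) z
        = Ioo (-1) 1 ×ˢ {z.2}

/-! ### Hyperbolic dynamics -/

/-- The stable space of a linear map of the plane: the vectors whose forward iterates tend to
zero. -/
def stableSpace (T : Plane →L[ℝ] Plane) : Submodule ℝ Plane where
  carrier := {v | Tendsto (fun n : ℕ => (T ^ n) v) atTop (𝓝 0)}
  zero_mem' := by simp
  add_mem' := fun {a b} ha hb => by
    simpa using Filter.Tendsto.add (show Tendsto _ _ _ from ha) (show Tendsto _ _ _ from hb)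
  smul_mem' := fun c a ha => by
    have h := Filter.Tendsto.const_smul (show Tendsto (fun n : ℕ => (T ^ n) a) atTop (𝓝 0) from ha) c
    rw [smul_zero] at h
    exact h.congr fun n => ((T ^ n).map_smul c a).symm

/-- The leaf through `x` of the linear foliation of the torus in the direction `E`. -/
def linearLeaf (E : Submodule ℝ Plane) (x : Torus2) : Set Torus2 :=
  {y | ∃ v ∈ E, y = x + torusProj v}

/-- A distribution `E` on the torus is invariant over `Λ` under the derivative of the map with
lift `F`. -/
def IsInvariantBundle (F : Plane → Plane) (Λ : Set Torus2) (E : Torus2 → Submodule ℝ Plane) :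
    Prop :=
  ∀ x, torusProj x ∈ Λ →
    (E (torusProj x)).map (fderiv ℝ F x : Plane →ₗ[ℝ] Plane) = E (torusProj (F x))

/-- The torus diffeomorphism with lift `F` is partially hyperbolic with splitting into the line
bundles `Ecs ⊕ Eu`: the splitting is continuous, invariant and dominated, and `Eu` is uniformly
expanded. Continuity is expressed by closed graphs. -/
def IsPartiallyHyperbolic (F : Plane → Plane) (Ecs Eu : Torus2 → Submodule ℝ Plane) : Prop :=
  (∀ x, IsCompl (Ecs x) (Eu x) ∧ Module.finrank ℝ (Ecs x) = 1 ∧ Module.finrank ℝ (Eu x) = 1) ∧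
  IsClosed {q : Torus2 × Plane | q.2 ∈ Ecs q.1} ∧
  IsClosed {q : Torus2 × Plane | q.2 ∈ Eu q.1} ∧
  IsInvariantBundle F univ Ecs ∧ IsInvariantBundle F univ Eu ∧
  ∃ C > 0, ∃ η ∈ Ioo (0 : ℝ) 1, ∀ (n : ℕ) (x : Plane), ∀ u ∈ Eu (torusProj x),
    (∀ v ∈ Ecs (torusProj x),
      ‖fderiv ℝ F^[n] x v‖ * ‖u‖ ≤ C * η ^ n * (‖fderiv ℝ F^[n] x u‖ * ‖v‖)) ∧
    ‖u‖ ≤ C * η ^ n * ‖fderiv ℝ F^[n] x u‖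

/-- `Λ` is a compact invariant uniformly hyperbolic set, with splitting `Es ⊕ Eu`, of the torus
diffeomorphism `f` with lift `F`. -/
def IsHyperbolicSet (f : Torus2 → Torus2) (F : Plane → Plane) (Λ : Set Torus2)
    (Es Eu : Torus2 → Submodule ℝ Plane) : Prop :=
  Λ.Nonempty ∧ IsCompact Λ ∧ f '' Λ = Λ ∧ (∀ x ∈ Λ, IsCompl (Es x) (Eu x)) ∧
  IsInvariantBundle F Λ Es ∧ IsInvariantBundle F Λ Eu ∧
  ∃ C > 0, ∃ η ∈ Ioo (0 : ℝ) 1, ∀ (n : ℕ) (x : Plane), torusProj x ∈ Λ →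
    (∀ v ∈ Es (torusProj x), ‖fderiv ℝ F^[n] x v‖ ≤ C * η ^ n * ‖v‖) ∧
    ∀ v ∈ Eu (torusProj x), ‖v‖ ≤ C * η ^ n * ‖fderiv ℝ F^[n] x v‖

/-- `p` is a source: a fixed point at which the derivative is uniformly expanding in every
direction. -/
def IsSource (f : Torus2 → Torus2) (F : Plane → Plane) (p : Torus2) : Prop :=
  f p = p ∧ IsHyperbolicSet f F {p} (fun _ => ⊥) (fun _ => ⊤)

/-- `Λ` is a topologically transitive attractor: the maximal invariant set of a compact trapping
region, with a transitive restriction of `f`. -/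
def IsTransitiveAttractor (f : Torus2 → Torus2) (Λ : Set Torus2) : Prop :=
  (∃ N : Set Torus2, IsCompact N ∧ f '' N ⊆ interior N ∧ Λ = ⋂ n : ℕ, f^[n] '' N) ∧
  ∀ U V : Set Torus2, IsOpen U → IsOpen V → (U ∩ Λ).Nonempty → (V ∩ Λ).Nonempty →
    ∃ n : ℕ, ((f^[n] '' (U ∩ Λ)) ∩ V).Nonempty

/-- `Λ` is a hyperbolic expanding attractor: a transitive attractor that is a hyperbolic set and
whose topological dimension equals the dimension of its unstable bundle. -/
def IsHyperbolicExpandingAttractor (f : Torus2 → Torus2) (F : Plane → Plane) (Λ : Set Torus2) :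
    Prop :=
  IsTransitiveAttractor f Λ ∧ ∃ Es Eu : Torus2 → Submodule ℝ Plane,
    IsHyperbolicSet f F Λ Es Eu ∧
    ∀ x ∈ Λ, smallInductiveDimension Λ = (Module.finrank ℝ (Eu x) : WithBot ℕ∞)

/-- The non-wandering set `Ω(f)`. -/
def nonwanderingSet (f : Torus2 → Torus2) : Set Torus2 :=
  {x | ∀ U ∈ 𝓝 x, ∃ n : ℕ, 0 < n ∧ ((f^[n] '' U) ∩ U).Nonempty}

end

/-! In coordinates `(r, s)` along `w` and the contracting eigenvector of `A`, centred at a lift of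
`p`, the automorphism is `(r, s) ↦ (λ r, μ s)` with `|μ| = λ⁻¹`. The diffeomorphism is the skew
product `F (r, s) = (λ r, μ s + k (r, s))`, where `k` is periodic under the lattice of periods and
supported near it. Vertical lines, the leaves of `E^s_A`, are thus preserved, and `r` is still
multiplied by exactly `λ`; this is why the unstable flow can have constant speed in `r`. The
perturbation (`exists_isProfile`, `exists_isDAPerturbation`) makes `0` a source, yet keeps the
vertical derivative at most `(1 + λ) / 2 < λ` in absolute value everywhere, and at most `η < 1` off
small boxes around the lattice points.

Unstable field. A field `(1, a)` with `DF (1, a) = λ (1, a) ∘ F` amounts to a solution of `a = c + j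
· (a ∘ F⁻¹)`. Both `|j|` and `‖j · DF⁻¹‖` are at most `θ = (1 + λ) / (2 λ) < 1`, so the series for
`a` converges together with its first derivatives. The derivatives of the terms decay exponentially
and their Lipschitz constants grow at most exponentially; interpolation then gives a Hölder
derivative for small `α` (`exists_cohomological_solution`). The flow `Φ` of `(1, a)` is jointly
`C^{1+α}`, and uniqueness of integral curves gives `F ∘ Φ_t = Φ_{λ t} ∘ F`.

Semiconjugacy. A geometric series produces a bounded periodic `u` such that `H (r, s) = (r, s + u)`
carries `F` to the linear map. `H` is monotone on vertical lines and carries `Φ` to horizontal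
translation. A nontrivial vertical segment in a fibre of `H` must meet the boxes under backward
iteration: otherwise `F` would contract all its preimages, whose lengths are bounded
(`exists_betw_mem_V`). Hence nontrivial fibres lie over the countably many second coordinates of
lattice points.

Attractor. `attr` consists of the points whose backward orbit avoids the boxes. It is `Φ`-invariant,
contains no vertical segment, and is approximated along verticals by singleton fibres. A nonempty
closed flow-invariant subset of the torus is mapped onto the torus by `h`, so it contains all
singleton fibres, hence `Λ`. This minimality, with the stretching of flow time by `λ ^ n`, gives
transitivity. Flow boxes whose horizontal sides miss the attractor give dimension one. Apart from
`p`, every orbit starting in the boxes leaves them for ever, which determines the non-wandering set.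
Finally, only `p` keeps its forward orbit in the boxes, whereas every fixed point of a hyperbolic
automorphism has a stable arc; so no conjugacy to an affine action exists. -/

noncomputable section

/-! ### Locally Hölder maps and maps of class `C^{1+α}` -/

/-- `f` is locally `α`-Hölder. -/
def LocHolder {V W : Type*} [PseudoEMetricSpace V] [PseudoEMetricSpace W] (α : ℝ≥0) (f : V → W) :
    Prop :=
  ∀ x, ∃ U ∈ 𝓝 x, ∃ C : ℝ≥0, HolderOnWith C α f U

section LocHolder

variable {V W Y : Type*} [NormedAddCommGroup V] [NormedSpace ℝ V]
  [NormedAddCommGroup W] [NormedSpace ℝ W] [NormedAddCommGroup Y] [NormedSpace ℝ Y] {α : ℝ≥0}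

omit [NormedSpace ℝ Y] in
theorem LocHolder.comp_contDiff {g : W → Y} {f : V → W} (hg : LocHolder α g)
    (hf : ContDiff ℝ 1 f) : LocHolder α (g ∘ f) := by
  intro x
  obtain ⟨U, hU, C, hC⟩ := hg (f x)
  obtain ⟨K, t, ht, hK⟩ := hf.contDiffAt.exists_lipschitzOnWith (x := x)
  have := hC.comp (holderOnWith_one.2 (hK.mono (inter_subset_left (t := f ⁻¹' U))))
    (fun y hy => hy.2)
  rw [mul_one] at this
  exact ⟨t ∩ f ⁻¹' U, inter_mem ht (hf.continuous.continuousAt.preimage_mem_nhds hU), _, this⟩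

omit [NormedSpace ℝ V] in
theorem LocHolder.contDiffAt_comp {g : W → Y} {f : V → W} (hf : LocHolder α f)
    (hfc : Continuous f) (hg : ∀ x, ContDiffAt ℝ 1 g (f x)) : LocHolder α (g ∘ f) := by
  intro x
  obtain ⟨U, hU, C, hC⟩ := hf x
  obtain ⟨K, t, ht, hK⟩ := (hg x).exists_lipschitzOnWith
  have := (holderOnWith_one.2 hK).comp (hC.mono (inter_subset_left (t := f ⁻¹' t)))
    (fun y hy => hy.2)
  rw [one_mul] at this
  exact ⟨U ∩ f ⁻¹' t, inter_mem hU (hfc.continuousAt.preimage_mem_nhds ht), _, this⟩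

omit [NormedSpace ℝ V] [NormedSpace ℝ W] [NormedSpace ℝ Y] in
theorem LocHolder.prodMk {f : V → W} {g : V → Y} (hf : LocHolder α f) (hg : LocHolder α g) :
    LocHolder α (fun x => (f x, g x)) := by
  intro x
  obtain ⟨U, hU, C, hC⟩ := hf x
  obtain ⟨U', hU', C', hC'⟩ := hg x
  refine ⟨U ∩ U', inter_mem hU hU', max C C', fun y hy z hz => ?_⟩
  rw [Prod.edist_eq]
  refine max_le ((hC y hy.1 z hz.1).trans ?_) ((hC' y hy.2 z hz.2).trans ?_)
  · gcongr; exact le_max_left _ _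
  · gcongr; exact le_max_right _ _

theorem LocHolder.of_contDiff (hα : α ≤ 1) {f : V → W} (hf : ContDiff ℝ 1 f) : LocHolder α f := by
  intro x
  obtain ⟨K, t, ht, hK⟩ := hf.contDiffAt.exists_lipschitzOnWith (x := x)
  refine ⟨t ∩ Metric.ball x 1, inter_mem ht (Metric.ball_mem_nhds x one_pos), _,
    HolderOnWith.of_le (D := 2) ?_ (holderOnWith_one.2 (hK.mono inter_subset_left)) hα⟩
  intro y hy z hz
  rw [edist_dist]
  refine ENNReal.ofReal_le_of_le_toReal ?_
  have h1 := Metric.mem_ball.1 hy.2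
  have h2 := Metric.mem_ball'.1 hz.2
  have := dist_triangle y x z
  simp
  linarith

theorem isC1HolderOn_univ {F : V → W} :
    IsC1HolderOn α F univ ↔ ContDiff ℝ 1 F ∧ LocHolder α (fderiv ℝ F) := by
  simp [IsC1HolderOn, contDiffOn_univ, LocHolder]

theorem IsC1HolderOn.mono_univ {F : V → W} (h : IsC1HolderOn α F univ) (S : Set V) :
    IsC1HolderOn α F S :=
  ⟨h.1.mono (subset_univ _), fun x _ => h.2 x (mem_univ x)⟩

theorem isC1HolderOn_of_contDiff (hα : α ≤ 1) {F : V → W} (hF : ContDiff ℝ 2 F) :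
    IsC1HolderOn α F univ :=
  isC1HolderOn_univ.2 ⟨hF.of_le one_le_two,
    LocHolder.of_contDiff hα (hF.fderiv_right (m := 1) (by norm_num))⟩

/-- By the chain rule the derivative is the smooth bilinear composition map applied to two locally
Hölder maps, one of them precomposed with the locally Lipschitz `F`. -/
theorem IsC1HolderOn.comp {G : W → Y} {F : V → W} (hG : IsC1HolderOn α G univ)
    (hF : IsC1HolderOn α F univ) : IsC1HolderOn α (G ∘ F) univ := by
  rw [isC1HolderOn_univ] at *
  refine ⟨hG.1.comp hF.1, ?_⟩
  have h1 : fderiv ℝ (G ∘ F) = (fun q : (W →L[ℝ] Y) × (V →L[ℝ] W) => q.1.comp q.2) ∘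
      fun x => (fderiv ℝ G (F x), fderiv ℝ F x) := by
    funext x
    exact fderiv_comp x ((hG.1.differentiable one_ne_zero) _) ((hF.1.differentiable one_ne_zero) _)
  rw [h1]
  refine LocHolder.contDiffAt_comp ((hG.2.comp_contDiff hF.1).prodMk hF.2) ?_ ?_
  · exact ((hG.1.continuous_fderiv one_ne_zero).comp hF.1.continuous).prodMk
      (hF.1.continuous_fderiv one_ne_zero)
  · intro x
    exact (isBoundedBilinearMap_comp.contDiff).contDiffAt

theorem IsC1HolderOn.prodMk {F : V → W} {G : V → Y} (hF : IsC1HolderOn α F univ)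
    (hG : IsC1HolderOn α G univ) : IsC1HolderOn α (fun x => (F x, G x)) univ := by
  rw [isC1HolderOn_univ] at *
  refine ⟨hF.1.prodMk hG.1, ?_⟩
  have h1 : fderiv ℝ (fun x => (F x, G x)) =
      (fun q : (V →L[ℝ] W) × (V →L[ℝ] Y) => (ContinuousLinearMap.inl ℝ W Y).comp q.1 +
        (ContinuousLinearMap.inr ℝ W Y).comp q.2) ∘
      fun x => (fderiv ℝ F x, fderiv ℝ G x) := by
    funext x
    rw [((hF.1.differentiable one_ne_zero).differentiableAt).fderiv_prodMk
      ((hG.1.differentiable one_ne_zero).differentiableAt)]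
    ext v <;> simp
  rw [h1]
  refine LocHolder.contDiffAt_comp (hF.2.prodMk hG.2) ((hF.1.continuous_fderiv one_ne_zero).prodMk
    (hG.1.continuous_fderiv one_ne_zero)) fun x => ?_
  exact ((contDiff_const.clm_comp contDiff_fst).add
    (contDiff_const.clm_comp contDiff_snd)).contDiffAt

/-- The inverse of a `C^n` bijection with invertible derivatives is `C^n`. -/
theorem Equiv.contDiff_symm_of_invertible [CompleteSpace V] [CompleteSpace W] (F : V ≃ W)
    {n : WithTop ℕ∞} (hn : n ≠ 0)
    (hF : ContDiff ℝ n F) (F' : V → V ≃L[ℝ] W)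
    (hF' : ∀ x, HasFDerivAt F (F' x : V →L[ℝ] W) x) : ContDiff ℝ n F.symm := by
  have hs : ∀ x, HasStrictFDerivAt F (F' x : V →L[ℝ] W) x := fun x =>
    hF.contDiffAt.hasStrictFDerivAt' (hF' x) hn
  have ho : IsOpenMap F := isOpenMap_of_hasStrictFDerivAt_equiv hs
  exact (F.toHomeomorphOfContinuousOpen hF.continuous ho).contDiff_symm hF' hF

/-- The derivative of the inverse is operator inversion, smooth at invertible operators, after the
locally Hölder map `fderiv F` and the `C¹` map `F.symm`. -/
theorem IsC1HolderOn.symm [CompleteSpace V] [CompleteSpace W] (F : V ≃ W)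
    (hF : IsC1HolderOn α F univ) (F' : V → V ≃L[ℝ] W)
    (hF' : ∀ x, HasFDerivAt F (F' x : V →L[ℝ] W) x) : IsC1HolderOn α F.symm univ := by
  rw [isC1HolderOn_univ] at *
  have h0 := F.contDiff_symm_of_invertible one_ne_zero hF.1 F' hF'
  refine ⟨h0, ?_⟩
  have h1 : fderiv ℝ F.symm = ContinuousLinearMap.inverse ∘ (fderiv ℝ F ∘ F.symm) := by
    funext y
    have h2 := (hF' (F.symm y))
    simp only [Function.comp_apply]
    rw [h2.fderiv, ContinuousLinearMap.inverse_equiv]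
    refine (HasFDerivAt.of_local_left_inverse h0.continuous.continuousAt h2 ?_).fderiv
    exact Eventually.of_forall fun x => F.apply_symm_apply x
  rw [h1]
  refine LocHolder.contDiffAt_comp (hF.2.comp_contDiff h0)
    ((hF.1.continuous_fderiv one_ne_zero).comp h0.continuous) fun y => ?_
  simp only [Function.comp_apply]
  rw [(hF' (F.symm y)).fderiv]
  exact contDiffAt_map_inverse _

end LocHolder

/-! ### Series of functions with exponentially decaying terms -/

/-- At `α = 0` the expression equals `θ < 1`, and it is continuous in `α`. However large the growth
rate `M` is, a small exponent thus lets the decay rate `θ` win. -/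
theorem exists_holder_exponent {θ M : ℝ} (hθ : 0 < θ) (hθ1 : θ < 1) (hM : 0 < M) :
    ∃ α : ℝ, 0 < α ∧ α < 1 ∧ θ ^ (1 - α) * M ^ α < 1 := by
  have hc : ContinuousAt (fun α : ℝ => θ ^ (1 - α) * M ^ α) 0 := by
    refine ContinuousAt.mul ?_ ?_
    · exact continuousAt_const.rpow (by fun_prop) (Or.inl hθ.ne')
    · exact continuousAt_const.rpow (by fun_prop) (Or.inl hM.ne')
  have h0 : (fun α : ℝ => θ ^ (1 - α) * M ^ α) 0 < 1 := by simpa using hθ1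
  have h1 : ∀ᶠ α in 𝓝 (0 : ℝ), θ ^ (1 - α) * M ^ α < 1 := hc.eventually_lt_const h0
  obtain ⟨ε, hε, h2⟩ := Metric.eventually_nhds_iff.1 h1
  refine ⟨min (ε / 2) (1 / 2), by positivity, ?_, h2 ?_⟩
  · exact (min_le_right _ _).trans_lt (by norm_num)
  · rw [Real.dist_eq, sub_zero, abs_of_pos (by positivity)]
    exact (min_le_left _ _).trans_lt (by linarith)

/-- Interpolation between two bounds, by writing `x = x ^ (1 - α) * x ^ α` and bounding each factor
by a different one. -/
theorem min_le_rpow_mul_rpow {a b x α : ℝ} (ha : 0 ≤ a) (hxa : x ≤ a)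
    (hxb : x ≤ b) (hx : 0 ≤ x) (hα : 0 ≤ α) (hα1 : α ≤ 1) : x ≤ a ^ (1 - α) * b ^ α := by
  have : x = x ^ (1 - α) * x ^ α := by
    rcases hx.eq_or_lt with h | h
    · subst h
      rcases hα.eq_or_lt with h' | h'
      · subst h'; simp
      · rw [Real.zero_rpow h'.ne', mul_zero]
    · rw [← Real.rpow_add h]; simp
  rw [this]
  have : 0 ≤ 1 - α := by linarith
  gcongr

/-- If the terms of a series decay exponentially and their Lipschitz constants grow at most
exponentially, then the sum is Hölder. -/
theorem exists_holderWith_tsum {V W : Type*} [NormedAddCommGroup V] [NormedAddCommGroup W]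
    [CompleteSpace W] {D : ℕ → V → W} {B θ K M : ℝ} (hB : 0 < B) (hθ : 0 < θ) (hθ1 : θ < 1)
    (hK : 0 < K) (hM : 0 < M) (h1 : ∀ n x, ‖D n x‖ ≤ B * θ ^ n)
    (h2 : ∀ n x y, ‖D n x - D n y‖ ≤ K * M ^ n * ‖x - y‖) :
    ∃ α : ℝ≥0, 0 < α ∧ α < 1 ∧ ∃ C : ℝ≥0, HolderWith C α (fun x => ∑' n, D n x) := by
  obtain ⟨α, hα, hα1, hr⟩ := exists_holder_exponent hθ hθ1 hM
  have hr0 : 0 < θ ^ (1 - α) * M ^ α := by positivity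
  set r := θ ^ (1 - α) * M ^ α with hrdef
  have hs : ∀ x, Summable fun n => D n x := fun x =>
    Summable.of_norm_bounded ((summable_geometric_of_lt_one hθ.le hθ1).mul_left B) fun n => h1 n x
  set C : ℝ := (2 * B) ^ (1 - α) * K ^ α * (1 - r)⁻¹ with hC
  have hC0 : 0 ≤ C := by
    have : 0 < 1 - r := by linarith
    positivity
  refine ⟨α.toNNReal, Real.toNNReal_pos.2 hα, Real.toNNReal_lt_one.2 hα1, C.toNNReal, fun x y => ?_⟩
  -- Interpolation of the decay bound `2 B θ ^ n` with the Lipschitz bound `K M ^ n ‖x - y‖` gives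
  -- terms of a geometric series of ratio `r`.
  have key : ∀ n, ‖D n x - D n y‖ ≤ (2 * B) ^ (1 - α) * K ^ α * ‖x - y‖ ^ α * r ^ n := by
    intro n
    have e1 : ‖D n x - D n y‖ ≤ 2 * B * θ ^ n :=
      (norm_sub_le _ _).trans (by linarith [h1 n x, h1 n y])
    refine (min_le_rpow_mul_rpow (by positivity) e1 (h2 n x y) (norm_nonneg _)
      hα.le hα1.le).trans_eq ?_
    rw [Real.mul_rpow (x := 2 * B) (by positivity) (by positivity),
      Real.mul_rpow (x := K * M ^ n) (by positivity) (by positivity),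
      Real.mul_rpow (x := K) (by positivity) (by positivity), hrdef, mul_pow, ← Real.rpow_natCast,
      ← Real.rpow_natCast M, ← Real.rpow_natCast (θ ^ (1 - α)), ← Real.rpow_natCast (M ^ α),
      ← Real.rpow_mul hθ.le, ← Real.rpow_mul hM.le, ← Real.rpow_mul hθ.le, ← Real.rpow_mul hM.le,
      mul_comm (n : ℝ) (1 - α), mul_comm (n : ℝ) α]
    ring
  have h3 : ‖∑' n, D n x - ∑' n, D n y‖ ≤ C * ‖x - y‖ ^ α := by
    rw [← (hs x).tsum_sub (hs y)]
    refine (tsum_of_norm_bounded ((hasSum_geometric_of_lt_one hr0.le hr).mul_left _) key).trans_eq ?_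
    rw [hC]; ring
  rw [edist_dist, edist_dist, dist_eq_norm, dist_eq_norm, Real.coe_toNNReal _ hα.le,
    ENNReal.ofReal_rpow_of_nonneg (norm_nonneg _) hα.le]
  change _ ≤ ENNReal.ofReal C * _
  rw [← ENNReal.ofReal_mul hC0]
  exact ENNReal.ofReal_le_ofReal h3

/-- A linear factor is absorbed by a slightly larger ratio, since `n (θ / θ') ^ n` tends to zero. -/
theorem exists_geometric_bound {θ : ℝ} (hθ : 0 < θ) (hθ1 : θ < 1) (P Q : ℝ) :
    ∃ θ' B : ℝ, 0 < θ' ∧ θ' < 1 ∧ 0 < B ∧ ∀ n : ℕ, (P + n * Q) * θ ^ n ≤ B * θ' ^ n := by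
  set θ' := (1 + θ) / 2 with hθ'
  have h0 : 0 < θ' := by positivity
  have h1 : θ' < 1 := by linarith
  have h2 : θ / θ' < 1 := by rw [div_lt_one h0]; linarith
  have h3 : Tendsto (fun n : ℕ => P * (θ / θ') ^ n + Q * (n * (θ / θ') ^ n)) atTop (𝓝 0) := by
    have := ((tendsto_pow_atTop_nhds_zero_of_lt_one (by positivity) h2).const_mul P).add
      ((tendsto_self_mul_const_pow_of_lt_one (by positivity) h2).const_mul Q)
    simpa using this
  obtain ⟨B, hB⟩ := h3.bddAbove_range
  refine ⟨θ', max B 1, h0, h1, by positivity, fun n => ?_⟩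
  have := hB ⟨n, rfl⟩
  simp only [div_pow] at this
  calc (P + n * Q) * θ ^ n = (P * (θ ^ n / θ' ^ n) + Q * (n * (θ ^ n / θ' ^ n))) * θ' ^ n := by
        field_simp
    _ ≤ max B 1 * θ' ^ n := by gcongr; exact this.trans (le_max_left _ _)

/-- A cohomological equation `a = c + j · a ∘ S` over a dominated map `S` has a bounded solution of
class `C^{1+α}`. -/
theorem exists_cohomological_solution {V : Type*} [NormedAddCommGroup V] [NormedSpace ℝ V]
    {S : V → V} {j c : V → ℝ} {θ K : ℝ} (hθ : 0 < θ) (hθ1 : θ < 1) (hK : 1 ≤ K)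
    (hS : Differentiable ℝ S) (hSb : ∀ x, ‖fderiv ℝ S x‖ ≤ K)
    (hSl : ∀ x y, ‖fderiv ℝ S x - fderiv ℝ S y‖ ≤ K * ‖x - y‖)
    (hj : Differentiable ℝ j) (hjθ : ∀ x, |j x| ≤ θ) (hjb : ∀ x, ‖fderiv ℝ j x‖ ≤ K)
    (hjl : ∀ x y, ‖fderiv ℝ j x - fderiv ℝ j y‖ ≤ K * ‖x - y‖)
    (hc : Differentiable ℝ c) (hcK : ∀ x, |c x| ≤ K) (hcb : ∀ x, ‖fderiv ℝ c x‖ ≤ K)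
    (hcl : ∀ x y, ‖fderiv ℝ c x - fderiv ℝ c y‖ ≤ K * ‖x - y‖)
    (hjS : ∀ x, ‖j x • fderiv ℝ S x‖ ≤ θ) :
    ∃ α : ℝ≥0, 0 < α ∧ α < 1 ∧ ∃ a : V → ℝ, ContDiff ℝ 1 a ∧ (∃ C, ∀ x, |a x| ≤ C) ∧
      (∃ C, ∀ x, ‖fderiv ℝ a x‖ ≤ C) ∧ (∃ C : ℝ≥0, HolderWith C α (fderiv ℝ a)) ∧
      ∀ x, a x = c x + j x * a (S x) := by
  have hK0 : 0 < K := by linarith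
  -- The `n`-th term is `j · (j ∘ S) ⋯ (j ∘ S^[n-1]) · (c ∘ S^[n])`, and the solution is the sum.
  -- Each step multiplies the derivative by `j · DS`, of norm at most `θ`, and adds a term of order
  -- `θ ^ n` from `Dj`; hence the linear factor in `n` below.
  let d : ℕ → V → ℝ := fun n => Nat.rec c (fun _ u x => j x * u (S x)) n
  have d0 : d 0 = c := rfl
  have dS : ∀ n, d (n + 1) = fun x => j x * d n (S x) := fun n => rfl
  have hdd : ∀ n, Differentiable ℝ (d n) := by
    intro n
    induction n with
    | zero => exact hc
    | succ n ih => rw [dS]; exact hj.mul (ih.comp hS)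
  have hD : ∀ n x, fderiv ℝ (d (n + 1)) x =
      d n (S x) • fderiv ℝ j x + j x • (fderiv ℝ (d n) (S x)).comp (fderiv ℝ S x) := by
    intro n x
    have h1 : HasFDerivAt (fun x => d n (S x)) ((fderiv ℝ (d n) (S x)).comp (fderiv ℝ S x)) x :=
      ((hdd n) (S x)).hasFDerivAt.comp x (hS x).hasFDerivAt
    rw [dS, ((hj x).hasFDerivAt.fun_mul h1).fderiv]
    exact add_comm _ _
  have hdb : ∀ n x, |d n x| ≤ K * θ ^ n := by
    intro n
    induction n with
    | zero => simpa [d0] using hcK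
    | succ n ih =>
      intro x
      rw [dS, abs_mul, pow_succ]
      have := mul_le_mul (hjθ x) (ih (S x)) (abs_nonneg _) hθ.le
      linarith
  have hDb0 : ∀ n x, ‖fderiv ℝ (d n) x‖ ≤ (K + n * (K * K / θ)) * θ ^ n := by
    intro n
    induction n with
    | zero => simpa [d0] using hcb
    | succ n ih =>
      intro x
      rw [hD]
      have e1 : ‖d n (S x) • fderiv ℝ j x‖ ≤ (K * θ ^ n) * K := by
        rw [norm_smul]
        exact mul_le_mul (hdb n _) (hjb x) (norm_nonneg _) (by positivity)
      have e2 : ‖j x • (fderiv ℝ (d n) (S x)).comp (fderiv ℝ S x)‖ ≤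
          ((K + n * (K * K / θ)) * θ ^ n) * θ := by
        rw [← ContinuousLinearMap.comp_smul]
        refine (ContinuousLinearMap.opNorm_comp_le _ _).trans ?_
        exact mul_le_mul (ih _) (hjS x) (norm_nonneg _) (by positivity)
      refine (norm_add_le_of_le e1 e2).trans_eq ?_
      push_cast
      field_simp
      ring
  obtain ⟨θ', B, hθ', hθ'1, hB, hgeo⟩ := exists_geometric_bound hθ hθ1 K (K * K / θ)
  have hDb : ∀ n x, ‖fderiv ℝ (d n) x‖ ≤ B * θ' ^ n := fun n x => (hDb0 n x).trans (hgeo n)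
  have hDB : ∀ n x, ‖fderiv ℝ (d n) x‖ ≤ B := fun n x => (hDb n x).trans
    (mul_le_of_le_one_right hB.le (pow_le_one₀ hθ'.le hθ'1.le))
  have hlip : ∀ {u : V → ℝ} {b : ℝ}, Differentiable ℝ u → (∀ x, ‖fderiv ℝ u x‖ ≤ b) →
      ∀ x y, |u x - u y| ≤ b * ‖x - y‖ := fun hu hb x y =>
    convex_univ.norm_image_sub_le_of_norm_fderiv_le (fun z _ => hu z) (fun z _ => hb z)
      (mem_univ y) (mem_univ x)
  have hSlip : ∀ x y, ‖S x - S y‖ ≤ K * ‖x - y‖ := fun x y =>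
    convex_univ.norm_image_sub_le_of_norm_fderiv_le (fun z _ => hS z) (fun z _ => hSb z)
      (mem_univ y) (mem_univ x)
  -- `P` collects the contributions to the Lipschitz constant of the next derivative that do not
  -- involve that of the current one (`e1`, `e2`, `e3`, `e5`). The remaining one, `e4`, multiplies
  -- the current constant by `K * K`.
  set P := B * K * K + K * K + K * B * K + B * K with hP
  have hP0 : 0 < P := by positivity
  have hDl : ∀ n x y, ‖fderiv ℝ (d n) x - fderiv ℝ (d n) y‖ ≤ K * (K * K + P) ^ n * ‖x - y‖ := by
    intro n
    induction n with
    | zero => simpa [d0] using hcl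
    | succ n ih =>
      intro x y
      have hN := norm_nonneg (x - y)
      have e1 : ‖(d n (S x) - d n (S y)) • fderiv ℝ j x‖ ≤ B * K * K * ‖x - y‖ := by
        rw [norm_smul]
        calc _ ≤ (B * (K * ‖x - y‖)) * K := by
              refine mul_le_mul ?_ (hjb x) (norm_nonneg _) (by positivity)
              exact (hlip (hdd n) (hDB n) _ _).trans (by gcongr; exact hSlip x y)
          _ = _ := by ring
      have e2 : ‖d n (S y) • (fderiv ℝ j x - fderiv ℝ j y)‖ ≤ K * K * ‖x - y‖ := by
        rw [norm_smul, mul_assoc]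
        refine mul_le_mul ((hdb n _).trans ?_) (hjl x y) (norm_nonneg _) hK0.le
        exact mul_le_of_le_one_right hK0.le (pow_le_one₀ hθ.le hθ1.le)
      have e3 : ‖(j x - j y) • (fderiv ℝ (d n) (S x)).comp (fderiv ℝ S x)‖ ≤
          K * B * K * ‖x - y‖ := by
        rw [norm_smul]
        calc _ ≤ (K * ‖x - y‖) * (B * K) := by
              refine mul_le_mul (hlip hj hjb x y) ?_ (norm_nonneg _) (by positivity)
              exact (ContinuousLinearMap.opNorm_comp_le _ _).trans
                (mul_le_mul (hDB n _) (hSb x) (norm_nonneg _) hB.le)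
          _ = _ := by ring
      have e4 : ‖j y • (fderiv ℝ (d n) (S x) - fderiv ℝ (d n) (S y)).comp (fderiv ℝ S x)‖ ≤
          K * K * (K * (K * K + P) ^ n) * ‖x - y‖ := by
        rw [norm_smul]
        calc _ ≤ 1 * ((K * (K * K + P) ^ n * (K * ‖x - y‖)) * K) := by
              refine mul_le_mul ((hjθ y).trans hθ1.le) ?_ (norm_nonneg _) zero_le_one
              refine (ContinuousLinearMap.opNorm_comp_le _ _).trans
                (mul_le_mul ((ih _ _).trans ?_) (hSb x) (norm_nonneg _) (by positivity))
              gcongr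
              exact hSlip x y
          _ = _ := by ring
      have e5 : ‖j y • (fderiv ℝ (d n) (S y)).comp (fderiv ℝ S x - fderiv ℝ S y)‖ ≤
          B * K * ‖x - y‖ := by
        rw [norm_smul]
        calc _ ≤ 1 * (B * (K * ‖x - y‖)) := by
              refine mul_le_mul ((hjθ y).trans hθ1.le) ?_ (norm_nonneg _) zero_le_one
              exact (ContinuousLinearMap.opNorm_comp_le _ _).trans
                (mul_le_mul (hDB n _) (hSl x y) (norm_nonneg _) hB.le)
          _ = _ := by ring
      have e6 : fderiv ℝ (d (n + 1)) x - fderiv ℝ (d (n + 1)) y =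
          (d n (S x) - d n (S y)) • fderiv ℝ j x + d n (S y) • (fderiv ℝ j x - fderiv ℝ j y) +
          (j x - j y) • (fderiv ℝ (d n) (S x)).comp (fderiv ℝ S x) +
          j y • (fderiv ℝ (d n) (S x) - fderiv ℝ (d n) (S y)).comp (fderiv ℝ S x) +
          j y • (fderiv ℝ (d n) (S y)).comp (fderiv ℝ S x - fderiv ℝ S y) := by
        rw [hD, hD]
        ext v
        simp
        ring
      rw [e6]
      have h1 : 1 ≤ K * (K * K + P) ^ n :=
        one_le_mul_of_one_le_of_one_le hK (one_le_pow₀ (by nlinarith))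
      refine (norm_add_le_of_le (norm_add_le_of_le (norm_add_le_of_le (norm_add_le_of_le e1 e2) e3)
        e4) e5).trans ?_
      have h2 : P * ‖x - y‖ ≤ P * (K * (K * K + P) ^ n) * ‖x - y‖ := by
        gcongr
        exact le_mul_of_one_le_right hP0.le h1
      rw [pow_succ]
      rw [hP] at h2 ⊢
      nlinarith
  obtain ⟨α, hα, hα1, C, hC⟩ := exists_holderWith_tsum (D := fun n x => fderiv ℝ (d n) x) hB hθ' hθ'1
    hK0 (M := K * K + P) (by positivity) hDb hDl
  have hgs := summable_geometric_of_lt_one hθ.le hθ1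
  have hs : ∀ x, Summable fun n => d n x := fun x =>
    Summable.of_norm_bounded (hgs.mul_left K) fun n => hdb n x
  have hgs' := (summable_geometric_of_lt_one hθ'.le hθ'1).mul_left B
  have hfd : ∀ x, HasFDerivAt (fun y => ∑' n, d n y) (∑' n, fderiv ℝ (d n) x) x := fun x =>
    hasFDerivAt_tsum hgs' (fun n x => (hdd n x).hasFDerivAt) hDb (hs 0) x
  have hfe : fderiv ℝ (fun y => ∑' n, d n y) = fun x => ∑' n, fderiv ℝ (d n) x :=
    funext fun x => (hfd x).fderiv
  refine ⟨α, hα, hα1, fun x => ∑' n, d n x, ?_, ⟨K * (1 - θ)⁻¹, fun x => ?_⟩,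
    ⟨B * (1 - θ')⁻¹, fun x => ?_⟩, ⟨C, ?_⟩, fun x => ?_⟩
  · rw [contDiff_one_iff_fderiv]
    refine ⟨fun x => (hfd x).differentiableAt, ?_⟩
    rw [hfe]
    exact hC.continuous hα
  · exact tsum_of_norm_bounded (f := fun n => d n x)
      ((hasSum_geometric_of_lt_one hθ.le hθ1).mul_left K) fun n => hdb n x
  · rw [hfe]
    exact tsum_of_norm_bounded ((hasSum_geometric_of_lt_one hθ'.le hθ'1).mul_left B)
      fun n => hDb n x
  · rw [hfe]; exact hC
  · change ∑' n, d n x = c x + j x * ∑' n, d n (S x)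
    rw [(hs x).tsum_eq_zero_add, d0]
    simp only [dS]
    rw [tsum_mul_left]

/-! ### The flow of a vector field `(1, a)` on the plane -/

/-- A bounded Lipschitz vector field is complete. -/
theorem exists_integralCurve {V : Type*} [NormedAddCommGroup V] [NormedSpace ℝ V] [CompleteSpace V]
    {v : V → V} {K L : ℝ≥0} (hv : LipschitzWith K v) (hL : ∀ x, ‖v x‖ ≤ L) (x : V) :
    ∃ γ : ℝ → V, γ 0 = x ∧ ∀ t, HasDerivAt γ (v (γ t)) t := by
  have h1 : ∀ n : ℕ, ∃ γ : ℝ → V, γ 0 = x ∧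
      ∀ t ∈ Ioo (-(n + 1 : ℝ)) (n + 1), HasDerivAt γ (v (γ t)) t := by
    intro n
    have hz : (0 : ℝ) ∈ Icc (-(n + 1 : ℝ)) (n + 1) := by constructor <;> linarith [n.cast_nonneg (α := ℝ)]
    -- A curve of speed at most `L` cannot leave the ball of radius `L (n + 1)` during time `n + 1`,
    -- so the local existence theorem covers the whole interval.
    have hp : IsPicardLindelof (fun _ => v) (⟨0, hz⟩ : Icc (-(n + 1 : ℝ)) (n + 1)) x
        (L * (n + 1)) 0 L K := by
      refine IsPicardLindelof.of_time_independent (fun y _ => hL y) hv.lipschitzOnWith ?_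
      simp
    obtain ⟨γ, h0, h1⟩ := hp.exists_eq_forall_mem_Icc_hasDerivWithinAt₀
    exact ⟨γ, h0, fun t ht => (h1 t (Ioo_subset_Icc_self ht)).hasDerivAt (Icc_mem_nhds ht.1 ht.2)⟩
  choose γ h0 hγ using h1
  have hle : ∀ m n : ℕ, m ≤ n → ∀ t ∈ Ioo (-(m + 1 : ℝ)) (m + 1), γ m t = γ n t := by
    intro m n hmn
    have hmn' : (m : ℝ) ≤ n := by exact_mod_cast hmn
    refine ODE_solution_unique_of_mem_Ioo (v := fun _ => v) (s := fun _ => univ) (K := K) (t₀ := 0)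
      (fun t _ => hv.lipschitzOnWith) ⟨by linarith [m.cast_nonneg (α := ℝ)], by positivity⟩
      (fun t ht => ⟨hγ m t ht, mem_univ _⟩)
      (fun t ht => ⟨hγ n t ⟨by linarith [ht.1], by linarith [ht.2]⟩, mem_univ _⟩) ?_
    rw [h0, h0]
  -- The index jumps at integers, but near `t` every solution that is used agrees with the one of
  -- index `⌈|t|⌉₊ + 1`.
  refine ⟨fun t => γ ⌈|t|⌉₊ t, by simpa using h0 0, fun t => ?_⟩
  have habs : ∀ s : ℝ, s ∈ Ioo (-((⌈|s|⌉₊ : ℝ) + 1)) (⌈|s|⌉₊ + 1) := fun s => by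
    have := Nat.le_ceil |s|
    exact abs_lt.1 (by linarith)
  have hev : (fun t => γ ⌈|t|⌉₊ t) =ᶠ[𝓝 t] γ (⌈|t|⌉₊ + 1) := by
    have : ∀ᶠ s in 𝓝 t, |s| < |t| + 1 :=
      (continuous_abs.tendsto t).eventually_lt_const (by linarith)
    filter_upwards [this] with s hs
    refine hle _ _ ?_ s (habs s)
    rw [Nat.ceil_le]
    push_cast
    linarith [Nat.le_ceil |t|]
  have ht : t ∈ Ioo (-(((⌈|t|⌉₊ + 1 : ℕ) : ℝ) + 1)) ((⌈|t|⌉₊ + 1 : ℕ) + 1) := by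
    have := habs t
    push_cast
    exact ⟨by linarith [this.1], by linarith [this.2]⟩
  have := (hγ (⌈|t|⌉₊ + 1) t ht).congr_of_eventuallyEq hev
  rwa [← hev.eq_of_nhds] at this

/-- The invertible lower triangular map `(r, s) ↦ (p r, q r + d s)`. -/
def lowerTri (p q d : ℝ) (hp : p ≠ 0) (hd : d ≠ 0) : (ℝ × ℝ) ≃L[ℝ] (ℝ × ℝ) :=
  ContinuousLinearEquiv.equivOfInverse
    ((p • ContinuousLinearMap.fst ℝ ℝ ℝ).prod
      (q • ContinuousLinearMap.fst ℝ ℝ ℝ + d • ContinuousLinearMap.snd ℝ ℝ ℝ))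
    ((p⁻¹ • ContinuousLinearMap.fst ℝ ℝ ℝ).prod
      (-(d⁻¹ * q * p⁻¹) • ContinuousLinearMap.fst ℝ ℝ ℝ + d⁻¹ • ContinuousLinearMap.snd ℝ ℝ ℝ))
    (fun z => by
      ext
      · simp [hp]
      · simp only [ContinuousLinearMap.prod_apply, add_apply,
          smul_apply, ContinuousLinearMap.coe_fst',
          ContinuousLinearMap.coe_snd', smul_eq_mul]
        field_simp
        ring)
    (fun z => by
      ext
      · simp [hp]
      · simp only [ContinuousLinearMap.prod_apply, add_apply,
          smul_apply, ContinuousLinearMap.coe_fst',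
          ContinuousLinearMap.coe_snd', smul_eq_mul]
        field_simp
        ring)

theorem coe_lowerTri (p q d : ℝ) (hp : p ≠ 0) (hd : d ≠ 0) :
    (lowerTri p q d hp hd : (ℝ × ℝ) →L[ℝ] (ℝ × ℝ)) = (p • ContinuousLinearMap.fst ℝ ℝ ℝ).prod
      (q • ContinuousLinearMap.fst ℝ ℝ ℝ + d • ContinuousLinearMap.snd ℝ ℝ ℝ) := rfl

theorem lowerTri_apply (p q d : ℝ) (hp : p ≠ 0) (hd : d ≠ 0) (z : ℝ × ℝ) :
    lowerTri p q d hp hd z = (p * z.1, q * z.1 + d * z.2) := rfl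

/-- The vector field `(1, a)`. -/
def slopeField (a : ℝ × ℝ → ℝ) (z : ℝ × ℝ) : ℝ × ℝ := (1, a z)

theorem lipschitzWith_slopeField {a : ℝ × ℝ → ℝ} {K : ℝ≥0} (ha : LipschitzWith K a) :
    LipschitzWith K (slopeField a) := by
  have := (LipschitzWith.const (α := ℝ × ℝ) (1 : ℝ)).prodMk ha
  rwa [max_eq_right zero_le] at this

theorem eq_of_integralCurve {a : ℝ × ℝ → ℝ} {K : ℝ≥0} (ha : LipschitzWith K a) {γ γ' : ℝ → ℝ × ℝ}
    (h : ∀ t, HasDerivAt γ (slopeField a (γ t)) t) (h' : ∀ t, HasDerivAt γ' (slopeField a (γ' t)) t)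
    {t₀ : ℝ} (h0 : γ t₀ = γ' t₀) : γ = γ' :=
  ODE_solution_unique_univ (v := fun _ => slopeField a) (s := fun _ => univ) (K := K)
    (fun _ => (lipschitzWith_slopeField ha).lipschitzOnWith)
    (fun t => ⟨h t, mem_univ _⟩) (fun t => ⟨h' t, mem_univ _⟩) h0

/-- A global flow of the vector field `(1, a)`. -/
structure IsSlopeFlow (a : ℝ × ℝ → ℝ) (Φ : ℝ → ℝ × ℝ → ℝ × ℝ) : Prop where
  zero : ∀ z, Φ 0 z = z
  hasDerivAt : ∀ z t, HasDerivAt (fun t => Φ t z) (slopeField a (Φ t z)) t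

theorem exists_isSlopeFlow {a : ℝ × ℝ → ℝ} {K : ℝ≥0} (ha : LipschitzWith K a) {L : ℝ}
    (hL : ∀ z, |a z| ≤ L) : ∃ Φ, IsSlopeFlow a Φ := by
  have h : ∀ z, ‖slopeField a z‖ ≤ (max 1 L).toNNReal := fun z => by
    rw [Real.coe_toNNReal _ (by positivity), slopeField, Prod.norm_def]
    refine max_le (by simp) ((hL z).trans (le_max_right _ _))
  choose Φ h0 h1 using fun z => exists_integralCurve (lipschitzWith_slopeField ha) h z
  exact ⟨fun t z => Φ z t, h0, h1⟩

namespace IsSlopeFlow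

variable {a : ℝ × ℝ → ℝ} {Φ : ℝ → ℝ × ℝ → ℝ × ℝ}

theorem add (h : IsSlopeFlow a Φ) {K : ℝ≥0} (ha : LipschitzWith K a) (s t : ℝ) (z : ℝ × ℝ) :
    Φ (s + t) z = Φ s (Φ t z) := by
  have := eq_of_integralCurve (γ := fun s => Φ (s + t) z) (γ' := fun s => Φ s (Φ t z)) (t₀ := 0) ha
    (fun s => HasDerivAt.comp_add_const s t (h.hasDerivAt z (s + t))) (h.hasDerivAt (Φ t z))
    (by simp [h.zero])
  exact congrFun this s

theorem neg_cancel (h : IsSlopeFlow a Φ) {K : ℝ≥0} (ha : LipschitzWith K a) (t : ℝ) (z : ℝ × ℝ) :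
    Φ (-t) (Φ t z) = z := by
  rw [← h.add ha, neg_add_cancel, h.zero]

theorem cancel_neg (h : IsSlopeFlow a Φ) {K : ℝ≥0} (ha : LipschitzWith K a) (t : ℝ) (z : ℝ × ℝ) :
    Φ t (Φ (-t) z) = z := by
  rw [← h.add ha, add_neg_cancel, h.zero]

theorem injective (h : IsSlopeFlow a Φ) {K : ℝ≥0} (ha : LipschitzWith K a) (t : ℝ) :
    Function.Injective (Φ t) :=
  Function.LeftInverse.injective (h.neg_cancel ha t)

theorem hasDerivAt_fst (h : IsSlopeFlow a Φ) (z : ℝ × ℝ) (t : ℝ) :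
    HasDerivAt (fun t => (Φ t z).1) 1 t :=
  (hasFDerivAt_fst (𝕜 := ℝ) (E := ℝ) (F := ℝ)).comp_hasDerivAt t (h.hasDerivAt z t)

theorem hasDerivAt_snd (h : IsSlopeFlow a Φ) (z : ℝ × ℝ) (t : ℝ) :
    HasDerivAt (fun t => (Φ t z).2) (a (Φ t z)) t :=
  (hasFDerivAt_snd (𝕜 := ℝ) (E := ℝ) (F := ℝ)).comp_hasDerivAt t (h.hasDerivAt z t)

theorem fst (h : IsSlopeFlow a Φ) (t : ℝ) (z : ℝ × ℝ) : (Φ t z).1 = z.1 + t := by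
  have h1 : ∀ t, HasDerivAt (fun t => (Φ t z).1 - t) 0 t := fun t => by
    simpa using (h.hasDerivAt_fst z t).fun_sub (hasDerivAt_id' t)
  have h2 := is_const_of_deriv_eq_zero (fun t => (h1 t).differentiableAt) (fun t => (h1 t).deriv) t 0
  simp only [h.zero] at h2
  linarith

theorem continuous_left (h : IsSlopeFlow a Φ) (z : ℝ × ℝ) : Continuous fun t => Φ t z :=
  continuous_iff_continuousAt.2 fun t => (h.hasDerivAt z t).continuousAt

/-- The difference of two solutions is the exponential of the integral of the difference
quotients. -/
theorem snd_sub_snd (h : IsSlopeFlow a Φ) {K : ℝ≥0} (ha : LipschitzWith K a) {s s' : ℝ}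
    (hs : s' ≠ s) (r : ℝ) :
    (Φ r (0, s')).2 - (Φ r (0, s)).2 = (s' - s) * Real.exp (∫ τ in (0 : ℝ)..r,
      (a (Φ τ (0, s')) - a (Φ τ (0, s))) / ((Φ τ (0, s')).2 - (Φ τ (0, s)).2)) := by
  -- Both solutions have first coordinate `τ`; if their second coordinates met, injectivity of the
  -- time-`τ` map would force `s' = s`.
  have hne : ∀ τ, (Φ τ (0, s')).2 - (Φ τ (0, s)).2 ≠ 0 := by
    intro τ h0
    refine hs ?_
    have : Φ τ (0, s') = Φ τ (0, s) := by
      refine Prod.ext ?_ (sub_eq_zero.1 h0)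
      rw [h.fst, h.fst]
    exact congrArg Prod.snd (h.injective ha τ this)
  have hcont : Continuous fun τ =>
      (a (Φ τ (0, s')) - a (Φ τ (0, s))) / ((Φ τ (0, s')).2 - (Φ τ (0, s)).2) := by
    refine Continuous.div ?_ ?_ hne
    · exact (ha.continuous.comp (h.continuous_left _)).sub (ha.continuous.comp (h.continuous_left _))
    · exact (continuous_snd.comp (h.continuous_left _)).sub
        (continuous_snd.comp (h.continuous_left _))
  set A : ℝ → ℝ := fun τ =>
      (a (Φ τ (0, s')) - a (Φ τ (0, s))) / ((Φ τ (0, s')).2 - (Φ τ (0, s)).2) with hA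
  -- The difference `y` of the two solutions satisfies the linear equation `y' = A y`;
  -- multiplication by the integrating factor makes it constant.
  have h1 : ∀ t, HasDerivAt (fun t => ((Φ t (0, s')).2 - (Φ t (0, s)).2) *
      Real.exp (-∫ τ in (0 : ℝ)..t, A τ)) 0 t := by
    intro t
    have e1 := (h.hasDerivAt_snd (0, s') t).sub (h.hasDerivAt_snd (0, s) t)
    have e2 := (hcont.integral_hasStrictDerivAt 0 t).hasDerivAt.neg.exp
    have e3 := e1.mul e2
    refine e3.congr_deriv ?_
    have : a (Φ t (0, s')) - a (Φ t (0, s)) = A t * ((Φ t (0, s')).2 - (Φ t (0, s)).2) := by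
      rw [hA]; field_simp [hne t]
    rw [this]
    simp only [Pi.sub_apply]
    ring
  have h2 := is_const_of_deriv_eq_zero (fun t => (h1 t).differentiableAt) (fun t => (h1 t).deriv) r 0
  simp only [h.zero, intervalIntegral.integral_same, neg_zero, Real.exp_zero, mul_one] at h2
  rw [← h2, mul_assoc, ← Real.exp_add]
  simp

theorem abs_slope_le {K : ℝ≥0} (ha : LipschitzWith K a) {z z' : ℝ × ℝ} (hz : z'.1 = z.1) :
    |(a z' - a z) / (z'.2 - z.2)| ≤ K := by
  rw [abs_div]
  refine div_le_of_le_mul₀ (abs_nonneg _) K.2 ?_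
  have := ha.dist_le_mul z' z
  rwa [Real.dist_eq, Prod.dist_eq, hz, dist_self, max_eq_right dist_nonneg, Real.dist_eq] at this

/-- The Grönwall bound, read off from the exact formula, as the difference quotients are bounded by
`K`. -/
theorem abs_snd_sub_le (h : IsSlopeFlow a Φ) {K : ℝ≥0} (ha : LipschitzWith K a) (r s s' : ℝ) :
    |(Φ r (0, s')).2 - (Φ r (0, s)).2| ≤ Real.exp (K * |r|) * |s' - s| := by
  rcases eq_or_ne s' s with rfl | hs
  · simp
  rw [h.snd_sub_snd ha hs, abs_mul, mul_comm, abs_of_pos (Real.exp_pos _)]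
  gcongr
  refine (le_abs_self _).trans ?_
  have := intervalIntegral.norm_integral_le_of_norm_le_const (a := 0) (b := r) (C := K)
    (f := fun τ => (a (Φ τ (0, s')) - a (Φ τ (0, s))) / ((Φ τ (0, s')).2 - (Φ τ (0, s)).2))
    fun τ _ => abs_slope_le ha (by rw [h.fst, h.fst])
  simpa using this

/-- The logarithm of the derivative of the flow in the vertical direction. -/
def logDeriv (a : ℝ × ℝ → ℝ) (Φ : ℝ → ℝ × ℝ → ℝ × ℝ) (z : ℝ × ℝ) : ℝ :=
  ∫ τ in (0 : ℝ)..z.1, fderiv ℝ a (Φ τ (0, z.2)) (0, 1)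

/-- The exact formula for the difference of two solutions turns the difference quotient into the
exponential of an integral. Its integrand is bounded by `K` and tends to the vertical derivative of
`a`, so dominated convergence applies. -/
theorem hasDerivAt_vertical (h : IsSlopeFlow a Φ) {K : ℝ≥0} (ha : LipschitzWith K a)
    (hd : Differentiable ℝ a) (r s : ℝ) :
    HasDerivAt (fun s => (Φ r (0, s)).2) (Real.exp (logDeriv a Φ (r, s))) s := by
  rw [hasDerivAt_iff_tendsto_slope]
  have h1 : Tendsto (fun s' => Real.exp (∫ τ in (0 : ℝ)..r,
      (a (Φ τ (0, s')) - a (Φ τ (0, s))) / ((Φ τ (0, s')).2 - (Φ τ (0, s)).2))) (𝓝[≠] s)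
      (𝓝 (Real.exp (logDeriv a Φ (r, s)))) := by
    refine (Real.continuous_exp.tendsto _).comp ?_
    refine intervalIntegral.tendsto_integral_filter_of_dominated_convergence (fun _ => (K : ℝ))
      ?_ ?_ intervalIntegrable_const ?_
    · refine Eventually.of_forall fun s' => Measurable.aestronglyMeasurable ?_
      have e : ∀ s, Measurable fun τ => Φ τ (0, s) := fun s => (h.continuous_left _).measurable
      exact ((ha.continuous.measurable.comp (e s')).sub (ha.continuous.measurable.comp (e s))).div
        ((measurable_snd.comp (e s')).sub (measurable_snd.comp (e s)))
    · exact Eventually.of_forall fun s' => Eventually.of_forall fun τ _ =>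
        abs_slope_le ha (by rw [h.fst, h.fst])
    · refine Eventually.of_forall fun τ _ => ?_
      set c := (Φ τ (0, s)).2 with hc
      have hΦ : ∀ s', Φ τ (0, s') = (τ, (Φ τ (0, s')).2) := fun s' =>
        Prod.ext (by rw [h.fst]; simp) rfl
      have e1 : HasDerivAt (fun σ => a (τ, σ)) (fderiv ℝ a (Φ τ (0, s)) (0, 1)) c := by
        rw [hΦ s, ← hc]
        exact (hd (τ, c)).hasFDerivAt.comp_hasDerivAt c
          ((hasDerivAt_const c τ).prodMk (hasDerivAt_id c))
      have e2 := e1.tendsto_slope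
      have e3 : Tendsto (fun s' => (Φ τ (0, s')).2) (𝓝[≠] s) (𝓝[≠] c) := by
        refine tendsto_nhdsWithin_iff.2 ⟨?_, ?_⟩
        · have : Continuous fun s' => (Φ τ (0, s')).2 :=
            (LipschitzWith.of_dist_le_mul (K := (Real.exp (K * |τ|)).toNNReal) fun x y => by
              rw [Real.coe_toNNReal _ (Real.exp_pos _).le]
              exact h.abs_snd_sub_le ha τ y x).continuous
          exact (this.tendsto s).mono_left nhdsWithin_le_nhds
        · filter_upwards [self_mem_nhdsWithin] with s' hs' h0
          refine hs' ?_
          have : Φ τ (0, s') = Φ τ (0, s) := Prod.ext (by rw [h.fst, h.fst]) h0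
          exact congrArg Prod.snd (h.injective ha τ this)
      refine (e2.comp e3).congr fun s' => ?_
      simp only [Function.comp_apply, slope_def_field]
      rw [← hΦ s', hc, ← hΦ s]
  refine h1.congr' ?_
  filter_upwards [self_mem_nhdsWithin] with s' hs'
  rw [slope_def_field, h.snd_sub_snd ha hs', mul_div_cancel_left₀ _ (sub_ne_zero.2 hs')]

/-- A change of the upper limit `z.1` costs a Lipschitz error. A change of `z.2` costs the Hölder
modulus of `fderiv a` at the distance of two orbits, which grows at most by the factor `exp (K R)`.
-/
theorem locHolder_logDeriv (h : IsSlopeFlow a Φ) {K : ℝ≥0} (ha : LipschitzWith K a)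
    (hd : ContDiff ℝ 1 a) {α C : ℝ≥0} (hα : α ≤ 1) (hC : HolderWith C α (fderiv ℝ a)) :
    LocHolder α (logDeriv a Φ) := by
  intro z₀
  set R : ℝ := |z₀.1| + 1 with hR
  have hR0 : 0 < R := by positivity
  set M : ℝ := K + C * Real.exp (K * R) ^ (α : ℝ) * R with hM
  have hM0 : 0 ≤ M := by positivity
  have hnorm : ‖((0 : ℝ), (1 : ℝ))‖ = 1 := by simp [Prod.norm_def]
  refine ⟨Metric.ball z₀ (1 / 2), Metric.ball_mem_nhds _ (by norm_num), M.toNNReal, ?_⟩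
  intro z hz z' hz'
  have hd1 : dist z z' ≤ 1 := by
    have := dist_triangle_right z z' z₀
    linarith [Metric.mem_ball.1 hz, Metric.mem_ball.1 hz']
  have hr : |z'.1| ≤ R := by
    have h1 : dist z'.1 z₀.1 ≤ dist z' z₀ := le_max_left _ _
    rw [Real.dist_eq] at h1
    have := abs_sub_abs_le_abs_sub z'.1 z₀.1
    linarith [Metric.mem_ball.1 hz']
  have hcont : ∀ s, Continuous fun τ => fderiv ℝ a (Φ τ (0, s)) (0, 1) := fun s =>
    ((hd.continuous_fderiv one_ne_zero).comp (h.continuous_left _)).clm_apply continuous_const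
  have hK : ∀ z, |fderiv ℝ a z (0, 1)| ≤ K := fun z => by
    have := (fderiv ℝ a z).le_of_opNorm_le (norm_fderiv_le_of_lipschitz ℝ ha) ((0 : ℝ), (1 : ℝ))
    rwa [hnorm, mul_one] at this
  have e0 : logDeriv a Φ z - logDeriv a Φ z' =
      (∫ τ in z'.1..z.1, fderiv ℝ a (Φ τ (0, z.2)) (0, 1)) + ∫ τ in (0 : ℝ)..z'.1,
        (fderiv ℝ a (Φ τ (0, z.2)) (0, 1) - fderiv ℝ a (Φ τ (0, z'.2)) (0, 1)) := by
    rw [intervalIntegral.integral_sub ((hcont _).intervalIntegrable _ _)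
      ((hcont _).intervalIntegrable _ _), logDeriv, logDeriv,
      ← intervalIntegral.integral_add_adjacent_intervals (a := 0) (b := z'.1) (c := z.1)
      ((hcont _).intervalIntegrable _ _) ((hcont _).intervalIntegrable _ _)]
    ring
  have e1 : |∫ τ in z'.1..z.1, fderiv ℝ a (Φ τ (0, z.2)) (0, 1)| ≤ K * dist z z' ^ (α : ℝ) := by
    refine (intervalIntegral.norm_integral_le_of_norm_le_const (C := K)
      (f := fun τ => fderiv ℝ a (Φ τ (0, z.2)) (0, 1)) fun τ _ => hK _).trans ?_
    gcongr
    calc |z.1 - z'.1| ≤ dist z z' := le_max_left _ _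
      _ ≤ dist z z' ^ (α : ℝ) := Real.self_le_rpow_of_le_one dist_nonneg hd1 (by exact_mod_cast hα)
  have e2 : |∫ τ in (0 : ℝ)..z'.1,
        (fderiv ℝ a (Φ τ (0, z.2)) (0, 1) - fderiv ℝ a (Φ τ (0, z'.2)) (0, 1))| ≤
        C * Real.exp (K * R) ^ (α : ℝ) * R * dist z z' ^ (α : ℝ) := by
    refine (intervalIntegral.norm_integral_le_of_norm_le_const (f := fun τ =>
        (fderiv ℝ a (Φ τ (0, z.2)) (0, 1) - fderiv ℝ a (Φ τ (0, z'.2)) (0, 1)))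
      (C := C * (Real.exp (K * R) * dist z z') ^ (α : ℝ)) fun τ hτ => ?_).trans ?_
    · have hτR : |τ| ≤ R := by
        refine le_trans ?_ hr
        have := uIoc_subset_uIcc hτ
        have h2 := abs_sub_left_of_mem_uIcc this
        simpa using h2
      rw [← sub_apply]
      refine (ContinuousLinearMap.le_opNorm _ _).trans ?_
      rw [hnorm, mul_one, ← dist_eq_norm]
      refine (hC.dist_le _ _).trans ?_
      gcongr
      rw [Prod.dist_eq, h.fst, h.fst, dist_self, max_eq_right dist_nonneg, Real.dist_eq]
      refine (h.abs_snd_sub_le ha _ _ _).trans ?_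
      gcongr
      exact le_max_right (dist z.1 z'.1) (dist z.2 z'.2)
    · rw [sub_zero, Real.mul_rpow (Real.exp_pos _).le dist_nonneg]
      calc _ ≤ C * (Real.exp (K * R) ^ (α : ℝ) * dist z z' ^ (α : ℝ)) * R := by gcongr
        _ = _ := by ring
  have e3 : dist (logDeriv a Φ z) (logDeriv a Φ z') ≤ M * dist z z' ^ (α : ℝ) := by
    rw [Real.dist_eq, e0, hM, add_mul]
    exact (abs_add_le _ _).trans (add_le_add e1 e2)
  rw [edist_dist, edist_dist, ENNReal.ofReal_rpow_of_nonneg dist_nonneg α.coe_nonneg]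
  change _ ≤ ENNReal.ofReal M * _
  rw [← ENNReal.ofReal_mul hM0]
  exact ENNReal.ofReal_le_ofReal e3

/-- The map `(r, s) ↦ Φ r (0, s)`, straightening the flow. -/
def straighten (h : IsSlopeFlow a Φ) {K : ℝ≥0} (ha : LipschitzWith K a) : (ℝ × ℝ) ≃ (ℝ × ℝ) where
  toFun z := Φ z.1 (0, z.2)
  invFun z := (z.1, (Φ (-z.1) z).2)
  left_inv z := by
    have h1 : (Φ z.1 (0, z.2)).1 = z.1 := by rw [h.fst]; simp
    ext
    · exact h1
    · simp only [h1, h.neg_cancel ha]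
  right_inv z := by
    have h1 : ((0 : ℝ), (Φ (-z.1) z).2) = Φ (-z.1) z := Prod.ext (by rw [h.fst]; simp) rfl
    simp only [h1, h.cancel_neg ha]

/-- The partial derivatives of `(r, s) ↦ Φ r (0, s)` are `(1, a)` along the orbit and `(0, exp
(logDeriv))`. Their joint continuity gives differentiability, and their Hölder regularity comes from
`locHolder_logDeriv`. -/
theorem isC1HolderOn_straighten (h : IsSlopeFlow a Φ) {K : ℝ≥0} (ha : LipschitzWith K a)
    (hd : ContDiff ℝ 1 a) {α C : ℝ≥0} (hα0 : 0 < α) (hα : α ≤ 1)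
    (hC : HolderWith C α (fderiv ℝ a)) :
    IsC1HolderOn α (h.straighten ha) univ ∧ ∀ z, HasFDerivAt (h.straighten ha)
      (lowerTri 1 (a (h.straighten ha z)) (Real.exp (logDeriv a Φ z)) one_ne_zero
        (Real.exp_pos _).ne' : (ℝ × ℝ) →L[ℝ] (ℝ × ℝ)) z := by
  have hl := h.locHolder_logDeriv ha hd hα hC
  have hlc : Continuous (logDeriv a Φ) := by
    refine continuous_iff_continuousAt.2 fun z => ?_
    obtain ⟨U, hU, C, hC⟩ := hl z
    exact (hC.continuousOn hα0).continuousAt hU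
  have hΘc : Continuous fun z : ℝ × ℝ => Φ z.1 (0, z.2) := by
    have : Continuous fun z : ℝ × ℝ => (Φ z.1 (0, z.2)).2 := by
      rw [continuous_iff_continuousAt]
      intro z₀
      have h1 : Tendsto (fun z : ℝ × ℝ => Real.exp (K * |z.1|) * |z.2 - z₀.2| +
          |(Φ z.1 (0, z₀.2)).2 - (Φ z₀.1 (0, z₀.2)).2|) (𝓝 z₀) (𝓝 0) := by
        have : Continuous fun z : ℝ × ℝ => Real.exp (K * |z.1|) * |z.2 - z₀.2| +
          |(Φ z.1 (0, z₀.2)).2 - (Φ z₀.1 (0, z₀.2)).2| := by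
          have := h.continuous_left (0, z₀.2)
          fun_prop
        simpa using this.tendsto z₀
      refine tendsto_iff_dist_tendsto_zero.2 (squeeze_zero (fun _ => dist_nonneg) (fun z => ?_) h1)
      rw [Real.dist_eq]
      have := h.abs_snd_sub_le ha z.1 z₀.2 z.2
      have h3 := abs_sub_le (Φ z.1 (0, z.2)).2 (Φ z.1 (0, z₀.2)).2 (Φ z₀.1 (0, z₀.2)).2
      linarith
    have h2 : (fun z : ℝ × ℝ => Φ z.1 (0, z.2)) = fun z => (z.1, (Φ z.1 (0, z.2)).2) := by
      funext z
      exact Prod.ext (by rw [h.fst]; simp) rfl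
    rw [h2]
    exact continuous_fst.prodMk this
  have hF : ∀ z, HasFDerivAt (h.straighten ha)
      (lowerTri 1 (a (h.straighten ha z)) (Real.exp (logDeriv a Φ z)) one_ne_zero
        (Real.exp_pos _).ne' : (ℝ × ℝ) →L[ℝ] (ℝ × ℝ)) z := by
    intro z
    have h1 : HasStrictFDerivAt (↿fun (r s : ℝ) => (Φ r (0, s)).2)
        ((ContinuousLinearMap.toSpanSingleton ℝ (a (Φ z.1 (0, z.2)))).coprod
          (ContinuousLinearMap.toSpanSingleton ℝ (Real.exp (logDeriv a Φ z)))) z := by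
      refine hasStrictFDerivAt_uncurry_coprod (u := z)
        (f₁ := fun r s => ContinuousLinearMap.toSpanSingleton ℝ (a (Φ r (0, s))))
        (f₂ := fun r s => ContinuousLinearMap.toSpanSingleton ℝ (Real.exp (logDeriv a Φ (r, s))))
        (Eventually.of_forall fun v => (h.hasDerivAt_snd (0, v.2) v.1).hasFDerivAt)
        (Eventually.of_forall fun v =>
          (h.hasDerivAt_vertical ha (hd.differentiable one_ne_zero) v.1 v.2).hasFDerivAt) ?_ ?_
      · refine Continuous.continuousAt ?_
        exact (ContinuousLinearMap.toSpanSingletonCLE (𝕜 := ℝ) (E := ℝ)).continuous.comp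
          (ha.continuous.comp hΘc)
      · refine Continuous.continuousAt ?_
        exact (ContinuousLinearMap.toSpanSingletonCLE (𝕜 := ℝ) (E := ℝ)).continuous.comp
          (Real.continuous_exp.comp hlc)
    have h2 : HasFDerivAt (fun z : ℝ × ℝ => (z.1, (Φ z.1 (0, z.2)).2)) _ z :=
      (hasFDerivAt_fst (𝕜 := ℝ)).prodMk h1.hasFDerivAt
    have h3 : (h.straighten ha : ℝ × ℝ → ℝ × ℝ) = fun z : ℝ × ℝ => (z.1, (Φ z.1 (0, z.2)).2) := by
      funext z
      exact Prod.ext (by change (Φ z.1 (0, z.2)).1 = z.1; rw [h.fst]; simp) rfl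
    have h4 : (lowerTri 1 (a (h.straighten ha z)) (Real.exp (logDeriv a Φ z)) one_ne_zero
        (Real.exp_pos _).ne' : (ℝ × ℝ) →L[ℝ] (ℝ × ℝ)) = (ContinuousLinearMap.fst ℝ ℝ ℝ).prod
        ((ContinuousLinearMap.toSpanSingleton ℝ (a (Φ z.1 (0, z.2)))).coprod
          (ContinuousLinearMap.toSpanSingleton ℝ (Real.exp (logDeriv a Φ z)))) := by
      rw [coe_lowerTri]
      ext <;> simp [straighten]
    rw [h4, h3]
    exact h2
  refine ⟨isC1HolderOn_univ.2 ?_, hF⟩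
  have hfe : fderiv ℝ (h.straighten ha) = (fun q : ℝ × ℝ =>
      (ContinuousLinearMap.fst ℝ ℝ ℝ).prod (q.1 • ContinuousLinearMap.fst ℝ ℝ ℝ +
        Real.exp q.2 • ContinuousLinearMap.snd ℝ ℝ ℝ)) ∘
      fun z => (a (h.straighten ha z), logDeriv a Φ z) := by
    funext z
    rw [(hF z).fderiv, coe_lowerTri, one_smul]
    rfl
  have hP : ContDiff ℝ 1 fun q : ℝ × ℝ => (ContinuousLinearMap.fst ℝ ℝ ℝ).prod
      (q.1 • ContinuousLinearMap.fst ℝ ℝ ℝ + Real.exp q.2 • ContinuousLinearMap.snd ℝ ℝ ℝ) := by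
    have : (fun q : ℝ × ℝ => (ContinuousLinearMap.fst ℝ ℝ ℝ).prod
        (q.1 • ContinuousLinearMap.fst ℝ ℝ ℝ + Real.exp q.2 • ContinuousLinearMap.snd ℝ ℝ ℝ)) =
        fun q => (ContinuousLinearMap.inl ℝ ℝ ℝ).comp (ContinuousLinearMap.fst ℝ ℝ ℝ) +
          (ContinuousLinearMap.inr ℝ ℝ ℝ).comp (q.1 • ContinuousLinearMap.fst ℝ ℝ ℝ +
            Real.exp q.2 • ContinuousLinearMap.snd ℝ ℝ ℝ) := by
      funext q
      ext <;> simp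
    rw [this]
    fun_prop
  have hΘ : ContDiff ℝ 1 (h.straighten ha) := by
    rw [contDiff_one_iff_fderiv]
    refine ⟨fun z => (hF z).differentiableAt, ?_⟩
    rw [hfe]
    exact hP.continuous.comp ((ha.continuous.comp hΘc).prodMk hlc)
  refine ⟨hΘ, ?_⟩
  rw [hfe]
  exact (LocHolder.prodMk (LocHolder.of_contDiff hα (hd.comp hΘ)) hl).contDiffAt_comp
    ((ha.continuous.comp hΘc).prodMk hlc) fun z => hP.contDiffAt

/-- The flow of a `C^{1+α}` slope field is jointly `C^{1+α}`. -/
theorem isC1HolderOn (h : IsSlopeFlow a Φ) {K : ℝ≥0} (ha : LipschitzWith K a)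
    (hd : ContDiff ℝ 1 a) {α C : ℝ≥0} (hα0 : 0 < α) (hα : α ≤ 1)
    (hC : HolderWith C α (fderiv ℝ a)) :
    IsC1HolderOn α (fun q : ℝ × (ℝ × ℝ) => Φ q.1 q.2) univ := by
  obtain ⟨h1, h2⟩ := h.isC1HolderOn_straighten ha hd hα0 hα hC
  have h3 := IsC1HolderOn.symm (h.straighten ha) h1 _ h2
  -- In the straightened coordinates the flow is the translation `(r, s) ↦ (r + t, s)`.
  have e : (fun q : ℝ × (ℝ × ℝ) => Φ q.1 q.2) = h.straighten ha ∘
      (fun q : ℝ × (ℝ × ℝ) => (q.1 + q.2.1, q.2.2)) ∘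
      fun q : ℝ × (ℝ × ℝ) => (q.1, (h.straighten ha).symm q.2) := by
    funext q
    have h4 : q.2 = h.straighten ha ((h.straighten ha).symm q.2) :=
      ((h.straighten ha).apply_symm_apply q.2).symm
    simp only [Function.comp_apply]
    conv_lhs => rw [h4]
    exact (h.add ha q.1 _ _).symm
  rw [e]
  refine h1.comp (IsC1HolderOn.comp (isC1HolderOn_of_contDiff hα (by fun_prop))
    (IsC1HolderOn.prodMk (isC1HolderOn_of_contDiff hα contDiff_fst) ?_))
  exact IsC1HolderOn.comp h3 (isC1HolderOn_of_contDiff hα contDiff_snd)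

end IsSlopeFlow

/-! ### The one-dimensional profile of the perturbation -/

/-- A smooth even plateau function. -/
def plateau (s : ℝ) : ℝ := Real.smoothTransition (2 - s ^ 2)

theorem plateau_nonneg (s : ℝ) : 0 ≤ plateau s := Real.smoothTransition.nonneg _

theorem plateau_le_one (s : ℝ) : plateau s ≤ 1 := Real.smoothTransition.le_one _

theorem plateau_eq_one {s : ℝ} (hs : |s| ≤ 1) : plateau s = 1 :=
  Real.smoothTransition.one_of_one_le (by
    have := (sq_le_one_iff_abs_le_one s).2 hs
    linarith)

theorem plateau_eq_zero {s : ℝ} (hs : 2 ≤ |s|) : plateau s = 0 :=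
  Real.smoothTransition.zero_of_nonpos (by nlinarith [sq_abs s])

theorem plateau_neg (s : ℝ) : plateau (-s) = plateau s := by simp [plateau]

theorem plateau_anti {s t : ℝ} (hs : 0 ≤ s) (hst : s ≤ t) : plateau t ≤ plateau s :=
  Real.smoothTransition.monotone (by nlinarith)

theorem contDiff_plateau {n : ℕ∞} : ContDiff ℝ n plateau :=
  Real.smoothTransition.contDiff.comp (by fun_prop)

/-- The odd primitive of the plateau function. -/
def ramp (s : ℝ) : ℝ := ∫ τ in (0 : ℝ)..s, plateau τ

theorem continuous_plateau : Continuous plateau := (contDiff_plateau (n := 0)).continuous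

theorem hasDerivAt_ramp (s : ℝ) : HasDerivAt ramp (plateau s) s :=
  (continuous_plateau.integral_hasStrictDerivAt 0 s).hasDerivAt

theorem deriv_ramp : deriv ramp = plateau := funext fun s => (hasDerivAt_ramp s).deriv

theorem contDiff_ramp {n : ℕ∞} : ContDiff ℝ n ramp := by
  have : ContDiff ℝ (⊤ : ℕ∞) ramp := by
    rw [contDiff_infty_iff_deriv, deriv_ramp]
    exact ⟨fun s => (hasDerivAt_ramp s).differentiableAt, contDiff_plateau⟩
  exact this.of_le (by exact_mod_cast le_top)

theorem ramp_neg (s : ℝ) : ramp (-s) = -ramp s := by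
  have h := intervalIntegral.integral_comp_neg (a := 0) (b := s) plateau
  simp only [plateau_neg, neg_zero] at h
  rw [ramp, ramp, h, intervalIntegral.integral_symm]

theorem ramp_eq_self {s : ℝ} (hs : 0 ≤ s) (hs1 : s ≤ 1) : ramp s = s := by
  rw [ramp, intervalIntegral.integral_congr (g := fun _ => (1 : ℝ))]
  · simp
  · intro τ hτ
    rw [uIcc_of_le hs] at hτ
    exact plateau_eq_one (abs_le.2 ⟨by linarith [hτ.1], by linarith [hτ.2]⟩)

theorem ramp_eq_of_two_le {s : ℝ} (hs : 2 ≤ s) : ramp s = ramp 2 := by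
  rw [ramp, ramp, ← intervalIntegral.integral_add_adjacent_intervals (b := 2)
    (continuous_plateau.intervalIntegrable _ _) (continuous_plateau.intervalIntegrable _ _),
    intervalIntegral.integral_congr (a := 2) (g := fun _ => (0 : ℝ))]
  · simp
  · intro τ hτ
    rw [uIcc_of_le hs] at hτ
    exact plateau_eq_zero (hτ.1.trans (le_abs_self τ))

/-- `s ↦ λ⁻¹ s + B s` is an increasing diffeomorphism of the line, expanding near `0`, contracting
outside `(-q, q)`, moving the points of `(0, q]` away from `0`, and linear outside `(-τ, τ)`. -/
structure IsProfile (lam : ℝ) (B : ℝ → ℝ) (q τ η : ℝ) : Prop where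
  smooth : ContDiff ℝ (⊤ : ℕ∞) B
  odd : ∀ s, B (-s) = -B s
  support : ∀ s, τ ≤ |s| → B s = 0
  abs_le : ∀ s, |B s| ≤ τ
  deriv_pos : ∀ s, 0 < lam⁻¹ + deriv B s
  deriv_le : ∀ s, lam⁻¹ + deriv B s ≤ (1 + lam) / 2
  deriv_zero : 1 < lam⁻¹ + deriv B 0
  q_pos : 0 < q
  q_lt : q < τ
  push : ∀ s, 0 < s → s ≤ q → (1 - lam⁻¹) * s < B s
  eta_lt : η < 1
  le_eta : lam⁻¹ ≤ η
  deriv_le_eta : ∀ s, q ≤ |s| → lam⁻¹ + deriv B s ≤ η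

/-- Conjugation by a homothety leaves all derivatives, hence `η`, unchanged, while support and size
shrink. The perturbation can thus be made small without weakening the source. -/
theorem IsProfile.scale {lam : ℝ} {B : ℝ → ℝ} {q τ η : ℝ} (h : IsProfile lam B q τ η) {δ : ℝ}
    (hδ : 0 < δ) : IsProfile lam (fun s => δ * B (s / δ)) (δ * q) (δ * τ) η := by
  have hd : ∀ s, deriv (fun s => δ * B (s / δ)) s = deriv B (s / δ) := by
    intro s
    have h1 : HasDerivAt B (deriv B (s / δ)) (s / δ) :=
      ((h.smooth.differentiable (by simp)) _).hasDerivAt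
    have h2 := ((h1.comp s ((hasDerivAt_id' s).div_const δ)).const_mul δ).deriv
    rw [show (fun s => δ * B (s / δ)) = fun y => δ * (B ∘ fun s => s / δ) y from rfl, h2]
    field_simp
  have habs : ∀ s, |s / δ| = |s| / δ := fun s => by rw [abs_div, abs_of_pos hδ]
  have hsm := h.smooth
  refine ⟨by fun_prop, fun s => ?_, fun s hs => ?_, fun s => ?_, fun s => ?_, fun s => ?_, ?_,
    mul_pos hδ h.q_pos, mul_lt_mul_of_pos_left h.q_lt hδ, fun s hs hs' => ?_, h.eta_lt, h.le_eta,
    fun s hs => ?_⟩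
  · rw [neg_div, h.odd]; ring
  · rw [h.support, mul_zero]
    rw [habs, le_div_iff₀ hδ]; linarith
  · rw [abs_mul, abs_of_pos hδ]; gcongr; exact h.abs_le _
  · rw [hd]; exact h.deriv_pos _
  · rw [hd]; exact h.deriv_le _
  · rw [hd, zero_div]; exact h.deriv_zero
  · have := h.push (s / δ) (by positivity) (by rw [div_le_iff₀ hδ]; linarith)
    calc (1 - lam⁻¹) * s = δ * ((1 - lam⁻¹) * (s / δ)) := by field_simp
      _ < _ := by gcongr
  · rw [hd]
    refine h.deriv_le_eta _ ?_
    rw [habs, le_div_iff₀ hδ]; linarith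

/-- The profile is `c (ramp s - ramp (s / K))`. The first ramp raises the derivative near `0` from
`λ⁻¹` almost to `(1 + λ) / 2`. The second brings the function back to zero with slope at least `-c /
K`, too gentle to destroy monotonicity. On `[0, 2]` the derivative `D` decreases, so `q` is chosen
just after the last point where the total derivative is at least `1`. -/
theorem exists_isProfile {lam : ℝ} (hlam : 1 < lam) : ∃ B q τ η, IsProfile lam B q τ η := by
  have hl0 : 0 < lam := by linarith
  set ν := lam⁻¹ with hν
  have hν0 : 0 < ν := inv_pos.2 hl0
  have hν1 : ν < 1 := inv_lt_one_of_one_lt₀ hlam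
  set c := (1 + lam) / 2 - ν with hc
  have hc0 : 0 < c := by linarith
  -- `K > 2` makes the second plateau constant on `[0, 2]`; `c / K < ν` keeps the derivative
  -- positive; `c / K < (λ - 1) / 2` keeps it above `1` at the origin.
  obtain ⟨K, hK⟩ := exists_gt (max 2 (max (c / ν) (c / ((lam - 1) / 2))))
  have hK2 : 2 < K := (le_max_left _ _).trans_lt hK
  have hK0 : 0 < K := by linarith
  have hK1 : c / K < ν := by
    have : c / ν < K := (le_max_left _ _).trans_lt ((le_max_right _ _).trans_lt hK)
    rw [div_lt_iff₀ hν0] at this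
    rw [div_lt_iff₀ hK0]; linarith
  have hK3 : c / K < (lam - 1) / 2 := by
    have : c / ((lam - 1) / 2) < K := (le_max_right _ _).trans_lt ((le_max_right _ _).trans_lt hK)
    rw [div_lt_iff₀ (by linarith)] at this
    rw [div_lt_iff₀ hK0]; linarith
  have hcK : 0 < c / K := by positivity
  set B : ℝ → ℝ := fun s => c * (ramp s - ramp (s / K)) with hB
  set D : ℝ → ℝ := fun s => c * plateau s - c / K * plateau (s / K) with hD
  have hBD : ∀ s, HasDerivAt B (D s) s := by
    intro s
    have h1 : HasDerivAt (fun s => ramp (s / K)) (plateau (s / K) * (1 / K)) s :=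
      (hasDerivAt_ramp (s / K)).comp (h := fun s => s / K) s ((hasDerivAt_id' s).div_const K)
    refine (((hasDerivAt_ramp s).sub h1).const_mul c).congr_deriv ?_
    rw [hD]; field_simp
  have hdB : ∀ s, deriv B s = D s := fun s => (hBD s).deriv
  have hBs : ContDiff ℝ (⊤ : ℕ∞) B := by
    have h1 := contDiff_ramp (n := ⊤)
    have h2 : ContDiff ℝ (⊤ : ℕ∞) fun s : ℝ => ramp (s / K) := h1.comp (by fun_prop)
    exact contDiff_const.mul (h1.sub h2)
  have hDodd : ∀ s, D |s| = D s := by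
    intro s
    rcases abs_choice s with h | h <;> rw [h]
    simp only [hD, neg_div, plateau_neg]
  have habsK : ∀ s : ℝ, |s / K| = |s| / K := fun s => by rw [abs_div, abs_of_pos hK0]
  have hDlow : ∀ s, |s| ≤ K → D s = c * plateau s - c / K := fun s hs => by
    simp only [hD]
    rw [plateau_eq_one (s := s / K), mul_one]
    rw [habsK, div_le_one hK0]; exact hs
  have hDhigh : ∀ s, 2 ≤ |s| → D s ≤ 0 := fun s hs => by
    simp only [hD]
    rw [plateau_eq_zero hs, mul_zero, zero_sub, neg_nonpos]
    exact mul_nonneg hcK.le (plateau_nonneg _)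
  have hDanti : ∀ s t, 0 ≤ s → s ≤ t → t ≤ 2 → D t ≤ D s := fun s t hs hst ht => by
    rw [hDlow s (by rw [abs_of_nonneg hs]; linarith),
      hDlow t (by rw [abs_of_nonneg (hs.trans hst)]; linarith)]
    have := plateau_anti hs hst
    gcongr
  have hDc : Continuous D := by
    have := continuous_plateau
    fun_prop
  have hD1 : D 1 = c - c / K := by
    rw [hDlow 1 (by simp; linarith), plateau_eq_one (by simp), mul_one]
  have hBlin : ∀ s, 0 ≤ s → s ≤ 1 → B s = (c - c / K) * s := fun s hs hs1 => by
    simp only [hB]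
    rw [ramp_eq_self hs hs1, ramp_eq_self (by positivity) (by rw [div_le_one hK0]; linarith)]
    field_simp
  have hb0 : 1 - ν < c - c / K := by linarith
  -- the last point where the derivative is at least `1 - ν`
  obtain ⟨s₁, hs₁, hs₁m⟩ : ∃ s, IsGreatest (Icc (1 : ℝ) 2 ∩ {s | 1 - ν ≤ D s}) s := by
    refine IsCompact.exists_isGreatest ?_ ⟨1, ⟨by norm_num, by norm_num⟩, ?_⟩
    · exact isCompact_Icc.inter_right (isClosed_le continuous_const hDc)
    · rw [mem_ofPred_eq, hD1]; exact hb0.le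
  have hs₁1 : 1 ≤ s₁ := hs₁.1.1
  have hs₁2 : s₁ < 2 := by
    refine lt_of_le_of_ne hs₁.1.2 fun h => ?_
    have := hDhigh 2 (by norm_num)
    have h2 := hs₁.2
    rw [h, mem_ofPred_eq] at h2
    linarith
  have hmono : MonotoneOn (fun s => B s - (1 - ν) * s) (Icc 1 s₁) := by
    refine monotoneOn_of_deriv_nonneg (convex_Icc _ _) ?_ ?_ ?_
    · exact (hBs.continuous.sub (by fun_prop)).continuousOn
    · exact fun s _ => ((hBD s).sub ((hasDerivAt_id' s).const_mul (1 - ν))).differentiableAt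
        |>.differentiableWithinAt
    · intro s hs
      rw [interior_Icc] at hs
      have h1 := ((hBD s).fun_sub ((hasDerivAt_id' s).const_mul (1 - ν))).deriv
      rw [h1]
      have := hDanti s s₁ (by linarith [hs.1]) hs.2.le hs₁2.le
      have h2 := hs₁.2
      rw [mem_ofPred_eq] at h2
      linarith
  have hpos1 : ∀ s ∈ Icc 1 s₁, (1 - ν) * s < B s := by
    intro s hs
    have := hmono (left_mem_Icc.2 hs₁1) hs hs.1
    simp only [hBlin 1 zero_le_one le_rfl] at this
    linarith
  -- The pushing inequality is strict at `s₁`, so it persists a little further, and there the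
  -- derivative has already dropped strictly below `1`. This gap is what allows `η < 1`.
  obtain ⟨q, hq1, hq2⟩ : ∃ q, q ∈ Ioo s₁ 2 ∧ ∀ s ∈ Icc s₁ q, (1 - ν) * s < B s := by
    have h1 : ∀ᶠ s in 𝓝 s₁, (1 - ν) * s < B s :=
      (isOpen_lt (by fun_prop) hBs.continuous).mem_nhds (hpos1 s₁ ⟨hs₁1, le_rfl⟩)
    obtain ⟨ε, hε, h2⟩ := Metric.eventually_nhds_iff.1 h1
    have hm : 0 < min (ε / 2) ((2 - s₁) / 2) := lt_min (by positivity) (by linarith)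
    refine ⟨s₁ + min (ε / 2) ((2 - s₁) / 2), ⟨by linarith, ?_⟩, fun s hs => h2 ?_⟩
    · linarith [min_le_right (ε / 2) ((2 - s₁) / 2)]
    · rw [Real.dist_eq, abs_of_nonneg (by linarith [hs.1])]
      linarith [min_le_left (ε / 2) ((2 - s₁) / 2), hs.2]
  have hDq : D q < 1 - ν := by
    by_contra h
    have := hs₁m ⟨⟨by linarith [hq1.1], hq1.2.le⟩, not_lt.1 h⟩
    linarith [hq1.1]
  have hBodd : ∀ s, B (-s) = -B s := fun s => by
    simp only [hB, neg_div, ramp_neg]; ring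
  have hBsupp0 : ∀ s, 2 * K ≤ s → B s = 0 := fun s hs => by
    simp only [hB]
    rw [ramp_eq_of_two_le (s := s) (by linarith),
      ramp_eq_of_two_le (s := s / K) (by rw [le_div_iff₀ hK0]; linarith)]
    simp
  have hBsupp : ∀ s, 2 * K ≤ |s| → B s = 0 := fun s hs => by
    rcases abs_choice s with h | h
    · exact hBsupp0 s (h ▸ hs)
    · rw [h] at hs
      have h1 := hBsupp0 _ hs
      rw [hBodd] at h1
      linarith
  obtain ⟨M, hM⟩ : ∃ M, ∀ s, ‖B s‖ ≤ M :=
    hBs.continuous.bounded_above_of_compact_support (HasCompactSupport.intro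
      (isCompact_Icc (a := -(2 * K)) (b := 2 * K)) fun s hs => hBsupp s (by
        by_contra h
        exact hs (abs_le.1 (not_le.1 h).le)))
  refine ⟨B, q, max (2 * K) M, max ν (ν + D q), hBs, hBodd, fun s hs => hBsupp s
    ((le_max_left _ _).trans hs), fun s => (hM s).trans (le_max_right _ _), fun s => ?_, fun s => ?_,
    ?_, by linarith [hq1.1], ?_, fun s hs hsq => ?_, max_lt hν1 (by linarith), le_max_left _ _,
    fun s hs => ?_⟩
  · rw [hdB]
    simp only [hD]
    have h1 := mul_nonneg hc0.le (plateau_nonneg s)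
    have h2 := mul_le_of_le_one_right hcK.le (plateau_le_one (s / K))
    linarith
  · rw [hdB]
    simp only [hD]
    have h1 := mul_le_of_le_one_right hc0.le (plateau_le_one s)
    have h2 := mul_nonneg hcK.le (plateau_nonneg (s / K))
    linarith
  · rw [hdB, hDlow 0 (by simp; linarith), plateau_eq_one (by simp)]
    linarith
  · exact lt_of_lt_of_le (by linarith [hq1.2]) (le_max_left _ _)
  · rcases le_total s 1 with h1 | h1
    · rw [hBlin s hs.le h1]; gcongr
    · rcases le_total s s₁ with h2 | h2
      · exact hpos1 s ⟨h1, h2⟩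
      · exact hq2 s ⟨h2, hsq⟩
  · rw [hdB, ← hDodd]
    rcases le_total |s| 2 with h | h
    · refine le_trans ?_ (le_max_right _ _)
      have := hDanti q |s| (by linarith [hq1.1]) hs h
      linarith
    · refine le_trans ?_ (le_max_left _ _)
      have := hDhigh |s| (by rwa [abs_abs])
      linarith

/-! ### Periodization -/

/-- A smooth function supported in a small ball extends periodically. -/
theorem exists_periodization {V : Type*} [NormedAddCommGroup V] [NormedSpace ℝ V]
    (L : AddSubgroup V) {ρ₁ ρ : ℝ} (hρ : ρ₁ < ρ)
    (hL : ∀ ℓ ∈ L, ℓ ≠ 0 → 2 * ρ ≤ ‖ℓ‖) {k₀ : V → ℝ} (hsupp : ∀ z, ρ₁ ≤ ‖z‖ → k₀ z = 0) :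
    ∃ k : V → ℝ, (∀ ℓ ∈ L, ∀ z, k (z + ℓ) = k z) ∧
      (∀ z, ∀ ℓ ∈ L, ‖z - ℓ‖ < ρ → k =ᶠ[𝓝 z] fun y => k₀ (y - ℓ)) ∧
      ∀ z, (∀ ℓ ∈ L, ρ ≤ ‖z - ℓ‖) → k =ᶠ[𝓝 z] fun _ => 0 := by
  classical
  -- The balls of radius `ρ` around distinct lattice points are disjoint, so the choice in the
  -- definition of `k` is harmless.
  have huniq : ∀ z, ∀ ℓ ∈ L, ∀ ℓ' ∈ L, ‖z - ℓ‖ < ρ → ‖z - ℓ'‖ < ρ → ℓ = ℓ' := by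
    intro z ℓ hℓ ℓ' hℓ' h h'
    by_contra hne
    have h1 := hL (ℓ - ℓ') (L.sub_mem hℓ hℓ') (sub_ne_zero.2 hne)
    have h2 : ‖ℓ - ℓ'‖ ≤ ‖z - ℓ'‖ + ‖z - ℓ‖ := by
      calc ‖ℓ - ℓ'‖ = ‖(z - ℓ') - (z - ℓ)‖ := by congr 1; abel
        _ ≤ _ := norm_sub_le _ _
    linarith
  let k : V → ℝ := fun z =>
    if h : ∃ ℓ ∈ L, ‖z - ℓ‖ < ρ then k₀ (z - h.choose) else 0
  have hk : ∀ z, ∀ ℓ ∈ L, ‖z - ℓ‖ < ρ → k z = k₀ (z - ℓ) := by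
    intro z ℓ hℓ h
    have hex : ∃ ℓ ∈ L, ‖z - ℓ‖ < ρ := ⟨ℓ, hℓ, h⟩
    have : hex.choose = ℓ := huniq z _ hex.choose_spec.1 _ hℓ hex.choose_spec.2 h
    simp only [k, dif_pos hex, this]
  have hk0 : ∀ z, (∀ ℓ ∈ L, ρ ≤ ‖z - ℓ‖) → k z = 0 := by
    intro z h
    have : ¬∃ ℓ ∈ L, ‖z - ℓ‖ < ρ := fun ⟨ℓ, hℓ, h'⟩ => absurd h' (not_lt.2 (h ℓ hℓ))
    simp only [k, dif_neg this]
  refine ⟨k, fun ℓ hℓ z => ?_, fun z ℓ hℓ h => ?_, fun z h => ?_⟩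
  · by_cases hex : ∃ ℓ' ∈ L, ‖z - ℓ'‖ < ρ
    · obtain ⟨ℓ', hℓ', h⟩ := hex
      rw [hk z ℓ' hℓ' h, hk (z + ℓ) (ℓ' + ℓ) (L.add_mem hℓ' hℓ) (by simpa using h)]
      simp
    · push Not at hex
      rw [hk0 z hex, hk0 (z + ℓ) fun ℓ' hℓ' => ?_]
      have := hex (ℓ' - ℓ) (L.sub_mem hℓ' hℓ)
      rwa [show z + ℓ - ℓ' = z - (ℓ' - ℓ) by abel]
  · have : ∀ᶠ y in 𝓝 z, ‖y - ℓ‖ < ρ :=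
      (isOpen_lt (by fun_prop : Continuous fun y => ‖y - ℓ‖) continuous_const).mem_nhds h
    filter_upwards [this] with y hy using hk y ℓ hℓ hy
  -- A point closer than `ρ - ρ₁` to `z` may enter a ball of radius `ρ`, but only where `k₀` already
  -- vanishes.
  · filter_upwards [Metric.ball_mem_nhds z (sub_pos.2 hρ)] with y hy
    by_cases hex : ∃ ℓ ∈ L, ‖y - ℓ‖ < ρ
    · obtain ⟨ℓ, hℓ, h'⟩ := hex
      rw [hk y ℓ hℓ h', hsupp]
      have h1 := h ℓ hℓ
      have h2 : ‖z - ℓ‖ ≤ ‖y - z‖ + ‖y - ℓ‖ := by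
        calc ‖z - ℓ‖ = ‖(y - ℓ) - (y - z)‖ := by congr 1; abel
          _ ≤ ‖y - ℓ‖ + ‖y - z‖ := norm_sub_le _ _
          _ = _ := add_comm _ _
      rw [mem_ball_iff_norm] at hy
      linarith
    · push Not at hex
      exact hk0 y hex

/-! ### The perturbation -/

/-- The skew product `(r, s) ↦ (λ r, μ s + k (r, s))`. -/
def daMap (lam mu : ℝ) (k : ℝ × ℝ → ℝ) (z : ℝ × ℝ) : ℝ × ℝ := (lam * z.1, mu * z.2 + k z)

/-- The derivative of the second coordinate of `daMap` along the second coordinate. -/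
def daJac (mu : ℝ) (k : ℝ × ℝ → ℝ) (z : ℝ × ℝ) : ℝ := mu + fderiv ℝ k z (0, 1)

/-- The translates under `L` of the box `(-R, R) × (-q, q)`. -/
def boxes (L : AddSubgroup (ℝ × ℝ)) (R q : ℝ) : Set (ℝ × ℝ) :=
  {z | ∃ ℓ ∈ L, |(z - ℓ).1| < R ∧ |(z - ℓ).2| < q}

/-- A perturbation, periodic under the lattice `L`, turning the saddle `0` of the linear map
`(r, s) ↦ (λ r, μ s)` into a source. -/
structure IsDAPerturbation (lam mu : ℝ) (L : AddSubgroup (ℝ × ℝ)) (k : ℝ × ℝ → ℝ) (R q η : ℝ) :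
    Prop where
  one_lt : 1 < lam
  abs_mu : |mu| = lam⁻¹
  smooth : ContDiff ℝ (⊤ : ℕ∞) k
  periodic : ∀ ℓ ∈ L, ∀ z, k (z + ℓ) = k z
  zero : k 0 = 0
  jac_pos : ∀ z, 0 < mu * daJac mu k z
  jac_le : ∀ z, |daJac mu k z| ≤ (1 + lam) / 2
  slope_le : ∀ z, |fderiv ℝ k z (1, 0)| ≤ lam * (lam - 1) / 2
  R_pos : 0 < R
  q_pos : 0 < q
  inv_box : ∀ z, |(daMap lam mu k z).1| ≤ R → |(daMap lam mu k z).2| ≤ q → |z.1| < R ∧ |z.2| < q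
  eta_lt : η < 1
  contract : ∀ z ∉ boxes L R q, |daJac mu k z| ≤ η
  escape : ∀ z, |z.1| < R → |z.2| < q → z ≠ 0 → ∃ n, (daMap lam mu k)^[n] z ∉ boxes L R q
  source : 1 < |daJac mu k 0|
  slope_zero : fderiv ℝ k 0 (1, 0) = 0

/-- The sequence increases and is bounded, so it converges to a fixed point in `(0, q]`, where every
point is moved strictly. -/
theorem false_of_pushed_sequence {ν q : ℝ} {B : ℝ → ℝ} (hB : Continuous B)
    (hout : ∀ s, 0 < s → s ≤ q → s < ν * s + B s) {v : ℕ → ℝ} (h0 : 0 < v 0)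
    (hv : ∀ n, v (n + 1) = ν * v n + B (v n)) (hq : ∀ n, v n ≤ q) : False := by
  have hge : ∀ n, v 0 ≤ v n := by
    intro n
    induction n with
    | zero => exact le_rfl
    | succ n ih =>
      rw [hv]
      exact ih.trans (hout _ (h0.trans_le ih) (hq n)).le
  have hmon : Monotone v := monotone_nat_of_le_succ fun n => by
    rw [hv]
    exact (hout _ (h0.trans_le (hge n)) (hq n)).le
  have hlim := tendsto_atTop_ciSup hmon ⟨q, by rintro _ ⟨n, rfl⟩; exact hq n⟩
  have h1 := hlim.comp (tendsto_add_atTop_nat 1)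
  have h2 := (hlim.const_mul ν).add ((hB.tendsto _).comp hlim)
  have h3 := tendsto_nhds_unique (h1.congr hv) h2
  exact (hout _ (h0.trans_le (ge_of_tendsto' hlim hge)) (le_of_tendsto' hlim hq)).ne h3

set_option maxHeartbeats 1000000 in
-- Near the origin `k = ε β(r) B(s)`, with `ε` the sign of `mu`, `β` a cut-off and `B` a profile,
-- extended periodically. At every point the vertical derivative is `ε (ν + b d)` with `b ∈ [0, 1]`,
-- so it interpolates between the linear rate and that of the profile and inherits the bounds of
-- both.
theorem exists_isDAPerturbation {lam mu : ℝ} (hlam : 1 < lam) (hmu : |mu| = lam⁻¹)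
    (L : AddSubgroup (ℝ × ℝ)) {δ : ℝ} (hδ : 0 < δ) (hL : ∀ ℓ ∈ L, ℓ ≠ 0 → δ ≤ ‖ℓ‖)
    {δ₀ : ℝ} (hδ₀ : 0 < δ₀) :
    ∃ k R q η, IsDAPerturbation lam mu L k R q η ∧
      ∀ z, (∀ ℓ ∈ L, δ₀ ≤ ‖z - ℓ‖) → k z = 0 := by
  have hl0 : 0 < lam := by linarith
  set ν := lam⁻¹ with hν
  have hν0 : 0 < ν := inv_pos.2 hl0
  have hν1 : ν < 1 := inv_lt_one_of_one_lt₀ hlam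
  have hlν : lam * ν = 1 := mul_inv_cancel₀ hl0.ne'
  obtain ⟨ε, hεdef⟩ : ∃ ε, ε = mu * lam := ⟨_, rfl⟩
  have hε : |ε| = 1 := by
    rw [hεdef, abs_mul, hmu, abs_of_pos hl0, mul_comm, hlν]
  have hεε : ε * ε = 1 := by rw [← abs_mul_abs_self, hε, one_mul]
  have hmuε : mu = ε * ν := by rw [hεdef, mul_assoc, hlν, mul_one]
  -- This makes the supports disjoint, and prevents the image of one box, of size at most `λ ρ`,
  -- from reaching the box of another lattice point.
  set ρ := min δ₀ (δ / (2 * (lam + 1))) with hρ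
  have hρ0 : 0 < ρ := by positivity
  have hρδ : ρ * (2 * (lam + 1)) ≤ δ := by
    rw [← le_div_iff₀ (by positivity)]; exact min_le_right _ _
  set R := ρ / 2 with hR
  have hR0 : 0 < R := by positivity
  -- the cut-off in the first coordinate
  obtain ⟨β, hβs, hβ0, hβ1, hβone, hβzero⟩ : ∃ β : ℝ → ℝ, ContDiff ℝ (⊤ : ℕ∞) β ∧ (∀ r, 0 ≤ β r) ∧
      (∀ r, β r ≤ 1) ∧ (∀ r, lam * |r| ≤ R → β r = 1) ∧ ∀ r, R ≤ |r| → β r = 0 := by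
    have hd : 0 < R ^ 2 - (R * ν) ^ 2 := by
      have h1 : R * ν < R := mul_lt_of_lt_one_right hR0 hν1
      have h2 : 0 < R * ν := by positivity
      nlinarith
    refine ⟨fun r => Real.smoothTransition ((R ^ 2 - r ^ 2) / (R ^ 2 - (R * ν) ^ 2)),
      Real.smoothTransition.contDiff.comp (by fun_prop), fun r => Real.smoothTransition.nonneg _,
      fun r => Real.smoothTransition.le_one _, fun r hr => ?_, fun r hr => ?_⟩
    · refine Real.smoothTransition.one_of_one_le ?_
      rw [one_le_div hd]
      have h1 : |r| ≤ R * ν := by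
        rw [hν, ← div_eq_mul_inv, le_div_iff₀ hl0]; linarith
      nlinarith [sq_abs r, abs_nonneg r]
    · refine Real.smoothTransition.zero_of_nonpos (div_nonpos_of_nonpos_of_nonneg ?_ hd.le)
      nlinarith [sq_abs r]
  obtain ⟨Cβ, hCβ⟩ : ∃ C, ∀ r, ‖deriv β r‖ ≤ C := by
    have hsupp : HasCompactSupport β := HasCompactSupport.intro
      (isCompact_Icc (a := -R) (b := R)) fun r hr => hβzero r (by
        by_contra h
        exact hr (abs_le.1 (not_le.1 h).le))
    exact (hβs.continuous_deriv (by simp)).bounded_above_of_compact_support hsupp.deriv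
  have hCβ0 : 0 ≤ Cβ := (norm_nonneg _).trans (hCβ 0)
  -- the profile in the second coordinate
  obtain ⟨B, q, τ, η, hB, hτR, hτC⟩ : ∃ B q τ η, IsProfile lam B q τ η ∧ τ ≤ R ∧
      Cβ * τ ≤ lam * (lam - 1) / 2 := by
    obtain ⟨B, q, τ, η, hB⟩ := exists_isProfile hlam
    have hτ0 : 0 < τ := hB.q_pos.trans hB.q_lt
    -- The profile is shrunk after `β` is fixed, so that the horizontal derivative `B β'` is as
    -- small as required.
    set σ := min R (lam * (lam - 1) / 2 / (Cβ + 1)) with hσ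
    have hll : 0 < lam * (lam - 1) / 2 := by nlinarith
    have hσ0 : 0 < σ := by positivity
    have e : σ / τ * τ = σ := by field_simp
    refine ⟨_, _, σ / τ * τ, η, hB.scale (δ := σ / τ) (by positivity), ?_, ?_⟩
    · rw [e]; exact min_le_left _ _
    · rw [e]
      have h1 : σ * (Cβ + 1) ≤ lam * (lam - 1) / 2 := by
        rw [← le_div_iff₀ (by positivity)]; exact min_le_right _ _
      nlinarith
  have hq0 := hB.q_pos
  have hqR : q < R := hB.q_lt.trans_le hτR
  have hBd : ∀ s, HasDerivAt B (deriv B s) s := fun s =>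
    ((hB.smooth.differentiable (by simp)) s).hasDerivAt
  have hβd : ∀ s, HasDerivAt β (deriv β s) s := fun s =>
    ((hβs.differentiable (by simp)) s).hasDerivAt
  set k₀ : ℝ × ℝ → ℝ := fun z => ε * (β z.1 * B z.2) with hk₀
  have hk₀s : ContDiff ℝ (⊤ : ℕ∞) k₀ := by
    have h1 : ContDiff ℝ (⊤ : ℕ∞) fun z : ℝ × ℝ => β z.1 := hβs.comp contDiff_fst
    have h2 : ContDiff ℝ (⊤ : ℕ∞) fun z : ℝ × ℝ => B z.2 := hB.smooth.comp contDiff_snd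
    exact contDiff_const.mul (h1.mul h2)
  have hk₀d : ∀ z : ℝ × ℝ, HasFDerivAt k₀ (ε • (β z.1 • (deriv B z.2 • ContinuousLinearMap.snd ℝ ℝ ℝ)
      + B z.2 • (deriv β z.1 • ContinuousLinearMap.fst ℝ ℝ ℝ))) z := fun z =>
    (((hβd z.1).comp_hasFDerivAt z hasFDerivAt_fst).mul
      ((hBd z.2).comp_hasFDerivAt z hasFDerivAt_snd)).const_mul ε
  have hk₀1 : ∀ z : ℝ × ℝ, fderiv ℝ k₀ z (1, 0) = ε * (B z.2 * deriv β z.1) := fun z => by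
    rw [(hk₀d z).fderiv]; simp
  have hk₀2 : ∀ z : ℝ × ℝ, fderiv ℝ k₀ z (0, 1) = ε * (β z.1 * deriv B z.2) := fun z => by
    rw [(hk₀d z).fderiv]; simp
  have hL2 : ∀ ℓ ∈ L, ℓ ≠ 0 → 2 * ρ ≤ ‖ℓ‖ := fun ℓ hℓ h0 => by
    refine le_trans ?_ (hL ℓ hℓ h0)
    nlinarith
  obtain ⟨k, hper, hnear, hfar⟩ := exists_periodization L (ρ₁ := ρ / 2) (ρ := ρ) (by linarith)
    hL2 (k₀ := k₀) (by
      intro z hz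
      rw [Prod.norm_def, le_max_iff] at hz
      rcases hz with h | h
      · simp only [hk₀]
        rw [hβzero _ h]; simp
      · simp only [hk₀]
        rw [hB.support _ (hτR.trans h)]; simp)
  -- the local form of the perturbation at an arbitrary point
  have hcases : ∀ z, (∃ ℓ ∈ L, ‖z - ℓ‖ < ρ ∧ k z = k₀ (z - ℓ) ∧
      fderiv ℝ k z = fderiv ℝ k₀ (z - ℓ)) ∨ ((∀ ℓ ∈ L, ρ ≤ ‖z - ℓ‖) ∧ fderiv ℝ k z = 0) := by
    intro z
    by_cases h : ∃ ℓ ∈ L, ‖z - ℓ‖ < ρ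
    · obtain ⟨ℓ, hℓ, h⟩ := h
      have h1 := hnear z ℓ hℓ h
      refine Or.inl ⟨ℓ, hℓ, h, h1.eq_of_nhds, ?_⟩
      rw [h1.fderiv_eq, fderiv_comp_sub]
    · push Not at h
      refine Or.inr ⟨h, ?_⟩
      rw [(hfar z h).fderiv_eq]; simp
  have hsm : ContDiff ℝ (⊤ : ℕ∞) k := by
    rw [contDiff_iff_contDiffAt]
    intro z
    by_cases h : ∃ ℓ ∈ L, ‖z - ℓ‖ < ρ
    · obtain ⟨ℓ, hℓ, h⟩ := h
      refine ContDiffAt.congr_of_eventuallyEq ?_ (hnear z ℓ hℓ h)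
      exact (hk₀s.comp (contDiff_id.sub contDiff_const)).contDiffAt
    · push Not at h
      exact contDiffAt_const.congr_of_eventuallyEq (hfar z h)
  have hk0 : ∀ z, ‖z‖ < ρ → k z = k₀ z := fun z hz => by
    have := (hnear z 0 L.zero_mem (by simpa using hz)).eq_of_nhds
    simpa using this
  -- the derivative along the second coordinate is `ε` times a positive number
  have hjac : ∀ z, ∃ b ∈ Icc (0 : ℝ) 1, ∃ d, daJac mu k z = ε * (ν + b * d) ∧ 0 < ν + d ∧
      ν + d ≤ (1 + lam) / 2 ∧ (z ∉ boxes L R q → b = 0 ∨ ν + d ≤ η) := by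
    intro z
    rcases hcases z with ⟨ℓ, hℓ, hz, -, h⟩ | ⟨h, h0⟩
    · refine ⟨β (z - ℓ).1, ⟨hβ0 _, hβ1 _⟩, deriv B (z - ℓ).2, ?_, hB.deriv_pos _, hB.deriv_le _,
        fun hb => ?_⟩
      · rw [daJac, h, hk₀2, hmuε]; ring
      · rcases le_or_gt R |(z - ℓ).1| with h1 | h1
        · exact Or.inl (hβzero _ h1)
        · rcases le_or_gt q |(z - ℓ).2| with h2 | h2
          · exact Or.inr (hB.deriv_le_eta _ h2)
          · exact absurd ⟨ℓ, hℓ, h1, h2⟩ hb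
    · refine ⟨0, ⟨le_rfl, zero_le_one⟩, deriv B 0, ?_, hB.deriv_pos _, hB.deriv_le _,
        fun _ => Or.inl rfl⟩
      rw [daJac, h0, hmuε]; simp
  have hpos : ∀ b ∈ Icc (0 : ℝ) 1, ∀ d, 0 < ν + d → 0 < ν + b * d := by
    intro b hb d hd
    rcases hb.1.eq_or_lt with h | h
    · rw [← h]; simpa using hν0
    · nlinarith [hb.2]
  have hmono : ∀ r, StrictMono fun s => ε * (mu * s + k (r, s)) := by
    intro r
    refine strictMono_of_deriv_pos fun s => ?_
    have h1 : HasDerivAt (fun s => k (r, s)) (fderiv ℝ k (r, s) (0, 1)) s :=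
      ((hsm.differentiable (by simp)) (r, s)).hasFDerivAt.comp_hasDerivAt s
        ((hasDerivAt_const s r).prodMk (hasDerivAt_id s))
    have h2 := (((hasDerivAt_id' s).const_mul mu).add h1).const_mul ε
    rw [show (fun s => ε * (mu * s + k (r, s))) = fun y =>
      ε * ((fun y => mu * y) + fun s => k (r, s)) y from rfl, h2.deriv, mul_one]
    obtain ⟨b, hb, d, h3, h4, -, -⟩ := hjac (r, s)
    rw [daJac] at h3
    rw [h3, ← mul_assoc, hεε, one_mul]
    exact hpos b hb d h4
  have hexp : ∀ r, lam * |r| ≤ R → ∀ s, |s| < ρ → ε * (mu * s + k (r, s)) = ν * s + B s := by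
    intro r hr s hs
    have hrρ : |r| < ρ := by nlinarith [abs_nonneg r]
    rw [hk0 (r, s) (by rw [Prod.norm_def]; exact max_lt hrρ hs), hmuε]
    simp only [hk₀, hβone r hr]
    linear_combination (ν * s + B s) * hεε
  have hqρ : q < ρ := by linarith
  have hout : ∀ s, 0 < s → s ≤ q → s < ν * s + B s := fun s hs hsq => by
    have := hB.push s hs hsq
    linarith
  refine ⟨k, R, q, η, ⟨hlam, hmu, hsm, hper, ?_, fun z => ?_, fun z => ?_, fun z => ?_, hR0, hq0,
    fun z hz1 hz2 => ?_, hB.eta_lt, fun z hz => ?_, fun z hz1 hz2 hz0 => ?_, ?_, ?_⟩, fun z hz => ?_⟩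
  · rw [hk0 0 (by simpa using hρ0)]
    have := hB.odd 0
    simp only [neg_zero] at this
    simp only [hk₀, Prod.snd_zero, show B 0 = 0 by linarith, mul_zero]
  · obtain ⟨b, hb, d, h3, h4, -, -⟩ := hjac z
    rw [h3, hmuε, show ε * ν * (ε * (ν + b * d)) = ε * ε * (ν * (ν + b * d)) by ring, hεε, one_mul]
    exact mul_pos hν0 (hpos b hb d h4)
  · obtain ⟨b, hb, d, h3, h4, h5, -⟩ := hjac z
    rw [h3, abs_mul, hε, one_mul, abs_of_pos (hpos b hb d h4)]
    nlinarith [hb.1, hb.2]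
  · have h1 : 0 ≤ lam * (lam - 1) / 2 := by nlinarith
    rcases hcases z with ⟨ℓ, hℓ, hz, -, h⟩ | ⟨h, h0⟩
    · rw [h, hk₀1, abs_mul, hε, one_mul, abs_mul]
      refine le_trans ?_ hτC
      rw [mul_comm Cβ]
      exact mul_le_mul (hB.abs_le _) (hCβ _) (abs_nonneg _) (hq0.trans hB.q_lt).le
    · rw [h0]; simpa using h1
  · have hr : lam * |z.1| ≤ R := by
      simpa [daMap, abs_mul, abs_of_pos hl0] using hz1
    refine ⟨by nlinarith [abs_nonneg z.1], ?_⟩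
    -- If `λ |r| ≤ R`, then `β r = 1` and, up to sign, the map on the vertical line is `s ↦ ν s + B
    -- s`. It is increasing and moves `±q` strictly outwards, so the preimage of `[-q, q]` lies in
    -- `(-q, q)`.
    have h1 : |ε * (mu * z.2 + k (z.1, z.2))| ≤ q := by
      rw [abs_mul, hε, one_mul]; exact hz2
    have h2 := hout q hq0 le_rfl
    have h3 := hexp z.1 hr q (by rw [abs_of_pos hq0]; exact hqρ)
    have h4 := hexp z.1 hr (-q) (by rw [abs_neg, abs_of_pos hq0]; exact hqρ)
    rw [hB.odd] at h4
    rw [abs_le] at h1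
    rw [abs_lt]
    constructor
    · rw [← (hmono z.1).lt_iff_lt]
      linarith [h1.1]
    · rw [← (hmono z.1).lt_iff_lt]
      linarith [h1.2]
  · obtain ⟨b, hb, d, h3, h4, -, h6⟩ := hjac z
    rw [h3, abs_mul, hε, one_mul, abs_of_pos (hpos b hb d h4)]
    rcases h6 hz with h | h
    · rw [h, zero_mul, add_zero]; exact hB.le_eta
    · nlinarith [hb.1, hb.2, hB.le_eta]
  · by_contra hcon
    push Not at hcon
    -- An orbit that never leaves the union of the boxes stays in the central one, by the choice of
    -- `ρ`. Its first coordinate must then vanish, since it grows like `λ ^ n`, and its second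
    -- coordinate is pushed out.
    have hstep : ∀ y : ℝ × ℝ, |y.1| < R → |y.2| < q → daMap lam mu k y ∈ boxes L R q →
        |(daMap lam mu k y).1| < R ∧ |(daMap lam mu k y).2| < q := by
      intro y hy1 hy2 ⟨ℓ, hℓ, h1, h2⟩
      suffices ℓ = 0 by simpa [this] using And.intro h1 h2
      by_contra hne
      have h3 := hL ℓ hℓ hne
      have hyρ : ‖y‖ < ρ := by
        rw [Prod.norm_def]; exact max_lt (hy1.trans (by linarith)) (hy2.trans hqρ)
      have hk1 : |(daMap lam mu k y).1| ≤ lam * ρ := by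
        simp only [daMap, abs_mul, abs_of_pos hl0]
        gcongr; linarith
      have hk2 : |(daMap lam mu k y).2| ≤ lam * ρ := by
        have e : (daMap lam mu k y).2 = ε * (ν * y.2 + β y.1 * B y.2) := by
          simp only [daMap, hk0 y hyρ, hmuε, hk₀]; ring
        rw [e, abs_mul, hε, one_mul]
        have hBq : |β y.1 * B y.2| ≤ R := by
          rw [abs_mul, abs_of_nonneg (hβ0 _)]
          calc β y.1 * |B y.2| ≤ 1 * τ :=
                mul_le_mul (hβ1 _) (hB.abs_le _) (abs_nonneg _) zero_le_one
            _ ≤ R := by linarith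
        have hνy : |ν * y.2| ≤ R := by
          rw [abs_mul, abs_of_pos hν0]
          nlinarith [abs_nonneg y.2]
        refine (abs_add_le _ _).trans ?_
        nlinarith
      have h4 : ‖ℓ‖ < δ := by
        rw [Prod.norm_def]
        refine max_lt ?_ ?_
        · have := abs_sub_abs_le_abs_sub ℓ.1 (daMap lam mu k y).1
          rw [abs_sub_comm] at this
          have h1' : |(daMap lam mu k y).1 - ℓ.1| < R := h1
          rw [Real.norm_eq_abs]
          nlinarith
        · have := abs_sub_abs_le_abs_sub ℓ.2 (daMap lam mu k y).2
          rw [abs_sub_comm] at this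
          have h2' : |(daMap lam mu k y).2 - ℓ.2| < q := h2
          rw [Real.norm_eq_abs]
          nlinarith
      linarith
    set u : ℕ → ℝ × ℝ := fun n => (daMap lam mu k)^[n] z with hu
    have hu0 : u 0 = z := rfl
    have huS : ∀ n, u (n + 1) = daMap lam mu k (u n) := fun n =>
      Function.iterate_succ_apply' _ _ _
    have hbox : ∀ n, |(u n).1| < R ∧ |(u n).2| < q := by
      intro n
      induction n with
      | zero => exact ⟨hz1, hz2⟩
      | succ n ih =>
        rw [huS]
        refine hstep _ ih.1 ih.2 ?_
        rw [← huS]; exact hcon (n + 1)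
    have hfst : ∀ n, (u n).1 = lam ^ n * z.1 := by
      intro n
      induction n with
      | zero => simp [hu0]
      | succ n ih => rw [huS, daMap, ih, pow_succ]; ring
    have hz10 : z.1 = 0 := by
      by_contra hne
      obtain ⟨n, hn⟩ := pow_unbounded_of_one_lt (R / |z.1|) hlam
      have := (hbox n).1
      rw [hfst, abs_mul, abs_of_pos (by positivity)] at this
      rw [div_lt_iff₀ (abs_pos.2 hne)] at hn
      linarith
    have hz20 : 0 < |z.2| := abs_pos.2 fun h => hz0 (Prod.ext hz10 h)
    have hsnd : ∀ n, |(u (n + 1)).2| = ν * |(u n).2| + B |(u n).2| := by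
      intro n
      have h1 : u n = (0, (u n).2) := Prod.ext (by rw [hfst, hz10, mul_zero]) rfl
      have h2 := hexp 0 (by simpa using hR0.le) (u n).2 ((hbox n).2.trans hqρ)
      rw [← h1] at h2
      have h3 : |(u (n + 1)).2| = |ν * (u n).2 + B (u n).2| := by
        rw [← h2, abs_mul, hε, one_mul, huS, daMap]
      rw [h3]
      have hpos' : ∀ s, 0 ≤ s → s ≤ q → 0 ≤ ν * s + B s := by
        intro s hs hsq
        rcases hs.eq_or_lt with h | h
        · have := hB.odd 0
          simp only [neg_zero] at this
          rw [← h, show B 0 = 0 by linarith]; simp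
        · linarith [hout s h hsq]
      have h4 := hpos' |(u n).2| (abs_nonneg _) (hbox n).2.le
      rcases abs_choice (u n).2 with h | h
      · rw [h] at h4 ⊢
        rw [abs_of_nonneg h4]
      · rw [h] at h4 ⊢
        rw [hB.odd] at h4 ⊢
        rw [← abs_neg, abs_of_nonneg (by linarith)]
        ring
    exact false_of_pushed_sequence hB.smooth.continuous hout hz20 hsnd fun n => (hbox n).2.le
  · have h1 : fderiv ℝ k 0 = fderiv ℝ k₀ 0 := by
      refine Filter.EventuallyEq.fderiv_eq ?_
      simpa using hnear 0 0 L.zero_mem (by simpa using hρ0)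
    rw [daJac, h1, hk₀2, hmuε, ← mul_add, abs_mul, hε, one_mul, Prod.fst_zero, Prod.snd_zero,
      hβone 0 (by simpa using hR0.le), one_mul]
    exact hB.deriv_zero.trans_le (le_abs_self _)
  · have h1 : fderiv ℝ k 0 = fderiv ℝ k₀ 0 := by
      refine Filter.EventuallyEq.fderiv_eq ?_
      simpa using hnear 0 0 L.zero_mem (by simpa using hρ0)
    have := hB.odd 0
    simp only [neg_zero] at this
    rw [h1, hk₀1, Prod.snd_zero, show B 0 = 0 by linarith]; simp
  · refine (hfar z fun ℓ hℓ => ?_).eq_of_nhds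
    exact (min_le_left _ _).trans (hz ℓ hℓ)

/-! ### The model on the universal cover -/

/-- A lattice of the plane, invariant under the hyperbolic map `(r, s) ↦ (λ r, μ s)`. -/
structure IsInvLattice (lam mu : ℝ) (L : AddSubgroup (ℝ × ℝ)) : Prop where
  discrete : ∃ δ > 0, ∀ ℓ ∈ L, ℓ ≠ 0 → δ ≤ ‖ℓ‖
  map_mem : ∀ ℓ, (lam * ℓ.1, mu * ℓ.2) ∈ L ↔ ℓ ∈ L
  nontrivial : ∃ ℓ ∈ L, ℓ ≠ 0
  countable : (L : Set (ℝ × ℝ)).Countable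

/-- `π` is the quotient map of the plane onto the torus, by the lattice `L`. -/
structure IsTorusCover (L : AddSubgroup (ℝ × ℝ)) (π : ℝ × ℝ → Torus2) : Prop where
  continuous : Continuous π
  isOpenMap : IsOpenMap π
  surjective : Function.Surjective π
  eq_iff : ∀ z z', π z = π z' ↔ z - z' ∈ L

theorem IsTorusCover.isQuotientMap {L : AddSubgroup (ℝ × ℝ)} {π : ℝ × ℝ → Torus2}
    (h : IsTorusCover L π) : IsQuotientMap π :=
  h.isOpenMap.isQuotientMap h.continuous h.surjective

theorem IsTorusCover.apply_add {L : AddSubgroup (ℝ × ℝ)} {π : ℝ × ℝ → Torus2}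
    (h : IsTorusCover L π) {ℓ : ℝ × ℝ} (hℓ : ℓ ∈ L) (z : ℝ × ℝ) : π (z + ℓ) = π z := by
  rw [h.eq_iff]; simpa using hℓ

/-- A continuous periodic function descends to the compact torus. -/
theorem IsTorusCover.exists_bound {L : AddSubgroup (ℝ × ℝ)} {π : ℝ × ℝ → Torus2}
    (h : IsTorusCover L π) {W : Type*} [NormedAddCommGroup W] {u : ℝ × ℝ → W} (hu : Continuous u)
    (hp : ∀ ℓ ∈ L, ∀ z, u (z + ℓ) = u z) : ∃ C, ∀ z, ‖u z‖ ≤ C := by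
  set v : Torus2 → W := fun x => u (Function.surjInv h.surjective x)
  have hv : ∀ z, v (π z) = u z := fun z => by
    have h1 : Function.surjInv h.surjective (π z) - z ∈ L :=
      (h.eq_iff _ _).1 (Function.surjInv_eq h.surjective (π z))
    have := hp _ h1 z
    rwa [add_sub_cancel] at this
  have hvc : Continuous v := h.isQuotientMap.continuous_iff.2 (hu.congr fun z => (hv z).symm)
  obtain ⟨C, hC⟩ := (isCompact_range hvc).isBounded.exists_norm_le
  exact ⟨C, fun z => hv z ▸ hC _ ⟨_, rfl⟩⟩

theorem IsTorusCover.exists_bound_lipschitz {L : AddSubgroup (ℝ × ℝ)} {π : ℝ × ℝ → Torus2}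
    (h : IsTorusCover L π) {W : Type*} [NormedAddCommGroup W] [NormedSpace ℝ W] {u : ℝ × ℝ → W}
    (hu : ContDiff ℝ 1 u) (hp : ∀ ℓ ∈ L, ∀ z, u (z + ℓ) = u z) :
    ∃ C, 0 ≤ C ∧ (∀ z, ‖u z‖ ≤ C) ∧ (∀ z, ‖fderiv ℝ u z‖ ≤ C) ∧
      ∀ z z', ‖u z - u z'‖ ≤ C * ‖z - z'‖ := by
  obtain ⟨C, hC⟩ := h.exists_bound hu.continuous hp
  obtain ⟨C', hC'⟩ := h.exists_bound (hu.continuous_fderiv one_ne_zero) fun ℓ hℓ z => by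
    rw [← fderiv_comp_add_right]
    simp only [hp ℓ hℓ]
  refine ⟨max C C', ((norm_nonneg _).trans (hC 0)).trans (le_max_left _ _),
    fun z => (hC z).trans (le_max_left _ _), fun z => (hC' z).trans (le_max_right _ _),
    fun z z' => ?_⟩
  refine (convex_univ.norm_image_sub_le_of_norm_fderiv_le
    (fun y _ => (hu.differentiable one_ne_zero) y) (fun y _ => hC' y) (mem_univ z')
    (mem_univ z)).trans ?_
  gcongr
  exact le_max_right _ _

/-- The data of the construction, in coordinates adapted to the eigendirections. -/
structure DAModel where
  lam : ℝ
  mu : ℝ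
  L : AddSubgroup (ℝ × ℝ)
  k : ℝ × ℝ → ℝ
  R : ℝ
  q : ℝ
  η : ℝ
  π : ℝ × ℝ → Torus2
  pert : IsDAPerturbation lam mu L k R q η
  lat : IsInvLattice lam mu L
  cover : IsTorusCover L π

namespace DAModel

variable (M : DAModel)

theorem lam_pos : 0 < M.lam := zero_lt_one.trans M.pert.one_lt

theorem mu_ne_zero : M.mu ≠ 0 := by
  have := M.pert.abs_mu
  rw [← abs_pos, this]
  exact inv_pos.2 M.lam_pos

theorem abs_mu_lt_one : |M.mu| < 1 := by
  rw [M.pert.abs_mu]; exact inv_lt_one_of_one_lt₀ M.pert.one_lt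

theorem abs_mu_pos : 0 < |M.mu| := abs_pos.2 M.mu_ne_zero

theorem tendsto_abs_mu_pow (C : ℝ) : Tendsto (fun n : ℕ => |M.mu| ^ n * C) atTop (𝓝 0) := by
  simpa using (tendsto_pow_atTop_nhds_zero_of_lt_one (abs_nonneg _) M.abs_mu_lt_one).mul_const C

/-! #### The lattice -/

theorem diag_mem {ℓ : ℝ × ℝ} (hℓ : ℓ ∈ M.L) : (M.lam * ℓ.1, M.mu * ℓ.2) ∈ M.L :=
  (M.lat.map_mem ℓ).2 hℓ

theorem diag_inv_mem {ℓ : ℝ × ℝ} (hℓ : ℓ ∈ M.L) : (M.lam⁻¹ * ℓ.1, M.mu⁻¹ * ℓ.2) ∈ M.L := by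
  rw [← M.lat.map_mem]
  simpa [M.lam_pos.ne', M.mu_ne_zero] using hℓ

theorem diag_pow_mem {ℓ : ℝ × ℝ} (hℓ : ℓ ∈ M.L) (n : ℕ) :
    (M.lam ^ n * ℓ.1, M.mu ^ n * ℓ.2) ∈ M.L := by
  induction n with
  | zero => simpa using hℓ
  | succ n ih =>
    have := M.diag_mem ih
    simpa [pow_succ', mul_assoc] using this

theorem diag_inv_pow_mem {ℓ : ℝ × ℝ} (hℓ : ℓ ∈ M.L) (n : ℕ) :
    (M.lam⁻¹ ^ n * ℓ.1, M.mu⁻¹ ^ n * ℓ.2) ∈ M.L := by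
  induction n with
  | zero => simpa using hℓ
  | succ n ih =>
    have := M.diag_inv_mem ih
    simpa [pow_succ', mul_assoc] using this

/-- A lattice point on the unstable axis is contracted to the origin by the inverse linear map,
which preserves the discrete lattice. -/
theorem eq_zero_of_snd {ℓ : ℝ × ℝ} (hℓ : ℓ ∈ M.L) (h : ℓ.2 = 0) : ℓ = 0 := by
  by_contra hne
  obtain ⟨δ, hδ, hd⟩ := M.lat.discrete
  have h1 : Tendsto (fun n : ℕ => M.lam⁻¹ ^ n * |ℓ.1|) atTop (𝓝 0) := by
    simpa using (tendsto_pow_atTop_nhds_zero_of_lt_one (inv_nonneg.2 M.lam_pos.le)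
      (inv_lt_one_of_one_lt₀ M.pert.one_lt)).mul_const |ℓ.1|
  obtain ⟨n, hn⟩ := (h1.eventually_lt_const hδ).exists
  have h2 := hd _ (M.diag_inv_pow_mem hℓ n) fun h0 => hne <| Prod.ext (by
    have := congrArg Prod.fst h0
    simpa [M.lam_pos.ne'] using this) h
  rw [Prod.norm_def, h, mul_zero, norm_zero, max_eq_left (norm_nonneg _), norm_mul, norm_pow,
    norm_inv, Real.norm_of_nonneg M.lam_pos.le, Real.norm_eq_abs] at h2
  linarith

/-- The second coordinates form a subgroup of the line; multiplying a nonzero one by powers of `mu`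
gives arbitrarily small nonzero elements. -/
theorem dense_snd : ∀ x y : ℝ, x < y → ∃ ℓ ∈ M.L, ℓ.2 ∈ Ioo x y := by
  have hd : Dense ((M.L.map (AddMonoidHom.snd ℝ ℝ) : AddSubgroup ℝ) : Set ℝ) := by
    refine AddSubgroup.dense_of_not_isolated_zero _ fun ε hε => ?_
    obtain ⟨ℓ, hℓ, h0⟩ := M.lat.nontrivial
    have hℓ2 : 0 < |ℓ.2| := abs_pos.2 fun h => h0 (M.eq_zero_of_snd hℓ h)
    obtain ⟨n, hn⟩ := ((M.tendsto_abs_mu_pow |ℓ.2|).eventually_lt_const hε).exists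
    rw [← abs_pow, ← abs_mul] at hn
    have hmem := M.diag_pow_mem hℓ n
    have hpos : 0 < |M.mu ^ n * ℓ.2| := by
      rw [abs_mul, abs_pow]; have := M.abs_mu_pos; positivity
    refine ⟨|M.mu ^ n * ℓ.2|, ?_, hpos, hn⟩
    rcases abs_choice (M.mu ^ n * ℓ.2) with h | h <;> rw [h]
    · exact ⟨_, hmem, rfl⟩
    · exact ⟨_, M.L.neg_mem hmem, rfl⟩
  intro x y hxy
  obtain ⟨_, ⟨ℓ, hℓ, rfl⟩, h⟩ := hd.exists_between hxy
  exact ⟨ℓ, hℓ, h⟩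

/-! #### The diffeomorphism -/

/-- The derivative of the perturbation in the unstable direction. -/
def dk (z : ℝ × ℝ) : ℝ := fderiv ℝ M.k z (1, 0)

/-- The derivative of the diffeomorphism in the stable direction. -/
def jac (z : ℝ × ℝ) : ℝ := daJac M.mu M.k z

theorem jac_ne_zero (z : ℝ × ℝ) : M.jac z ≠ 0 := fun h => by
  have := M.pert.jac_pos z
  rw [jac] at h
  rw [h, mul_zero] at this
  exact lt_irrefl _ this

theorem hasFDerivAt_daMap (z : ℝ × ℝ) : HasFDerivAt (daMap M.lam M.mu M.k)
    (lowerTri M.lam (M.dk z) (M.jac z) M.lam_pos.ne' (M.jac_ne_zero z) :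
      (ℝ × ℝ) →L[ℝ] (ℝ × ℝ)) z := by
  have hk : HasFDerivAt M.k (fderiv ℝ M.k z) z :=
    ((M.pert.smooth.differentiable (by simp)) z).hasFDerivAt
  have h1 : HasFDerivAt (daMap M.lam M.mu M.k) _ z :=
    ((hasFDerivAt_fst (𝕜 := ℝ)).const_mul M.lam).prodMk
      (((hasFDerivAt_snd (𝕜 := ℝ)).const_mul M.mu).add hk)
  refine h1.congr_fderiv ?_
  rw [coe_lowerTri]
  ext <;> simp [dk, jac, daJac]

theorem contDiff_daMap : ContDiff ℝ (⊤ : ℕ∞) (daMap M.lam M.mu M.k) := by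
  have := M.pert.smooth
  unfold daMap
  fun_prop

theorem exists_bound_k : ∃ C, ∀ z, |M.k z| ≤ C :=
  M.cover.exists_bound M.pert.smooth.continuous M.pert.periodic

theorem hasDerivAt_vertical (r s : ℝ) :
    HasDerivAt (fun s => M.mu * s + M.k (r, s)) (M.jac (r, s)) s := by
  have h1 : HasDerivAt (fun s => M.k (r, s)) (fderiv ℝ M.k (r, s) (0, 1)) s :=
    ((M.pert.smooth.differentiable (by simp)) (r, s)).hasFDerivAt.comp_hasDerivAt s
      ((hasDerivAt_const s r).prodMk (hasDerivAt_id s))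
  have h2 := ((hasDerivAt_id' s).const_mul M.mu).fun_add h1
  rwa [mul_one] at h2

/-- The extra factor `mu` treats both signs at once: the vertical derivative has the sign of `mu`.
-/
theorem strictMono_vertical (r : ℝ) : StrictMono fun s => M.mu * (M.mu * s + M.k (r, s)) := by
  refine strictMono_of_deriv_pos fun s => ?_
  rw [((M.hasDerivAt_vertical r s).const_mul M.mu).deriv]
  exact M.pert.jac_pos (r, s)

theorem bijective_daMap : Function.Bijective (daMap M.lam M.mu M.k) := by
  constructor
  · intro z z' h
    have h1 : z.1 = z'.1 := mul_left_cancel₀ M.lam_pos.ne' (congrArg Prod.fst h)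
    have h2 : M.mu * z.2 + M.k z = M.mu * z'.2 + M.k z' := congrArg Prod.snd h
    refine Prod.ext h1 ((M.strictMono_vertical z.1).injective ?_)
    have e : (z.1, z'.2) = z' := Prod.ext h1 rfl
    simp only [e, Prod.mk.eta, h2]
  · intro y
    obtain ⟨C, hC⟩ := M.exists_bound_k
    have hmu := mul_self_pos.2 M.mu_ne_zero
    have hsurj : Function.Surjective fun s => M.mu * (M.mu * s + M.k (M.lam⁻¹ * y.1, s)) := by
      have hk := M.pert.smooth.continuous
      have hb : ∀ s, |M.mu * M.k (M.lam⁻¹ * y.1, s)| ≤ |M.mu| * C := fun s => by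
        rw [abs_mul]; gcongr; exact hC _
      refine Continuous.surjective (by fun_prop) ?_ ?_
      · refine tendsto_atTop_mono (f := fun s => M.mu * M.mu * s - |M.mu| * C) (fun s => ?_) ?_
        · linarith [(abs_le.1 (hb s)).1]
        · exact tendsto_atTop_add_const_right _ _ (tendsto_id.const_mul_atTop hmu)
      · refine tendsto_atBot_mono (fun s => ?_) (tendsto_atBot_add_const_right atBot (|M.mu| * C)
          (tendsto_id.const_mul_atBot hmu))
        simp only [id]
        linarith [(abs_le.1 (hb s)).2]
    obtain ⟨s, hs⟩ := hsurj (M.mu * y.2)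
    refine ⟨(M.lam⁻¹ * y.1, s), Prod.ext ?_ (mul_left_cancel₀ M.mu_ne_zero hs)⟩
    simp [daMap, M.lam_pos.ne']

/-- The diffeomorphism of the plane. -/
def F : (ℝ × ℝ) ≃ₜ (ℝ × ℝ) :=
  (Equiv.ofBijective _ M.bijective_daMap).toHomeomorphOfContinuousOpen
    M.contDiff_daMap.continuous (isOpenMap_of_hasStrictFDerivAt_equiv fun z =>
      M.contDiff_daMap.contDiffAt.hasStrictFDerivAt' (M.hasFDerivAt_daMap z) (by simp))

theorem F_apply (z : ℝ × ℝ) : M.F z = (M.lam * z.1, M.mu * z.2 + M.k z) := rfl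

theorem contDiff_F : ContDiff ℝ (⊤ : ℕ∞) M.F := M.contDiff_daMap

theorem hasFDerivAt_F (z : ℝ × ℝ) : HasFDerivAt M.F
    (lowerTri M.lam (M.dk z) (M.jac z) M.lam_pos.ne' (M.jac_ne_zero z) :
      (ℝ × ℝ) →L[ℝ] (ℝ × ℝ)) z := M.hasFDerivAt_daMap z

theorem contDiff_F_symm : ContDiff ℝ (⊤ : ℕ∞) M.F.symm :=
  M.F.toEquiv.contDiff_symm_of_invertible (by simp) M.contDiff_F _ M.hasFDerivAt_F

theorem hasFDerivAt_F_symm (z : ℝ × ℝ) : HasFDerivAt M.F.symm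
    ((lowerTri M.lam (M.dk (M.F.symm z)) (M.jac (M.F.symm z)) M.lam_pos.ne'
      (M.jac_ne_zero _)).symm : (ℝ × ℝ) →L[ℝ] (ℝ × ℝ)) z :=
  HasFDerivAt.of_local_left_inverse M.F.symm.continuous.continuousAt (M.hasFDerivAt_F _)
    (Eventually.of_forall M.F.apply_symm_apply)

theorem F_add {ℓ : ℝ × ℝ} (hℓ : ℓ ∈ M.L) (z : ℝ × ℝ) :
    M.F (z + ℓ) = M.F z + (M.lam * ℓ.1, M.mu * ℓ.2) := by
  rw [F_apply, F_apply, M.pert.periodic ℓ hℓ]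
  ext
  · simp; ring
  · simp; ring

theorem F_symm_add {ℓ : ℝ × ℝ} (hℓ : ℓ ∈ M.L) (z : ℝ × ℝ) :
    M.F.symm (z + ℓ) = M.F.symm z + (M.lam⁻¹ * ℓ.1, M.mu⁻¹ * ℓ.2) := by
  rw [Homeomorph.symm_apply_eq, M.F_add (M.diag_inv_mem hℓ), M.F.apply_symm_apply]
  simp [M.lam_pos.ne', M.mu_ne_zero]

theorem F_zero : M.F 0 = 0 := by
  rw [F_apply, M.pert.zero]; simp

theorem F_sub_mem {z z' : ℝ × ℝ} : M.F z - M.F z' ∈ M.L ↔ z - z' ∈ M.L := by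
  constructor
  · intro h
    have h1 := M.F_symm_add h (M.F z')
    rw [add_sub_cancel, M.F.symm_apply_apply, M.F.symm_apply_apply] at h1
    rw [h1, add_sub_cancel_left]
    exact M.diag_inv_mem h
  · intro h
    have h1 := M.F_add h z'
    rw [add_sub_cancel] at h1
    rw [h1, add_sub_cancel_left]
    exact M.diag_mem h

/-! #### Cohomological equations over the inverse -/

/-- The difference between the solution and its translate solves the homogeneous equation up to
replacing `ℓ` by its preimage in the lattice, so iteration bounds it by `θ ^ n` times a constant. -/
theorem periodic_of_cohomological {v c j : ℝ × ℝ → ℝ} {θ C : ℝ} (hθ : 0 ≤ θ) (hθ1 : θ < 1)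
    (hv : ∀ z, |v z| ≤ C) (hj : ∀ z, |j z| ≤ θ) (heq : ∀ z, v z = c z + j z * v (M.F.symm z))
    (hc : ∀ ℓ ∈ M.L, ∀ z, c (z + ℓ) = c z) (hjp : ∀ ℓ ∈ M.L, ∀ z, j (z + ℓ) = j z) :
    ∀ ℓ ∈ M.L, ∀ z, v (z + ℓ) = v z := by
  have h : ∀ n : ℕ, ∀ ℓ ∈ M.L, ∀ z, |v (z + ℓ) - v z| ≤ θ ^ n * (2 * C) := by
    intro n
    induction n with
    | zero =>
      intro ℓ _ z
      have := abs_sub (v (z + ℓ)) (v z)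
      linarith [hv (z + ℓ), hv z]
    | succ n ih =>
      intro ℓ hℓ z
      rw [heq (z + ℓ), heq z, hc ℓ hℓ, hjp ℓ hℓ, M.F_symm_add hℓ, add_sub_add_left_eq_sub, ← mul_sub,
        abs_mul, pow_succ', mul_assoc]
      exact mul_le_mul (hj z) (ih _ (M.diag_inv_mem hℓ) _) (abs_nonneg _) hθ
  intro ℓ hℓ z
  have h1 : Tendsto (fun n : ℕ => θ ^ n * (2 * C)) atTop (𝓝 0) := by
    simpa using (tendsto_pow_atTop_nhds_zero_of_lt_one hθ hθ1).mul_const (2 * C)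
  have h2 := ge_of_tendsto' h1 fun n => h n ℓ hℓ z
  exact sub_eq_zero.1 (abs_nonpos_iff.1 h2)

theorem contDiff_jac : ContDiff ℝ (⊤ : ℕ∞) M.jac := by
  have h : ContDiff ℝ (⊤ : ℕ∞) (fderiv ℝ M.k) := M.pert.smooth.fderiv_right (by simp)
  exact contDiff_const.add (h.clm_apply contDiff_const)

theorem contDiff_dk : ContDiff ℝ (⊤ : ℕ∞) M.dk := by
  have h : ContDiff ℝ (⊤ : ℕ∞) (fderiv ℝ M.k) := M.pert.smooth.fderiv_right (by simp)
  exact h.clm_apply contDiff_const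

theorem fderiv_periodic {W : Type*} [NormedAddCommGroup W] [NormedSpace ℝ W] {u : ℝ × ℝ → W}
    (hp : ∀ ℓ ∈ M.L, ∃ c, ∀ z, u (z + ℓ) = u z + c) :
    ∀ ℓ ∈ M.L, ∀ z, fderiv ℝ u (z + ℓ) = fderiv ℝ u z := by
  intro ℓ hℓ z
  obtain ⟨c, hc⟩ := hp ℓ hℓ
  rw [← fderiv_comp_add_right]
  simp only [hc, fderiv_add_const]

theorem jac_periodic : ∀ ℓ ∈ M.L, ∀ z, M.jac (z + ℓ) = M.jac z := by
  intro ℓ hℓ z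
  rw [jac, jac, daJac, daJac,
    M.fderiv_periodic (fun ℓ hℓ => ⟨0, fun z => by rw [M.pert.periodic ℓ hℓ, add_zero]⟩) ℓ hℓ]

theorem dk_periodic : ∀ ℓ ∈ M.L, ∀ z, M.dk (z + ℓ) = M.dk z := by
  intro ℓ hℓ z
  rw [dk, dk,
    M.fderiv_periodic (fun ℓ hℓ => ⟨0, fun z => by rw [M.pert.periodic ℓ hℓ, add_zero]⟩) ℓ hℓ]

/-- The invariant slope field is of class `C^{1+α}`. -/
theorem exists_slope : ∃ α : ℝ≥0, 0 < α ∧ α < 1 ∧ ∃ a : ℝ × ℝ → ℝ, ContDiff ℝ 1 a ∧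
    (∃ C, ∀ z, |a z| ≤ C) ∧ (∃ K : ℝ≥0, LipschitzWith K a) ∧
    (∃ C : ℝ≥0, HolderWith C α (fderiv ℝ a)) ∧
    (∀ z, M.lam * a (M.F z) = M.dk z + M.jac z * a z) ∧ ∀ ℓ ∈ M.L, ∀ z, a (z + ℓ) = a z := by
  have hl0 := M.lam_pos
  have hl1 := M.pert.one_lt
  -- The ratio of the largest vertical derivative to the unstable rate: the domination constant.
  set θ := (1 + M.lam) / 2 * M.lam⁻¹ with hθ
  have hθ0 : 0 < θ := by positivity
  have hθ1 : θ < 1 := by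
    rw [hθ, ← div_eq_mul_inv, div_lt_one hl0]; linarith
  set S := M.F.symm with hS
  set j : ℝ × ℝ → ℝ := fun z => M.lam⁻¹ * M.jac (S z) with hj
  set c : ℝ × ℝ → ℝ := fun z => M.lam⁻¹ * M.dk (S z) with hc
  have hSs : ContDiff ℝ (⊤ : ℕ∞) S := M.contDiff_F_symm
  have hjs : ContDiff ℝ (⊤ : ℕ∞) j := contDiff_const.mul (M.contDiff_jac.comp hSs)
  have hcs : ContDiff ℝ (⊤ : ℕ∞) c := contDiff_const.mul (M.contDiff_dk.comp hSs)
  have hjp : ∀ ℓ ∈ M.L, ∀ z, j (z + ℓ) = j z := fun ℓ hℓ z => by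
    simp only [hj]
    rw [M.F_symm_add hℓ, M.jac_periodic _ (M.diag_inv_mem hℓ)]
  have hcp : ∀ ℓ ∈ M.L, ∀ z, c (z + ℓ) = c z := fun ℓ hℓ z => by
    simp only [hc]
    rw [M.F_symm_add hℓ, M.dk_periodic _ (M.diag_inv_mem hℓ)]
  have hone : (1 : WithTop ℕ∞) ≤ ((⊤ : ℕ∞) : WithTop ℕ∞) := by exact_mod_cast le_top
  obtain ⟨K1, hK10, hSb, -, hSl⟩ := M.cover.exists_bound_lipschitz (u := fderiv ℝ S)
    ((hSs.fderiv_right (m := (⊤ : ℕ∞)) (by simp)).of_le hone) (M.fderiv_periodic fun ℓ hℓ => ⟨_, fun z => M.F_symm_add hℓ z⟩)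
  obtain ⟨K2, hK20, hjb, -, hjl⟩ := M.cover.exists_bound_lipschitz (u := fderiv ℝ j)
    ((hjs.fderiv_right (m := (⊤ : ℕ∞)) (by simp)).of_le hone) (M.fderiv_periodic fun ℓ hℓ => ⟨0, fun z => by rw [hjp ℓ hℓ, add_zero]⟩)
  obtain ⟨K3, hK30, hcb, -, hcl⟩ := M.cover.exists_bound_lipschitz (u := fderiv ℝ c)
    ((hcs.fderiv_right (m := (⊤ : ℕ∞)) (by simp)).of_le hone) (M.fderiv_periodic fun ℓ hℓ => ⟨0, fun z => by rw [hcp ℓ hℓ, add_zero]⟩)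
  obtain ⟨K4, hK40, hcK, -, -⟩ := M.cover.exists_bound_lipschitz (hcs.of_le hone) hcp
  set K := 1 + K1 + K2 + K3 + K4 with hK
  have hjac : ∀ z, |M.jac z| ≤ (1 + M.lam) / 2 := M.pert.jac_le
  have hjθ : ∀ z, |j z| ≤ θ := fun z => by
    simp only [hj, abs_mul, abs_inv, abs_of_pos hl0]
    rw [hθ, mul_comm]
    gcongr
    exact hjac _
  -- The vertical entry of `DS` is `1 / jac`, which cancels the factor `jac` in `j`, so strong
  -- vertical contraction of `F` does no harm. The bound `slope_le` is exactly what makes the second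
  -- row at most `λ⁻¹ (1 + (λ - 1) / 2) = θ`.
  have hjS : ∀ z, ‖j z • fderiv ℝ S z‖ ≤ θ := by
    intro z
    have hd := M.jac_ne_zero (S z)
    refine ContinuousLinearMap.opNorm_le_bound _ hθ0.le fun v => ?_
    have e : (j z • fderiv ℝ S z) v = (M.lam⁻¹ * (M.lam⁻¹ * M.jac (S z) * v.1),
        M.lam⁻¹ * (v.2 - M.lam⁻¹ * M.dk (S z) * v.1)) := by
      rw [(M.hasFDerivAt_F_symm z).fderiv]
      have e1 : ((lowerTri M.lam (M.dk (S z)) (M.jac (S z)) M.lam_pos.ne' hd).symm :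
        (ℝ × ℝ) →L[ℝ] (ℝ × ℝ)) v = (M.lam⁻¹ * v.1, (M.jac (S z))⁻¹ * (v.2 -
          M.dk (S z) * (M.lam⁻¹ * v.1))) := by
        rw [ContinuousLinearEquiv.coe_coe, ContinuousLinearEquiv.symm_apply_eq, lowerTri_apply]
        ext
        · simp [hl0.ne']
        · simp [hd]
      rw [smul_apply, e1]
      simp only [hj, Prod.smul_mk, smul_eq_mul]
      ext
      · simp only; ring
      · simp only; field_simp
    have hv1 : |v.1| ≤ ‖v‖ := norm_fst_le v
    have hv2 : |v.2| ≤ ‖v‖ := norm_snd_le v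
    have hli : 0 < M.lam⁻¹ := inv_pos.2 hl0
    have hli1 : M.lam⁻¹ ≤ 1 := inv_le_one_of_one_le₀ hl1.le
    rw [e, Prod.norm_def]
    refine max_le ?_ ?_
    · simp only [Real.norm_eq_abs, abs_mul, abs_of_pos hli]
      calc M.lam⁻¹ * (M.lam⁻¹ * |M.jac (S z)| * |v.1|)
          ≤ M.lam⁻¹ * (1 * ((1 + M.lam) / 2) * ‖v‖) := by gcongr; exact hjac _
        _ = θ * ‖v‖ := by rw [hθ]; ring
    · simp only [Real.norm_eq_abs, abs_mul, abs_of_pos hli]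
      have h1 : |M.lam⁻¹ * M.dk (S z) * v.1| ≤ (M.lam - 1) / 2 * ‖v‖ := by
        rw [abs_mul, abs_mul, abs_of_pos hli]
        refine mul_le_mul ?_ hv1 (abs_nonneg _) (by linarith)
        calc M.lam⁻¹ * |M.dk (S z)| ≤ M.lam⁻¹ * (M.lam * (M.lam - 1) / 2) := by
              gcongr; exact M.pert.slope_le _
          _ = _ := by field_simp
      calc M.lam⁻¹ * |v.2 - M.lam⁻¹ * M.dk (S z) * v.1|
          ≤ M.lam⁻¹ * (‖v‖ + (M.lam - 1) / 2 * ‖v‖) := by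
            gcongr
            exact (abs_sub _ _).trans (add_le_add hv2 h1)
        _ = θ * ‖v‖ := by rw [hθ]; ring
  obtain ⟨α, hα, hα1, a, ha1, ⟨C, haC⟩, ⟨K', haK'⟩, haH, heq⟩ :=
    exists_cohomological_solution (K := K) hθ0 hθ1 (by linarith)
      (hSs.differentiable (by simp)) (fun x => (hSb x).trans (by linarith))
      (fun x y => (hSl x y).trans (by gcongr; linarith))
      (hjs.differentiable (by simp)) hjθ (fun x => (hjb x).trans (by linarith))
      (fun x y => (hjl x y).trans (by gcongr; linarith))
      (hcs.differentiable (by simp)) (fun x => (hcK x).trans (by linarith))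
      (fun x => (hcb x).trans (by linarith))
      (fun x y => (hcl x y).trans (by gcongr; linarith)) hjS
  refine ⟨α, hα, hα1, a, ha1, ⟨C, haC⟩, ⟨K'.toNNReal, ?_⟩, haH, fun z => ?_, ?_⟩
  · refine lipschitzWith_of_nnnorm_fderiv_le (ha1.differentiable one_ne_zero) fun x => ?_
    rw [← NNReal.coe_le_coe, coe_nnnorm]
    exact (haK' x).trans (Real.le_coe_toNNReal K')
  · rw [heq]
    simp only [hj, hc, hS, M.F.symm_apply_apply]
    field_simp
  · exact M.periodic_of_cohomological hθ0.le hθ1 haC hjθ heq hcp hjp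

/-- The Hölder exponent of the model. -/
def α : ℝ≥0 := M.exists_slope.choose

theorem α_pos : 0 < M.α := M.exists_slope.choose_spec.1

theorem α_lt_one : M.α < 1 := M.exists_slope.choose_spec.2.1

/-- The slope of the unstable direction. -/
def slope : ℝ × ℝ → ℝ := M.exists_slope.choose_spec.2.2.choose

theorem slope_spec : ContDiff ℝ 1 M.slope ∧
    (∃ C, ∀ z, |M.slope z| ≤ C) ∧ (∃ K : ℝ≥0, LipschitzWith K M.slope) ∧
    (∃ C : ℝ≥0, HolderWith C M.α (fderiv ℝ M.slope)) ∧
    (∀ z, M.lam * M.slope (M.F z) = M.dk z + M.jac z * M.slope z) ∧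
    ∀ ℓ ∈ M.L, ∀ z, M.slope (z + ℓ) = M.slope z :=
  M.exists_slope.choose_spec.2.2.choose_spec

theorem slope_F (z : ℝ × ℝ) : M.lam * M.slope (M.F z) = M.dk z + M.jac z * M.slope z :=
  M.slope_spec.2.2.2.2.1 z

theorem slope_add {ℓ : ℝ × ℝ} (hℓ : ℓ ∈ M.L) (z : ℝ × ℝ) : M.slope (z + ℓ) = M.slope z :=
  M.slope_spec.2.2.2.2.2 ℓ hℓ z

theorem isC1HolderOn_slope : IsC1HolderOn M.α M.slope univ := by
  obtain ⟨h1, -, -, ⟨C, hC⟩, -⟩ := M.slope_spec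
  exact isC1HolderOn_univ.2 ⟨h1, fun x => ⟨univ, univ_mem, C, hC.holderOnWith _⟩⟩

theorem continuous_slope : Continuous M.slope := M.slope_spec.1.continuous

/-! #### The flow -/

theorem exists_flow : ∃ Φ, IsSlopeFlow M.slope Φ := by
  obtain ⟨-, ⟨C, hC⟩, ⟨K, hK⟩, -⟩ := M.slope_spec
  exact exists_isSlopeFlow hK hC

/-- The flow along the unstable direction. -/
def Φ : ℝ → ℝ × ℝ → ℝ × ℝ := M.exists_flow.choose

theorem isSlopeFlow : IsSlopeFlow M.slope M.Φ := M.exists_flow.choose_spec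

theorem Φ_zero (z : ℝ × ℝ) : M.Φ 0 z = z := M.isSlopeFlow.zero z

theorem Φ_fst (t : ℝ) (z : ℝ × ℝ) : (M.Φ t z).1 = z.1 + t := M.isSlopeFlow.fst t z

theorem Φ_add (s t : ℝ) (z : ℝ × ℝ) : M.Φ (s + t) z = M.Φ s (M.Φ t z) := by
  obtain ⟨-, -, ⟨K, hK⟩, -⟩ := M.slope_spec
  exact M.isSlopeFlow.add hK s t z

theorem Φ_neg_cancel (t : ℝ) (z : ℝ × ℝ) : M.Φ (-t) (M.Φ t z) = z := by
  rw [← M.Φ_add, neg_add_cancel, M.Φ_zero]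

theorem Φ_cancel_neg (t : ℝ) (z : ℝ × ℝ) : M.Φ t (M.Φ (-t) z) = z := by
  rw [← M.Φ_add, add_neg_cancel, M.Φ_zero]

theorem isC1HolderOn_Φ : IsC1HolderOn M.α (fun q : ℝ × (ℝ × ℝ) => M.Φ q.1 q.2) univ := by
  obtain ⟨h1, -, ⟨K, hK⟩, ⟨C, hC⟩, -⟩ := M.slope_spec
  exact M.isSlopeFlow.isC1HolderOn hK h1 M.α_pos M.α_lt_one.le hC

theorem continuous_Φ : Continuous fun q : ℝ × (ℝ × ℝ) => M.Φ q.1 q.2 :=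
  (isC1HolderOn_univ.1 M.isC1HolderOn_Φ).1.continuous

theorem eq_Φ {γ : ℝ → ℝ × ℝ} (h : ∀ t, HasDerivAt γ (slopeField M.slope (γ t)) t) (t : ℝ) :
    γ t = M.Φ t (γ 0) := by
  obtain ⟨-, -, ⟨K, hK⟩, -⟩ := M.slope_spec
  exact congrFun (eq_of_integralCurve (t₀ := 0) hK h (M.isSlopeFlow.hasDerivAt (γ 0))
    (M.Φ_zero _).symm) t

theorem Φ_add_lattice {ℓ : ℝ × ℝ} (hℓ : ℓ ∈ M.L) (t : ℝ) (z : ℝ × ℝ) :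
    M.Φ t (z + ℓ) = M.Φ t z + ℓ := by
  have := M.eq_Φ (γ := fun t => M.Φ t z + ℓ) (fun t => by
    rw [slopeField, M.slope_add hℓ]
    exact (M.isSlopeFlow.hasDerivAt z t).add_const ℓ) t
  rw [this, M.Φ_zero]

theorem F_slopeField (z : ℝ × ℝ) :
    lowerTri M.lam (M.dk z) (M.jac z) M.lam_pos.ne' (M.jac_ne_zero z) (slopeField M.slope z) =
      M.lam • slopeField M.slope (M.F z) := by
  rw [lowerTri_apply, slopeField, slopeField, Prod.smul_mk, smul_eq_mul, smul_eq_mul, M.slope_F,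
    mul_one, mul_one]

/-- `DF` maps the field `(1, slope)` to `λ` times itself, so the image of an orbit, with time
divided by `λ`, is again an integral curve. -/
theorem F_Φ (t : ℝ) (z : ℝ × ℝ) : M.F (M.Φ t z) = M.Φ (M.lam * t) (M.F z) := by
  have hl := M.lam_pos.ne'
  have := M.eq_Φ (γ := fun t => M.F (M.Φ (M.lam⁻¹ * t) z)) (fun t => by
    have h1 : HasDerivAt (fun t => M.Φ (M.lam⁻¹ * t) z)
        (M.lam⁻¹ • slopeField M.slope (M.Φ (M.lam⁻¹ * t) z)) t := by
      have := (M.isSlopeFlow.hasDerivAt z (M.lam⁻¹ * t)).scomp t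
        ((hasDerivAt_id' t).const_mul M.lam⁻¹)
      rwa [mul_one] at this
    have h2 := (M.hasFDerivAt_F (M.Φ (M.lam⁻¹ * t) z)).comp_hasDerivAt t h1
    refine h2.congr_deriv ?_
    rw [map_smul, ContinuousLinearEquiv.coe_coe, M.F_slopeField, smul_smul, inv_mul_cancel₀ hl,
      one_smul]) (M.lam * t)
  simp only [mul_zero, M.Φ_zero] at this
  rw [← this, inv_mul_cancel_left₀ hl]

theorem exists_Φ_bound : ∃ C, ∀ t z, |(M.Φ t z).2 - z.2| ≤ C * |t| := by
  obtain ⟨-, ⟨C, hC⟩, -⟩ := M.slope_spec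
  refine ⟨C, fun t z => ?_⟩
  have := convex_univ.norm_image_sub_le_of_norm_hasDerivWithin_le (f := fun t => (M.Φ t z).2)
    (C := C) (x := 0) (y := t)
    (fun t _ => (M.isSlopeFlow.hasDerivAt_snd z t).hasDerivWithinAt)
    (fun t _ => hC _) (mem_univ _) (mem_univ _)
  simpa [M.Φ_zero] using this

end DAModel

namespace DAModel

variable (M : DAModel)

/-! #### The semiconjugacy to the linear map -/

/-- The solution is `u = -∑ mu ^ n k ∘ F⁻⁽ⁿ⁺¹⁾`. The equation is the one that turns the second
coordinate of `F` into multiplication by `mu` after adding `u`. -/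
theorem exists_u : ∃ u : ℝ × ℝ → ℝ, Continuous u ∧ (∃ C, ∀ z, |u z| ≤ C) ∧
    (∀ z, u (M.F z) = M.mu * u z - M.k z) ∧ ∀ ℓ ∈ M.L, ∀ z, u (z + ℓ) = u z := by
  obtain ⟨C, hC⟩ := M.exists_bound_k
  set d : ℕ → ℝ × ℝ → ℝ := fun n z => M.mu ^ n * -M.k (M.F.symm^[n] (M.F.symm z)) with hd
  have hdb : ∀ n z, ‖d n z‖ ≤ |M.mu| ^ n * C := fun n z => by
    simp only [hd, norm_mul, norm_pow, norm_neg, Real.norm_eq_abs]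
    gcongr
    exact hC _
  have hs : Summable fun n : ℕ => |M.mu| ^ n * C :=
    (summable_geometric_of_lt_one (abs_nonneg _) M.abs_mu_lt_one).mul_right C
  have hsum : ∀ z, Summable fun n => d n z := fun z => Summable.of_norm_bounded hs fun n => hdb n z
  have hC' : ∀ z, |∑' n, d n z| ≤ ∑' n : ℕ, |M.mu| ^ n * C := fun z =>
    tsum_of_norm_bounded (f := fun n => d n z) hs.hasSum fun n => hdb n z
  have heq : ∀ z, ∑' n, d n z = -M.k (M.F.symm z) + M.mu * ∑' n, d n (M.F.symm z) := by
    intro z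
    rw [(hsum z).tsum_eq_zero_add, ← tsum_mul_left]
    congr 1
    · simp [hd]
    · refine tsum_congr fun n => ?_
      simp only [hd, Function.iterate_succ_apply]
      ring
  refine ⟨fun z => ∑' n, d n z, ?_, ⟨_, hC'⟩, fun z => ?_, ?_⟩
  · refine continuous_tsum (fun n => ?_) hs hdb
    have h1 := M.F.symm.continuous
    have h2 := h1.iterate n
    have h3 := M.pert.smooth.continuous
    fun_prop
  · simp only
    rw [heq (M.F z), M.F.symm_apply_apply]; ring
  · refine M.periodic_of_cohomological (c := fun z => -M.k (M.F.symm z)) (j := fun _ => M.mu)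
      (abs_nonneg _) M.abs_mu_lt_one hC' (fun _ => le_rfl) heq (fun ℓ hℓ z => ?_) fun _ _ _ => rfl
    rw [M.F_symm_add hℓ, M.pert.periodic _ (M.diag_inv_mem hℓ)]

/-- The displacement of the semiconjugacy along the stable direction. -/
def u : ℝ × ℝ → ℝ := M.exists_u.choose

theorem continuous_u : Continuous M.u := M.exists_u.choose_spec.1

theorem exists_bound_u : ∃ C, ∀ z, |M.u z| ≤ C := M.exists_u.choose_spec.2.1

theorem u_F (z : ℝ × ℝ) : M.u (M.F z) = M.mu * M.u z - M.k z := M.exists_u.choose_spec.2.2.1 z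

theorem u_add {ℓ : ℝ × ℝ} (hℓ : ℓ ∈ M.L) (z : ℝ × ℝ) : M.u (z + ℓ) = M.u z :=
  M.exists_u.choose_spec.2.2.2 ℓ hℓ z

/-- The semiconjugacy on the universal cover. -/
def H (z : ℝ × ℝ) : ℝ × ℝ := (z.1, z.2 + M.u z)

theorem continuous_H : Continuous M.H := by
  have := M.continuous_u
  unfold H
  fun_prop

theorem H_fst (z : ℝ × ℝ) : (M.H z).1 = z.1 := rfl

theorem H_snd (z : ℝ × ℝ) : (M.H z).2 = z.2 + M.u z := rfl

theorem H_F (z : ℝ × ℝ) : M.H (M.F z) = (M.lam * (M.H z).1, M.mu * (M.H z).2) := by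
  ext
  · rfl
  · rw [H_snd, M.u_F, M.F_apply, H_snd]
    simp only; ring

theorem H_add {ℓ : ℝ × ℝ} (hℓ : ℓ ∈ M.L) (z : ℝ × ℝ) : M.H (z + ℓ) = M.H z + ℓ := by
  ext
  · rfl
  · simp only [H_snd, M.u_add hℓ, Prod.snd_add]; ring

theorem H_zero : M.H 0 = 0 := by
  have h := M.u_F 0
  rw [M.F_zero, M.pert.zero, sub_zero] at h
  have h1 : (1 - M.mu) * M.u 0 = 0 := by linarith
  have h2 : 1 - M.mu ≠ 0 := by
    have := (abs_lt.1 M.abs_mu_lt_one).2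
    linarith
  have h3 := (mul_eq_zero.1 h1).resolve_left h2
  ext
  · rfl
  · rw [H_snd, h3]; simp

theorem H_lattice {ℓ : ℝ × ℝ} (hℓ : ℓ ∈ M.L) : M.H ℓ = ℓ := by
  have := M.H_add hℓ 0
  rwa [zero_add, M.H_zero, zero_add] at this

theorem snd_H_iterate (n : ℕ) (z : ℝ × ℝ) :
    (M.H z).2 = M.mu ^ n * (M.H (M.F.symm^[n] z)).2 := by
  induction n with
  | zero => simp
  | succ n ih =>
    have h := M.H_F (M.F.symm^[n + 1] z)
    rw [Function.iterate_succ_apply', M.F.apply_symm_apply] at h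
    rw [ih, h, Function.iterate_succ_apply', pow_succ]
    simp only; ring

theorem fst_symm_iterate (n : ℕ) (z : ℝ × ℝ) : (M.F.symm^[n] z).1 = M.lam⁻¹ ^ n * z.1 := by
  induction n with
  | zero => simp
  | succ n ih =>
    have h : (M.F (M.F.symm^[n + 1] z)).1 = M.lam * (M.F.symm^[n + 1] z).1 := rfl
    rw [Function.iterate_succ_apply', M.F.apply_symm_apply, ih] at h
    rw [Function.iterate_succ_apply', pow_succ', mul_assoc, h, inv_mul_cancel_left₀ M.lam_pos.ne']

theorem F_symm_iterate_Φ (n : ℕ) (t : ℝ) (z : ℝ × ℝ) :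
    M.F.symm^[n] (M.Φ t z) = M.Φ (M.lam⁻¹ ^ n * t) (M.F.symm^[n] z) := by
  induction n with
  | zero => simp
  | succ n ih =>
    rw [Function.iterate_succ_apply', ih, Function.iterate_succ_apply', Homeomorph.symm_apply_eq,
      M.F_Φ, M.F.apply_symm_apply, pow_succ', mul_assoc, mul_inv_cancel_left₀ M.lam_pos.ne']

theorem F_symm_iterate_add (n : ℕ) {ℓ : ℝ × ℝ} (hℓ : ℓ ∈ M.L) (z : ℝ × ℝ) :
    M.F.symm^[n] (z + ℓ) = M.F.symm^[n] z + (M.lam⁻¹ ^ n * ℓ.1, M.mu⁻¹ ^ n * ℓ.2) := by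
  induction n with
  | zero => simp
  | succ n ih =>
    rw [Function.iterate_succ_apply', ih, M.F_symm_add (M.diag_inv_pow_mem hℓ n),
      Function.iterate_succ_apply']
    simp only [pow_succ', mul_assoc]

/-- Backward iteration shortens the flow time, so the two second coordinates of `H` stay a bounded
distance apart along the whole backward orbit; returning multiplies this distance by `|mu| ^ n`. -/
theorem H_Φ (t : ℝ) (z : ℝ × ℝ) : M.H (M.Φ t z) = M.H z + (t, 0) := by
  ext
  · rw [H_fst, M.Φ_fst]; rfl
  · obtain ⟨C, hC⟩ := M.exists_Φ_bound
    obtain ⟨C', hC'⟩ := M.exists_bound_u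
    have hC0 : 0 ≤ C := by
      have := (abs_nonneg _).trans (hC 1 0)
      simpa using this
    have h : ∀ n : ℕ, |(M.H (M.Φ t z)).2 - (M.H z).2| ≤ |M.mu| ^ n * (C * |t| + 2 * C') := by
      intro n
      rw [M.snd_H_iterate n (M.Φ t z), M.snd_H_iterate n z, ← mul_sub, abs_mul, abs_pow]
      gcongr
      rw [M.F_symm_iterate_Φ, H_snd, H_snd]
      set z' := M.F.symm^[n] z
      set t' := M.lam⁻¹ ^ n * t with ht'
      have h1 : |t'| ≤ |t| := by
        rw [ht', abs_mul, abs_pow, abs_inv, abs_of_pos M.lam_pos]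
        exact mul_le_of_le_one_left (abs_nonneg _)
          (pow_le_one₀ (inv_nonneg.2 M.lam_pos.le) (inv_le_one_of_one_le₀ M.pert.one_lt.le))
      have h2 := hC t' z'
      have h3 := hC' (M.Φ t' z')
      have h4 := hC' z'
      have h5 : C * |t'| ≤ C * |t| := by gcongr
      rw [abs_le] at *
      constructor <;> linarith
    have h1 := ge_of_tendsto' (M.tendsto_abs_mu_pow _) h
    have h2 := abs_nonpos_iff.1 h1
    simp only [Prod.snd_add]
    linarith

/-! #### Vertical segments -/

/-- `y` lies between `z` and `z'` on a vertical line. -/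
def Betw (z z' y : ℝ × ℝ) : Prop := y.1 = z.1 ∧ (y.2 - z.2) * (y.2 - z'.2) ≤ 0

theorem betw_of_le {z z' y : ℝ × ℝ} (h : y.1 = z.1) (h1 : z.2 ≤ y.2) (h2 : y.2 ≤ z'.2) :
    Betw z z' y :=
  ⟨h, mul_nonpos_of_nonneg_of_nonpos (sub_nonneg.2 h1) (sub_nonpos.2 h2)⟩

theorem Betw.le_or_le {z z' y : ℝ × ℝ} (h : Betw z z' y) :
    (z.2 ≤ y.2 ∧ y.2 ≤ z'.2) ∨ (z'.2 ≤ y.2 ∧ y.2 ≤ z.2) := by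
  rcases mul_nonpos_iff.1 h.2 with h | h
  · exact Or.inl ⟨sub_nonneg.1 h.1, sub_nonpos.1 h.2⟩
  · exact Or.inr ⟨sub_nonneg.1 h.2, sub_nonpos.1 h.1⟩

/-- The mean value theorem along vertical segments. -/
theorem exists_jac_eq {z z' : ℝ × ℝ} (h : z'.1 = z.1) :
    ∃ ξ, Betw z z' ξ ∧ (M.F z').2 - (M.F z).2 = M.jac ξ * (z'.2 - z.2) := by
  have key : ∀ r s s', s < s' → ∃ ξ ∈ Ioo s s',
      (M.F (r, s')).2 - (M.F (r, s)).2 = M.jac (r, ξ) * (s' - s) := by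
    intro r s s' hs
    obtain ⟨ξ, hξ, h1⟩ := exists_hasDerivAt_eq_slope (fun s => M.mu * s + M.k (r, s))
      (fun s => M.jac (r, s)) hs
      (fun s _ => (M.hasDerivAt_vertical r s).continuousAt.continuousWithinAt)
      (fun s _ => M.hasDerivAt_vertical r s)
    refine ⟨ξ, hξ, ?_⟩
    rw [h1, div_mul_cancel₀ _ (sub_ne_zero.2 hs.ne')]
    rfl
  obtain ⟨r, s⟩ := z
  obtain ⟨r', s'⟩ := z'
  obtain rfl : r' = r := h
  rcases lt_trichotomy s s' with hs | hs | hs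
  · obtain ⟨ξ, hξ, h1⟩ := key r' s s' hs
    exact ⟨(r', ξ), betw_of_le rfl hξ.1.le hξ.2.le, h1⟩
  · subst hs
    exact ⟨(r', s), betw_of_le rfl le_rfl le_rfl, by simp⟩
  · obtain ⟨ξ, hξ, h1⟩ := key r' s' s hs
    refine ⟨(r', ξ), ⟨rfl, mul_nonpos_of_nonpos_of_nonneg ?_ ?_⟩, by simp only; linarith⟩
    · simp only; linarith [hξ.2]
    · simp only; linarith [hξ.1]

/-- The vertical derivative has the constant sign of `mu`, so `F` preserves or reverses the order on
every vertical line; the product in `Betw` is insensitive to which. -/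
theorem betw_F {z z' y : ℝ × ℝ} (h : z'.1 = z.1) :
    Betw (M.F z) (M.F z') (M.F y) ↔ Betw z z' y := by
  have h1 : (M.F y).1 = (M.F z).1 ↔ y.1 = z.1 := by
    rw [M.F_apply, M.F_apply]
    exact mul_right_inj' M.lam_pos.ne'
  constructor
  · rintro ⟨e, hb⟩
    rw [h1] at e
    refine ⟨e, ?_⟩
    obtain ⟨ξ, -, e1⟩ := M.exists_jac_eq e
    obtain ⟨ξ', -, e2⟩ := M.exists_jac_eq (e.trans h.symm)
    rw [e1, e2] at hb
    have hp := mul_pos (M.pert.jac_pos ξ) (M.pert.jac_pos ξ')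
    have hJ : 0 < M.jac ξ * M.jac ξ' := by
      have : M.mu * daJac M.mu M.k ξ * (M.mu * daJac M.mu M.k ξ') =
        M.mu * M.mu * (M.jac ξ * M.jac ξ') := by simp only [jac]; ring
      rw [this] at hp
      exact (mul_pos_iff_of_pos_left (mul_self_pos.2 M.mu_ne_zero)).1 hp
    by_contra hcon
    push Not at hcon
    have := mul_pos hJ hcon
    linarith
  · rintro ⟨e, hb⟩
    refine ⟨h1.2 e, ?_⟩
    obtain ⟨ξ, -, e1⟩ := M.exists_jac_eq e
    obtain ⟨ξ', -, e2⟩ := M.exists_jac_eq (e.trans h.symm)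
    rw [e1, e2]
    have hp := mul_pos (M.pert.jac_pos ξ) (M.pert.jac_pos ξ')
    have hJ : 0 < M.jac ξ * M.jac ξ' := by
      have : M.mu * daJac M.mu M.k ξ * (M.mu * daJac M.mu M.k ξ') =
        M.mu * M.mu * (M.jac ξ * M.jac ξ') := by simp only [jac]; ring
      rw [this] at hp
      exact (mul_pos_iff_of_pos_left (mul_self_pos.2 M.mu_ne_zero)).1 hp
    have := mul_nonneg hJ.le (neg_nonneg.2 hb)
    linarith

theorem fst_symm_iterate_eq (n : ℕ) {z z' : ℝ × ℝ} (h : z'.1 = z.1) :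
    (M.F.symm^[n] z').1 = (M.F.symm^[n] z).1 := by
  rw [M.fst_symm_iterate, M.fst_symm_iterate, h]

theorem betw_symm_iterate (n : ℕ) {z z' y : ℝ × ℝ} (h : z'.1 = z.1) :
    Betw (M.F.symm^[n] z) (M.F.symm^[n] z') (M.F.symm^[n] y) ↔ Betw z z' y := by
  induction n with
  | zero => rfl
  | succ n ih =>
    rw [← ih, Function.iterate_succ_apply', Function.iterate_succ_apply',
      Function.iterate_succ_apply', ← M.betw_F, M.F.apply_symm_apply, M.F.apply_symm_apply,
      M.F.apply_symm_apply]
    simpa only [Function.iterate_succ_apply'] using M.fst_symm_iterate_eq (n + 1) h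

/-- The semiconjugacy is monotone along vertical lines. -/
theorem H_mono {z z' : ℝ × ℝ} (h : z'.1 = z.1) (hle : z.2 ≤ z'.2) : (M.H z).2 ≤ (M.H z').2 := by
  obtain ⟨C, hC⟩ := M.exists_bound_u
  -- The sign of `mu ^ n` compensates for possible reversals of order. Since `H` differs from the
  -- identity by the bounded `u`, monotonicity holds up to an error of order `|mu| ^ n`.
  have h1 : ∀ n : ℕ, 0 ≤ M.mu ^ n * ((M.F.symm^[n] z').2 - (M.F.symm^[n] z).2) := by
    intro n
    induction n with
    | zero => simpa using hle
    | succ n ih =>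
      obtain ⟨ξ, -, e⟩ := M.exists_jac_eq (M.fst_symm_iterate_eq (n + 1) h)
      simp only [Function.iterate_succ_apply', M.F.apply_symm_apply] at e
      simp only [Function.iterate_succ_apply']
      rw [e] at ih
      have hp := M.pert.jac_pos ξ
      have hmu := mul_self_pos.2 M.mu_ne_zero
      set D := (M.F.symm (M.F.symm^[n] z')).2 - (M.F.symm (M.F.symm^[n] z)).2
      have e2 : M.mu * M.mu * (M.mu ^ n * (M.jac ξ * D)) =
          (M.mu * daJac M.mu M.k ξ) * (M.mu ^ (n + 1) * D) := by simp only [jac]; ring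
      have h3 : 0 ≤ (M.mu * daJac M.mu M.k ξ) * (M.mu ^ (n + 1) * D) := by
        rw [← e2]; exact mul_nonneg hmu.le ih
      exact nonneg_of_mul_nonneg_right h3 hp
  have h2 : ∀ n : ℕ, (M.H z).2 - (M.H z').2 ≤ |M.mu| ^ n * (2 * C) := by
    intro n
    rw [M.snd_H_iterate n z, M.snd_H_iterate n z', H_snd, H_snd]
    set a := M.F.symm^[n] z
    set b := M.F.symm^[n] z'
    have e : M.mu ^ n * (a.2 + M.u a) - M.mu ^ n * (b.2 + M.u b) =
        -(M.mu ^ n * (b.2 - a.2)) + M.mu ^ n * (M.u a - M.u b) := by ring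
    have e2 : M.mu ^ n * (M.u a - M.u b) ≤ |M.mu| ^ n * (2 * C) := by
      refine (le_abs_self _).trans ?_
      rw [abs_mul, abs_pow]
      gcongr
      exact (abs_sub _ _).trans (by linarith [hC a, hC b])
    rw [e]
    linarith [h1 n]
  have h3 := ge_of_tendsto' (M.tendsto_abs_mu_pow (2 * C)) h2
  linarith

theorem H_eq_of_betw {z z' y : ℝ × ℝ} (h : z'.1 = z.1) (hH : (M.H z').2 = (M.H z).2)
    (hy : Betw z z' y) : (M.H y).2 = (M.H z).2 := by
  have e1 := hy.1
  rcases hy.le_or_le with ⟨h1, h2⟩ | ⟨h1, h2⟩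
  · exact le_antisymm ((M.H_mono (h.trans e1.symm) h2).trans hH.le) (M.H_mono e1 h1)
  · exact le_antisymm (M.H_mono e1.symm h2) (hH.ge.trans (M.H_mono (e1.trans h.symm) h1))

/-! #### The repelling boxes -/

/-- The neighbourhoods of the lattice points that are repelled. -/
def V : Set (ℝ × ℝ) := boxes M.L M.R M.q

theorem add_mem_V {z ℓ : ℝ × ℝ} (hz : z ∈ M.V) (hℓ : ℓ ∈ M.L) : z + ℓ ∈ M.V := by
  obtain ⟨ℓ', hℓ', h⟩ := hz
  exact ⟨ℓ' + ℓ, M.L.add_mem hℓ' hℓ, by simpa using h⟩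

theorem lattice_mem_V {ℓ : ℝ × ℝ} (hℓ : ℓ ∈ M.L) : ℓ ∈ M.V :=
  ⟨ℓ, hℓ, by simp [M.pert.R_pos], by simp [M.pert.q_pos]⟩

theorem F_symm_mem_box {z : ℝ × ℝ} (h1 : |z.1| ≤ M.R) (h2 : |z.2| ≤ M.q) :
    |(M.F.symm z).1| < M.R ∧ |(M.F.symm z).2| < M.q := by
  refine M.pert.inv_box (M.F.symm z) ?_ ?_
  · change |(M.F (M.F.symm z)).1| ≤ M.R
    rwa [M.F.apply_symm_apply]
  · change |(M.F (M.F.symm z)).2| ≤ M.q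
    rwa [M.F.apply_symm_apply]

theorem F_symm_mem_V {z : ℝ × ℝ} (hz : z ∈ M.V) : M.F.symm z ∈ M.V := by
  obtain ⟨ℓ, hℓ, h1, h2⟩ := hz
  refine ⟨_, M.diag_inv_mem hℓ, ?_⟩
  have h := M.F_symm_add hℓ (z - ℓ)
  rw [sub_add_cancel] at h
  rw [h, add_sub_cancel_right]
  exact M.F_symm_mem_box h1.le h2.le

theorem F_symm_iterate_mem_V {z : ℝ × ℝ} {m n : ℕ} (hmn : m ≤ n) (hz : M.F.symm^[m] z ∈ M.V) :
    M.F.symm^[n] z ∈ M.V := by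
  induction n, hmn using Nat.le_induction with
  | base => exact hz
  | succ n _ ih => rw [Function.iterate_succ_apply']; exact M.F_symm_mem_V ih

/-- The backward orbit stays in the box, so the second coordinate of `H` is bounded along it, and
going forward again contracts by `|mu| ^ n`. -/
theorem snd_H_of_mem_box {z : ℝ × ℝ} (h1 : |z.1| < M.R) (h2 : |z.2| < M.q) : (M.H z).2 = 0 := by
  obtain ⟨C, hC⟩ := M.exists_bound_u
  have hbox : ∀ n : ℕ, |(M.F.symm^[n] z).1| < M.R ∧ |(M.F.symm^[n] z).2| < M.q := by
    intro n
    induction n with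
    | zero => exact ⟨h1, h2⟩
    | succ n ih => rw [Function.iterate_succ_apply']; exact M.F_symm_mem_box ih.1.le ih.2.le
  have h : ∀ n : ℕ, |(M.H z).2| ≤ |M.mu| ^ n * (M.q + C) := by
    intro n
    rw [M.snd_H_iterate n z, abs_mul, abs_pow, H_snd]
    gcongr
    exact (abs_add_le _ _).trans (add_le_add (hbox n).2.le (hC _))
  exact abs_nonpos_iff.1 (ge_of_tendsto' (M.tendsto_abs_mu_pow _) h)

theorem snd_H_of_box {z ℓ : ℝ × ℝ} (hℓ : ℓ ∈ M.L) (h1 : |(z - ℓ).1| < M.R)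
    (h2 : |(z - ℓ).2| < M.q) : (M.H z).2 = ℓ.2 := by
  have h := M.H_add hℓ (z - ℓ)
  rw [sub_add_cancel] at h
  rw [h, Prod.snd_add, M.snd_H_of_mem_box h1 h2, zero_add]

/-- A nontrivial vertical segment in a fibre of the semiconjugacy meets the basin of the source. -/
theorem exists_betw_mem_V {z z' : ℝ × ℝ} (h : z'.1 = z.1) (hne : z'.2 ≠ z.2)
    (hH : (M.H z').2 = (M.H z).2) : ∃ n y, Betw z z' y ∧ M.F.symm^[n] y ∈ M.V := by
  by_contra hcon
  push Not at hcon
  obtain ⟨C, hC⟩ := M.exists_bound_u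
  have hη : 0 ≤ M.η := (abs_nonneg _).trans
    (M.pert.contract _ (hcon 0 z (betw_of_le rfl le_rfl le_rfl |>.1 |> fun e => ⟨e, by simp⟩)))
  -- By assumption no preimage of the segment meets the boxes, so each application of `F` contracts
  -- it by `η`.
  have h1 : ∀ n : ℕ, |z'.2 - z.2| ≤ M.η ^ n * |(M.F.symm^[n] z').2 - (M.F.symm^[n] z).2| := by
    intro n
    induction n with
    | zero => simp
    | succ n ih =>
      refine ih.trans ?_
      have e0 := M.fst_symm_iterate_eq (n + 1) h
      obtain ⟨ξ, hξ, e⟩ := M.exists_jac_eq e0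
      have hinv : M.F.symm^[n + 1] (M.F^[n + 1] ξ) = ξ :=
        (M.F.symm.toEquiv.symm.right_inv.iterate (n + 1) |> fun _ =>
          Function.LeftInverse.iterate (fun x => M.F.symm_apply_apply x) (n + 1) ξ)
      have hout : ξ ∉ M.V := by
        have := hcon (n + 1) (M.F^[n + 1] ξ) (by
          rw [← M.betw_symm_iterate (n + 1) h, hinv]; exact hξ)
        rwa [hinv] at this
      have hj : |M.jac ξ| ≤ M.η := M.pert.contract _ hout
      simp only [Function.iterate_succ_apply', M.F.apply_symm_apply] at e ⊢
      rw [e, abs_mul, pow_succ, mul_assoc]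
      gcongr
  have h2 : ∀ n : ℕ, |z'.2 - z.2| ≤ M.η ^ n * (2 * C) := by
    intro n
    refine (h1 n).trans ?_
    gcongr
    -- The preimages also lie in one fibre, so their lengths are differences of values of `u`,
    -- bounded by `2 C`.
    have e : (M.H (M.F.symm^[n] z')).2 = (M.H (M.F.symm^[n] z)).2 := by
      rw [M.snd_H_iterate n z, M.snd_H_iterate n z'] at hH
      exact mul_left_cancel₀ (pow_ne_zero n M.mu_ne_zero) hH
    rw [H_snd, H_snd] at e
    have e2 : (M.F.symm^[n] z').2 - (M.F.symm^[n] z).2 =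
        M.u (M.F.symm^[n] z) - M.u (M.F.symm^[n] z') := by linarith
    rw [e2]
    exact (abs_sub _ _).trans (by linarith [hC (M.F.symm^[n] z), hC (M.F.symm^[n] z')])
  have h3 : Tendsto (fun n : ℕ => M.η ^ n * (2 * C)) atTop (𝓝 0) := by
    simpa using (tendsto_pow_atTop_nhds_zero_of_lt_one hη M.pert.eta_lt).mul_const (2 * C)
  exact hne (sub_eq_zero.1 (abs_nonpos_iff.1 (ge_of_tendsto' h3 h2)))

/-- Nontrivial fibres of the semiconjugacy lie over the unstable lines of the lattice points. -/
theorem exists_lattice_of_H_eq {z z' : ℝ × ℝ} (hne : z' ≠ z) (hH : M.H z' = M.H z) :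
    ∃ ℓ ∈ M.L, (M.H z).2 = ℓ.2 := by
  have h : z'.1 = z.1 := by
    have := congrArg Prod.fst hH
    exact this
  have hH2 : (M.H z').2 = (M.H z).2 := congrArg Prod.snd hH
  obtain ⟨n, y, hy, ℓ, hℓ, h1, h2⟩ :=
    M.exists_betw_mem_V h (fun e => hne (Prod.ext h e)) hH2
  refine ⟨_, M.diag_pow_mem hℓ n, ?_⟩
  rw [← M.H_eq_of_betw h hH2 hy, M.snd_H_iterate n, M.snd_H_of_box hℓ h1 h2]

/-! #### The attractor on the universal cover -/

/-- The preimage of the attractor in the universal cover. -/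
def attr : Set (ℝ × ℝ) := {z | ∀ n, M.F.symm^[n] z ∉ M.V}

theorem not_mem_attr_of_lattice {ℓ : ℝ × ℝ} (hℓ : ℓ ∈ M.L) : ℓ ∉ M.attr := fun h =>
  h 0 (M.lattice_mem_V hℓ)

theorem add_mem_attr {ℓ : ℝ × ℝ} (hℓ : ℓ ∈ M.L) {z : ℝ × ℝ} (hz : z ∈ M.attr) :
    z + ℓ ∈ M.attr := by
  intro n hn
  refine hz n ?_
  rw [M.F_symm_iterate_add n hℓ] at hn
  have := M.add_mem_V hn (M.L.neg_mem (M.diag_inv_pow_mem hℓ n))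
  rwa [add_neg_cancel_right] at this

theorem F_symm_mem_attr {z : ℝ × ℝ} (hz : z ∈ M.attr) : M.F.symm z ∈ M.attr := fun n => hz (n + 1)

theorem F_mem_attr {z : ℝ × ℝ} (hz : z ∈ M.attr) : M.F z ∈ M.attr := by
  intro n hn
  have := M.F_symm_iterate_mem_V (Nat.le_succ n) hn
  rw [Function.iterate_succ_apply, M.F.symm_apply_apply] at this
  exact hz n this

/-- A fibre of the semiconjugacy extends on at most one side of a point of the attractor. -/
theorem H_ne_of_mem_attr {z z₁ z₂ : ℝ × ℝ} (hz : z ∈ M.attr) (h1 : z₁.1 = z.1) (h2 : z₂.1 = z.1)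
    (hlt1 : z₁.2 < z.2) (hlt2 : z.2 < z₂.2) : (M.H z₁).2 ≠ (M.H z₂).2 := by
  intro hH
  have hz12 : (M.H z).2 = (M.H z₁).2 :=
    M.H_eq_of_betw (z' := z₂) (h2.trans h1.symm) hH.symm (betw_of_le h1.symm hlt1.le hlt2.le)
  obtain ⟨n₁, y₁, hy₁, hn₁⟩ := M.exists_betw_mem_V (z := z₁) (z' := z) h1.symm hlt1.ne' hz12
  obtain ⟨n₂, y₂, hy₂, hn₂⟩ := M.exists_betw_mem_V (z := z) (z' := z₂) h2 hlt2.ne'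
    (hH.symm.trans hz12.symm)
  have hHy₁ := M.H_eq_of_betw h1.symm hz12 hy₁
  have hHy₂ := M.H_eq_of_betw h2 (hH.symm.trans hz12.symm) hy₂
  -- On either side of `z` some point of the fibre has its `N`-th preimage in a box. Both preimages
  -- have the same value of `H.2`, so the boxes belong to the same lattice point; a box contains the
  -- vertical segments between its points, so it contains the preimage of `z` too.
  set N := max n₁ n₂
  obtain ⟨ℓ, hℓ, ha1, ha2⟩ := M.F_symm_iterate_mem_V (le_max_left n₁ n₂) hn₁
  obtain ⟨ℓ', hℓ', hb1, hb2⟩ := M.F_symm_iterate_mem_V (le_max_right n₁ n₂) hn₂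
  have hmuN := pow_ne_zero N M.mu_ne_zero
  have e1 : ℓ.2 = ℓ'.2 := by
    rw [← M.snd_H_of_box hℓ ha1 ha2, ← M.snd_H_of_box hℓ' hb1 hb2]
    refine mul_left_cancel₀ hmuN ?_
    rw [← M.snd_H_iterate, ← M.snd_H_iterate, hHy₁, hHy₂, hz12]
  have e2 : ℓ = ℓ' := sub_eq_zero.1 (M.eq_zero_of_snd (M.L.sub_mem hℓ hℓ') (sub_eq_zero.2 e1))
  subst e2
  have hy₁le : y₁.2 ≤ z.2 := by
    rcases hy₁.le_or_le with h | h
    · exact h.2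
    · linarith [h.1, h.2]
  have hy₂le : z.2 ≤ y₂.2 := by
    rcases hy₂.le_or_le with h | h
    · exact h.1
    · linarith [h.1, h.2]
  have hb : Betw y₁ y₂ z := betw_of_le (h1.symm.trans hy₁.1.symm) hy₁le hy₂le
  have hb' := (M.betw_symm_iterate N (hy₂.1.trans (h1.symm.trans hy₁.1.symm))).2 hb
  refine hz N ⟨ℓ, hℓ, ?_, ?_⟩
  · have := hb'.1
    simp only [Prod.fst_sub] at ha1 ⊢
    rwa [this]
  · simp only [Prod.snd_sub] at ha2 hb2 ⊢
    rw [abs_lt] at *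
    rcases hb'.le_or_le with h | h
    · constructor <;> linarith [h.1, h.2]
    · constructor <;> linarith [h.1, h.2]

/-- `F⁻¹` sends the closed box to a compact subset of the open one, which leaves room for flowing a
short time, uniformly over the lattice. -/
theorem exists_Φ_mem_V : ∃ τ > 0, ∀ z ∈ M.V, ∀ t, |t| < τ → M.Φ t (M.F.symm z) ∈ M.V := by
  obtain ⟨C, hC⟩ := M.exists_Φ_bound
  set B : Set (ℝ × ℝ) := Icc (-M.R) M.R ×ˢ Icc (-M.q) M.q with hB
  have hBc : IsCompact (M.F.symm '' B) :=
    (isCompact_Icc.prod isCompact_Icc).image M.F.symm.continuous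
  have hO : IsOpen (Ioo (-M.R) M.R ×ˢ Ioo (-M.q) M.q) := isOpen_Ioo.prod isOpen_Ioo
  have hsub : M.F.symm '' B ⊆ Ioo (-M.R) M.R ×ˢ Ioo (-M.q) M.q := by
    rintro _ ⟨z, hz, rfl⟩
    have := M.F_symm_mem_box (abs_le.2 hz.1) (abs_le.2 hz.2)
    exact ⟨abs_lt.1 this.1, abs_lt.1 this.2⟩
  obtain ⟨δ, hδ, hth⟩ := hBc.exists_thickening_subset_open hO hsub
  have hC0 : 0 ≤ C := by
    have := (abs_nonneg _).trans (hC 1 0)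
    simpa using this
  refine ⟨δ / (C + 1), by positivity, ?_⟩
  rintro z ⟨ℓ, hℓ, h1, h2⟩ t ht
  rw [lt_div_iff₀ (by positivity)] at ht
  set y := M.F.symm (z - ℓ) with hy
  have hyB : y ∈ M.F.symm '' B := ⟨z - ℓ, ⟨abs_le.1 h1.le, abs_le.1 h2.le⟩, rfl⟩
  have hmem : M.Φ t y ∈ Metric.thickening δ (M.F.symm '' B) := by
    refine Metric.mem_thickening_iff.2 ⟨y, hyB, ?_⟩
    rw [Prod.dist_eq, max_lt_iff, M.Φ_fst, Real.dist_eq, Real.dist_eq, add_sub_cancel_left]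
    have := hC t y
    have h0 := abs_nonneg t
    constructor <;> nlinarith
  have hbox := hth hmem
  have e : M.F.symm z = y + (M.lam⁻¹ * ℓ.1, M.mu⁻¹ * ℓ.2) := by
    rw [hy, ← M.F_symm_add hℓ, sub_add_cancel]
  refine ⟨_, M.diag_inv_mem hℓ, ?_⟩
  rw [e, M.Φ_add_lattice (M.diag_inv_mem hℓ), add_sub_cancel_right]
  exact ⟨abs_lt.2 hbox.1, abs_lt.2 hbox.2⟩

/-- If a preimage of `Φ t z` lies in `V`, so do all later ones, while the flow time to the preimage
of `z` shrinks like `λ⁻¹ ^ m`. Eventually it is less than `τ`, and a preimage of `z` lies in `V` as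
well. -/
theorem Φ_mem_attr {z : ℝ × ℝ} (hz : z ∈ M.attr) (t : ℝ) : M.Φ t z ∈ M.attr := by
  obtain ⟨τ, hτ, h⟩ := M.exists_Φ_mem_V
  intro n hn
  have h1 : Tendsto (fun m : ℕ => M.lam⁻¹ ^ (m + 1) * |t|) atTop (𝓝 0) := by
    have := (tendsto_pow_atTop_nhds_zero_of_lt_one (inv_nonneg.2 M.lam_pos.le)
      (inv_lt_one_of_one_lt₀ M.pert.one_lt)).mul_const |t|
    rw [zero_mul] at this
    exact this.comp (tendsto_add_atTop_nat 1)
  obtain ⟨m, hm, hnm⟩ := ((h1.eventually_lt_const hτ).and (eventually_ge_atTop n)).exists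
  have h2 := M.F_symm_iterate_mem_V hnm hn
  have h3 := h _ h2 (-(M.lam⁻¹ ^ (m + 1) * t)) (by
    rw [abs_neg, abs_mul, abs_pow, abs_inv, abs_of_pos M.lam_pos]; exact hm)
  rw [← Function.iterate_succ_apply' (f := M.F.symm), M.F_symm_iterate_Φ, M.Φ_neg_cancel] at h3
  exact hz _ h3

theorem Φ_mem_attr_iff {z : ℝ × ℝ} (t : ℝ) : M.Φ t z ∈ M.attr ↔ z ∈ M.attr :=
  ⟨fun h => by simpa [M.Φ_neg_cancel] using M.Φ_mem_attr h (-t), fun h => M.Φ_mem_attr h t⟩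

/-- Vertical segments are not contained in the attractor. -/
theorem exists_not_mem_attr (r : ℝ) {s₁ s₂ : ℝ} (hs : s₁ < s₂) :
    ∃ s ∈ Ioo s₁ s₂, (r, s) ∉ M.attr := by
  by_contra hcon
  push Not at hcon
  -- If the segment lay in the attractor, `H` could not be constant between `a` and `b`, which
  -- surround its midpoint.
  set a := (3 * s₁ + s₂) / 4 with ha
  set b := (s₁ + 3 * s₂) / 4 with hb
  have hlt : (M.H (r, a)).2 < (M.H (r, b)).2 := by
    refine lt_of_le_of_ne (M.H_mono rfl (by simp only; linarith)) ?_
    refine M.H_ne_of_mem_attr (z := (r, (s₁ + s₂) / 2)) (hcon _ ⟨?_, ?_⟩) rfl rfl ?_ ?_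
    all_goals linarith
  obtain ⟨ℓ, hℓ, hℓ1, hℓ2⟩ := M.dense_snd _ _ hlt
  have hc : Continuous fun s => (M.H (r, s)).2 :=
    continuous_snd.comp (M.continuous_H.comp (by fun_prop : Continuous fun s : ℝ => (r, s)))
  obtain ⟨s, hs', hsℓ⟩ := intermediate_value_Ioo (f := fun s => (M.H (r, s)).2)
    (by linarith : a ≤ b) hc.continuousOn ⟨hℓ1, hℓ2⟩
  simp only at hsℓ
  -- The unstable curve of a lattice point meets this vertical line in a point outside the
  -- attractor, in the same fibre as a point `(r, s)` of the segment. Any point of the segment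
  -- between the two would be in the attractor with its fibre extending on both sides.
  set p := M.Φ (r - ℓ.1) ℓ with hp
  have hp1 : p.1 = r := by rw [hp, M.Φ_fst]; ring
  have hpH : (M.H p).2 = ℓ.2 := by
    rw [hp, M.H_Φ, M.H_lattice hℓ]; simp
  have hpa : p ∉ M.attr := fun h => M.not_mem_attr_of_lattice hℓ ((M.Φ_mem_attr_iff _).1 h)
  have hsI : s ∈ Ioo s₁ s₂ := ⟨by linarith [hs'.1], by linarith [hs'.2]⟩
  have hne : p.2 ≠ s := fun h => hpa (by
    have : p = (r, s) := Prod.ext hp1 h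
    rw [this]; exact hcon s hsI)
  rcases lt_or_gt_of_ne hne with h | h
  · obtain ⟨c, hc1, hc2⟩ := exists_between (max_lt h hsI.1)
    refine M.H_ne_of_mem_attr (z := (r, c)) (z₁ := p) (z₂ := (r, s)) (hcon c ⟨?_, ?_⟩) hp1 rfl ?_ hc2
      (hpH.trans hsℓ.symm)
    · exact (le_max_right _ _).trans_lt hc1
    · linarith [hsI.2]
    · exact (le_max_left _ _).trans_lt hc1
  · obtain ⟨c, hc1, hc2⟩ := exists_between (lt_min h hsI.2)
    refine M.H_ne_of_mem_attr (z := (r, c)) (z₁ := (r, s)) (z₂ := p) (hcon c ⟨?_, ?_⟩) rfl hp1 hc1 ?_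
      (hsℓ.trans hpH.symm)
    · linarith [hsI.1]
    · exact hc2.trans_le (min_le_right _ _)
    · exact hc2.trans_le (min_le_left _ _)

/-- Arbitrarily close to a point of the attractor, on its vertical line, there are points that are
alone in their fibre of the semiconjugacy. -/
theorem exists_singleton_fibre {z : ℝ × ℝ} (hz : z ∈ M.attr) {δ : ℝ} (hδ : 0 < δ) :
    ∃ s, |s - z.2| < δ ∧ ∀ z', M.H z' = M.H (z.1, s) → z' = (z.1, s) := by
  set a := z.2 - δ / 2 with ha
  set b := z.2 + δ / 2 with hb
  have hlt : (M.H (z.1, a)).2 < (M.H (z.1, b)).2 := by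
    refine lt_of_le_of_ne (M.H_mono rfl (by simp only; linarith)) ?_
    refine M.H_ne_of_mem_attr hz rfl rfl ?_ ?_
    all_goals linarith
  have hcount : (Prod.snd '' (M.L : Set (ℝ × ℝ))).Countable := M.lat.countable.image _
  -- Nontrivial fibres have their second coordinate in this countable set, so a value outside it has
  -- singleton fibres.
  obtain ⟨v, hv, hvL⟩ : ∃ v ∈ Ioo (M.H (z.1, a)).2 (M.H (z.1, b)).2,
      v ∉ Prod.snd '' (M.L : Set (ℝ × ℝ)) := by
    obtain ⟨v, hvL, hv⟩ := (hcount.dense_compl ℝ).exists_between hlt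
    exact ⟨v, hv, hvL⟩
  have hc : Continuous fun s => (M.H (z.1, s)).2 :=
    continuous_snd.comp (M.continuous_H.comp (by fun_prop : Continuous fun s : ℝ => (z.1, s)))
  obtain ⟨s, hs, hsv⟩ := intermediate_value_Ioo (f := fun s => (M.H (z.1, s)).2)
    (by linarith : a ≤ b) hc.continuousOn hv
  refine ⟨s, abs_lt.2 ⟨by linarith [hs.1], by linarith [hs.2]⟩, fun z' hz' => ?_⟩
  by_contra hne
  obtain ⟨ℓ, hℓ, h⟩ := M.exists_lattice_of_H_eq hne hz'
  exact hvL ⟨ℓ, hℓ, by rw [← h]; exact hsv⟩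

end DAModel

namespace DAModel

variable (M : DAModel)

/-! ### Dynamics on the torus -/

/-- The map of the torus induced by a map of the plane. -/
def descend (g : ℝ × ℝ → ℝ × ℝ) (x : Torus2) : Torus2 :=
  M.π (g (Function.surjInv M.cover.surjective x))

theorem descend_apply {g : ℝ × ℝ → ℝ × ℝ} (hg : ∀ z z', z - z' ∈ M.L → g z - g z' ∈ M.L)
    (z : ℝ × ℝ) : M.descend g (M.π z) = M.π (g z) := by
  rw [descend, M.cover.eq_iff]
  exact hg _ _ ((M.cover.eq_iff _ _).1 (Function.surjInv_eq M.cover.surjective (M.π z)))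

theorem continuous_descend {g : ℝ × ℝ → ℝ × ℝ} (hg : ∀ z z', z - z' ∈ M.L → g z - g z' ∈ M.L)
    (hc : Continuous g) : Continuous (M.descend g) :=
  M.cover.isQuotientMap.continuous_iff.2
    ((M.cover.continuous.comp hc).congr fun z => (M.descend_apply hg z).symm)

theorem F_symm_sub_mem {z z' : ℝ × ℝ} (h : z - z' ∈ M.L) : M.F.symm z - M.F.symm z' ∈ M.L := by
  rw [← M.F_sub_mem]; simpa using h

theorem Φ_sub_mem (t : ℝ) {z z' : ℝ × ℝ} (h : z - z' ∈ M.L) : M.Φ t z - M.Φ t z' ∈ M.L := by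
  have := M.Φ_add_lattice h t z'
  rw [add_sub_cancel] at this
  rwa [this, add_sub_cancel_left]

theorem H_sub_mem {z z' : ℝ × ℝ} (h : z - z' ∈ M.L) : M.H z - M.H z' ∈ M.L := by
  have := M.H_add h z'
  rw [add_sub_cancel] at this
  rwa [this, add_sub_cancel_left]

/-- The derived-from-Anosov diffeomorphism of the torus. -/
def f : Torus2 ≃ₜ Torus2 where
  toFun := M.descend M.F
  invFun := M.descend M.F.symm
  left_inv := M.cover.surjective.forall.2 fun z => by
    rw [M.descend_apply fun _ _ => M.F_sub_mem.2, M.descend_apply fun _ _ => M.F_symm_sub_mem,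
      M.F.symm_apply_apply]
  right_inv := M.cover.surjective.forall.2 fun z => by
    rw [M.descend_apply fun _ _ => M.F_symm_sub_mem, M.descend_apply fun _ _ => M.F_sub_mem.2,
      M.F.apply_symm_apply]
  continuous_toFun := M.continuous_descend (fun _ _ => M.F_sub_mem.2) M.F.continuous
  continuous_invFun := M.continuous_descend (fun _ _ => M.F_symm_sub_mem) M.F.symm.continuous

theorem f_π (z : ℝ × ℝ) : M.f (M.π z) = M.π (M.F z) :=
  M.descend_apply (fun _ _ => M.F_sub_mem.2) z

theorem f_symm_π (z : ℝ × ℝ) : M.f.symm (M.π z) = M.π (M.F.symm z) :=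
  M.descend_apply (fun _ _ => M.F_symm_sub_mem) z

theorem f_iterate_π (n : ℕ) (z : ℝ × ℝ) : M.f^[n] (M.π z) = M.π (M.F^[n] z) := by
  induction n with
  | zero => rfl
  | succ n ih => rw [Function.iterate_succ_apply', ih, M.f_π, Function.iterate_succ_apply']

theorem f_symm_iterate_π (n : ℕ) (z : ℝ × ℝ) : M.f.symm^[n] (M.π z) = M.π (M.F.symm^[n] z) := by
  induction n with
  | zero => rfl
  | succ n ih => rw [Function.iterate_succ_apply', ih, M.f_symm_π, Function.iterate_succ_apply']

theorem continuous_Φ_right (t : ℝ) : Continuous (M.Φ t) :=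
  M.continuous_Φ.comp (by fun_prop : Continuous fun z : ℝ × ℝ => (t, z))

theorem continuous_Φ_left (z : ℝ × ℝ) : Continuous fun t => M.Φ t z :=
  M.continuous_Φ.comp (by fun_prop : Continuous fun t : ℝ => (t, z))

/-- The flow along the unstable direction on the torus. -/
def φ (t : ℝ) : Torus2 ≃ₜ Torus2 where
  toFun := M.descend (M.Φ t)
  invFun := M.descend (M.Φ (-t))
  left_inv := M.cover.surjective.forall.2 fun z => by
    rw [M.descend_apply fun _ _ => M.Φ_sub_mem _, M.descend_apply fun _ _ => M.Φ_sub_mem _,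
      M.Φ_neg_cancel]
  right_inv := M.cover.surjective.forall.2 fun z => by
    rw [M.descend_apply fun _ _ => M.Φ_sub_mem _, M.descend_apply fun _ _ => M.Φ_sub_mem _,
      M.Φ_cancel_neg]
  continuous_toFun := M.continuous_descend (fun _ _ => M.Φ_sub_mem t) (M.continuous_Φ_right t)
  continuous_invFun := M.continuous_descend (fun _ _ => M.Φ_sub_mem (-t)) (M.continuous_Φ_right _)

theorem φ_π (t : ℝ) (z : ℝ × ℝ) : M.φ t (M.π z) = M.π (M.Φ t z) :=
  M.descend_apply (fun _ _ => M.Φ_sub_mem t) z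

theorem φ_zero : M.φ 0 = 1 := by
  ext1 x
  obtain ⟨z, rfl⟩ := M.cover.surjective x
  rw [M.φ_π, M.Φ_zero]; rfl

theorem φ_add (s t : ℝ) : M.φ (s + t) = M.φ s * M.φ t := by
  ext1 x
  obtain ⟨z, rfl⟩ := M.cover.surjective x
  rw [Homeomorph.mul_apply, M.φ_π, M.φ_π, M.φ_π, M.Φ_add]

theorem f_mul_φ (t : ℝ) : M.f * M.φ t = M.φ (M.lam * t) * M.f := by
  ext1 x
  obtain ⟨z, rfl⟩ := M.cover.surjective x
  rw [Homeomorph.mul_apply, Homeomorph.mul_apply, M.φ_π, M.f_π, M.f_π, M.φ_π, M.F_Φ]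

theorem f_φ (t : ℝ) (x : Torus2) : M.f (M.φ t x) = M.φ (M.lam * t) (M.f x) :=
  congrArg (fun g : Torus2 ≃ₜ Torus2 => g x) (M.f_mul_φ t)

theorem f_zpow_mul_φ (m : ℤ) (t : ℝ) : M.f ^ m * M.φ t = M.φ (M.lam ^ m * t) * M.f ^ m := by
  have hl := M.lam_pos.ne'
  have hinv : ∀ t, M.f⁻¹ * M.φ t = M.φ (M.lam⁻¹ * t) * M.f⁻¹ := fun t => by
    rw [inv_mul_eq_iff_eq_mul, ← mul_assoc, M.f_mul_φ, mul_inv_cancel_left₀ hl, mul_assoc,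
      mul_inv_cancel, mul_one]
  induction m generalizing t with
  | zero => simp
  | succ n ih =>
    rw [zpow_add_one, mul_assoc, M.f_mul_φ, ← mul_assoc, ih, mul_assoc, zpow_add_one₀ hl, mul_assoc]
  | pred n ih =>
    rw [zpow_sub_one, mul_assoc, hinv, ← mul_assoc, ih, mul_assoc, zpow_sub_one₀ hl, mul_assoc]

theorem f_iterate_φ (n : ℕ) (t : ℝ) (x : Torus2) :
    M.f^[n] (M.φ t x) = M.φ (M.lam ^ n * t) (M.f^[n] x) := by
  induction n with
  | zero => simp
  | succ n ih =>
    rw [Function.iterate_succ_apply', ih, M.f_φ, Function.iterate_succ_apply', pow_succ', mul_assoc]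

theorem continuous_φ_left (x : Torus2) : Continuous fun t => M.φ t x := by
  obtain ⟨z, rfl⟩ := M.cover.surjective x
  simp only [M.φ_π]
  exact M.cover.continuous.comp (M.continuous_Φ_left z)

/-- The semiconjugacy on the torus. -/
def h : Torus2 → Torus2 := M.descend M.H

theorem h_π (z : ℝ × ℝ) : M.h (M.π z) = M.π (M.H z) :=
  M.descend_apply (fun _ _ => M.H_sub_mem) z

theorem continuous_h : Continuous M.h :=
  M.continuous_descend (fun _ _ => M.H_sub_mem) M.continuous_H

theorem surjective_H : Function.Surjective M.H := fun z => by
  obtain ⟨C, hC⟩ := M.exists_bound_u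
  have hc : Continuous fun s => (M.H (z.1, s)).2 :=
    continuous_snd.comp (M.continuous_H.comp (by fun_prop : Continuous fun s : ℝ => (z.1, s)))
  have h0 := (abs_nonneg _).trans (hC 0)
  obtain ⟨s, -, hs⟩ := intermediate_value_Icc (f := fun s => (M.H (z.1, s)).2)
    (by linarith : z.2 - C ≤ z.2 + C) hc.continuousOn (show z.2 ∈ Icc _ _ from
      ⟨by have := (abs_le.1 (hC (z.1, z.2 - C))).2; simp only [H_snd]; linarith,
       by have := (abs_le.1 (hC (z.1, z.2 + C))).1; simp only [H_snd]; linarith⟩)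
  exact ⟨(z.1, s), Prod.ext rfl hs⟩

theorem surjective_h : Function.Surjective M.h := fun x => by
  obtain ⟨z, rfl⟩ := M.cover.surjective x
  obtain ⟨y, rfl⟩ := M.surjective_H z
  exact ⟨M.π y, M.h_π y⟩

/-! #### The attractor -/

/-- The repelling region of the source, on the torus. -/
def VT : Set Torus2 := M.π '' M.V

/-- The attractor. -/
def Λ : Set Torus2 := M.π '' M.attr

theorem π_mem_VT {z : ℝ × ℝ} : M.π z ∈ M.VT ↔ z ∈ M.V := by
  refine ⟨fun ⟨z', hz', e⟩ => ?_, fun h => ⟨z, h, rfl⟩⟩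
  have := M.add_mem_V hz' ((M.cover.eq_iff _ _).1 e.symm)
  rwa [add_sub_cancel] at this

theorem π_mem_Λ {z : ℝ × ℝ} : M.π z ∈ M.Λ ↔ z ∈ M.attr := by
  refine ⟨fun ⟨z', hz', e⟩ => ?_, fun h => ⟨z, h, rfl⟩⟩
  have := M.add_mem_attr ((M.cover.eq_iff _ _).1 e.symm) hz'
  rwa [add_sub_cancel] at this

theorem mem_Λ_iff {x : Torus2} : x ∈ M.Λ ↔ ∀ n, M.f.symm^[n] x ∉ M.VT := by
  obtain ⟨z, rfl⟩ := M.cover.surjective x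
  simp only [M.π_mem_Λ, M.f_symm_iterate_π, M.π_mem_VT]
  rfl

theorem isOpen_V : IsOpen M.V := by
  have : M.V = ⋃ ℓ ∈ M.L, {z | |(z - ℓ).1| < M.R ∧ |(z - ℓ).2| < M.q} := by
    ext z; simp only [V, boxes, mem_iUnion, exists_prop]; rfl
  rw [this]
  refine isOpen_biUnion fun ℓ _ => IsOpen.and ?_ ?_ <;>
  exact isOpen_lt (by fun_prop) continuous_const

theorem isOpen_VT : IsOpen M.VT := M.cover.isOpenMap _ M.isOpen_V

theorem f_symm_mem_VT {x : Torus2} (hx : x ∈ closure M.VT) : M.f.symm x ∈ M.VT := by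
  set B : Set (ℝ × ℝ) := Icc (-M.R) M.R ×ˢ Icc (-M.q) M.q with hB
  have hBc : IsClosed (M.π '' B) :=
    ((isCompact_Icc.prod isCompact_Icc).image M.cover.continuous).isClosed
  have hsub : M.VT ⊆ M.π '' B := by
    rintro _ ⟨z, ⟨ℓ, hℓ, h1, h2⟩, rfl⟩
    refine ⟨z - ℓ, ⟨abs_le.1 h1.le, abs_le.1 h2.le⟩, ?_⟩
    rw [M.cover.eq_iff]
    simpa using hℓ
  obtain ⟨z, ⟨h1, h2⟩, rfl⟩ := closure_minimal hsub hBc hx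
  rw [M.f_symm_π, M.π_mem_VT]
  refine ⟨0, M.L.zero_mem, ?_⟩
  simpa using M.F_symm_mem_box (abs_le.2 h1) (abs_le.2 h2)

theorem f_not_mem_closure {x : Torus2} (hx : x ∉ M.VT) : M.f x ∉ closure M.VT := fun h =>
  hx (by simpa using M.f_symm_mem_VT h)

theorem f_iterate_not_mem {x : Torus2} (hx : x ∉ M.VT) (n : ℕ) : M.f^[n] x ∉ M.VT := by
  induction n with
  | zero => exact hx
  | succ n ih =>
    rw [Function.iterate_succ_apply']
    exact fun h => M.f_not_mem_closure ih (subset_closure h)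

theorem f_image_subset_interior : M.f '' M.VTᶜ ⊆ interior M.VTᶜ := by
  rw [interior_compl]
  rintro _ ⟨x, hx, rfl⟩
  exact M.f_not_mem_closure hx

theorem f_iterate_image (n : ℕ) (S : Set Torus2) : M.f^[n] '' S = M.f.symm^[n] ⁻¹' S :=
  congrFun (image_eq_preimage_of_inverse (Function.LeftInverse.iterate M.f.symm_apply_apply n)
    (Function.LeftInverse.iterate M.f.apply_symm_apply n)) S

theorem Λ_eq_iInter : M.Λ = ⋂ n : ℕ, M.f^[n] '' M.VTᶜ := by
  ext x
  simp [M.mem_Λ_iff, M.f_iterate_image]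

theorem isCompact_Λ : IsCompact M.Λ := by
  rw [M.Λ_eq_iInter]
  refine (isClosed_iInter fun n => ?_).isCompact
  rw [M.f_iterate_image]
  exact M.isOpen_VT.isClosed_compl.preimage (M.f.symm.continuous.iterate n)

/-- This restates the `escape` property on the torus: `VT` is an isolating neighbourhood of the
source in forward time. It serves both the non-wandering set and the non-conjugacy. -/
theorem eq_of_forall_mem_VT {x : Torus2} (hx : ∀ n, M.f^[n] x ∈ M.VT) : x = M.π 0 := by
  obtain ⟨z, ⟨ℓ, hℓ, h1, h2⟩, rfl⟩ := hx 0
  have e : M.π z = M.π (z - ℓ) := by rw [M.cover.eq_iff]; simpa using hℓ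
  rw [e] at hx ⊢
  by_contra hne
  obtain ⟨n, hn⟩ := M.pert.escape (z - ℓ) h1 h2 fun h => hne (by rw [h])
  refine hn ?_
  have := hx n
  rwa [M.f_iterate_π, M.π_mem_VT] at this

theorem f_mem_Λ {x : Torus2} : M.f x ∈ M.Λ ↔ x ∈ M.Λ := by
  obtain ⟨z, rfl⟩ := M.cover.surjective x
  rw [M.f_π, M.π_mem_Λ, M.π_mem_Λ]
  exact ⟨fun h => by simpa using M.F_symm_mem_attr h, M.F_mem_attr⟩

theorem f_iterate_mem_Λ {x : Torus2} (hx : x ∈ M.Λ) (n : ℕ) : M.f^[n] x ∈ M.Λ := by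
  induction n with
  | zero => exact hx
  | succ n ih => rw [Function.iterate_succ_apply']; exact M.f_mem_Λ.2 ih

theorem f_image_Λ : M.f '' M.Λ = M.Λ := by
  ext x
  constructor
  · rintro ⟨y, hy, rfl⟩; exact M.f_mem_Λ.2 hy
  · exact fun hx => ⟨M.f.symm x, by rw [← M.f_mem_Λ]; simpa using hx, by simp⟩

theorem φ_mem_Λ {x : Torus2} (t : ℝ) : M.φ t x ∈ M.Λ ↔ x ∈ M.Λ := by
  obtain ⟨z, rfl⟩ := M.cover.surjective x
  rw [M.φ_π, M.π_mem_Λ, M.π_mem_Λ, M.Φ_mem_attr_iff]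

theorem nonempty_compl_VT : M.VTᶜ.Nonempty := by
  by_contra h
  rw [not_nonempty_iff_eq_empty, compl_empty_iff] at h
  have h1 : ∀ x, x = M.π 0 := fun x => M.eq_of_forall_mem_VT fun n => by rw [h]; trivial
  have h2 : (0, M.q / 2) ∈ (univ : Set (ℝ × ℝ)) := trivial
  have hq := M.pert.q_pos
  obtain ⟨n, hn⟩ := M.pert.escape (0, M.q / 2) (by simpa using M.pert.R_pos)
    (by rw [abs_of_pos (by simpa using hq)]; simp only; linarith)
    (fun e => by have := congrArg Prod.snd e; simp at this; exact hq.ne' this)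
  refine hn ?_
  change _ ∈ M.V
  rw [← M.π_mem_VT, h]
  trivial

theorem nonempty_Λ : M.Λ.Nonempty := by
  rw [M.Λ_eq_iInter]
  refine IsCompact.nonempty_iInter_of_sequence_nonempty_isCompact_isClosed _ (fun n => ?_)
    (fun n => M.nonempty_compl_VT.image _) ?_ fun n => ?_
  · rintro _ ⟨x, hx, rfl⟩
    exact ⟨M.f x, fun h => M.f_not_mem_closure hx (subset_closure h),
      (Function.iterate_succ_apply _ _ _).symm⟩
  · exact M.isOpen_VT.isClosed_compl.isCompact.image (M.f.continuous.iterate 0)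
  · exact (M.isOpen_VT.isClosed_compl.isCompact.image (M.f.continuous.iterate n)).isClosed

/-! #### Minimality of the flow on the attractor, and transitivity -/

/-- The image under `h` is closed and invariant under the linear flow along `w`, whose orbits are
dense because the second coordinates of the lattice are. -/
theorem h_image_eq_univ {K : Set Torus2} (hK : IsClosed K) (hne : K.Nonempty)
    (hinv : ∀ t, ∀ x ∈ K, M.φ t x ∈ K) : M.h '' K = univ := by
  have hc : IsClosed (M.h '' K) := (hK.isCompact.image M.continuous_h).isClosed
  obtain ⟨x, hx⟩ := hne
  obtain ⟨z₀, rfl⟩ := M.cover.surjective x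
  have hmem : ∀ t : ℝ, ∀ ℓ ∈ M.L, M.H z₀ + (t, 0) + ℓ ∈ M.π ⁻¹' (M.h '' K) := by
    intro t ℓ hℓ
    refine ⟨_, hinv t _ hx, ?_⟩
    rw [M.φ_π, M.h_π, M.H_Φ, M.cover.apply_add hℓ]
  rw [eq_univ_iff_forall]
  intro y
  obtain ⟨v, rfl⟩ := M.cover.surjective y
  change v ∈ M.π ⁻¹' (M.h '' K)
  rw [← (hc.preimage M.cover.continuous).closure_eq, Metric.mem_closure_iff]
  intro ε hε
  obtain ⟨ℓ, hℓ, h1, h2⟩ := M.dense_snd (v.2 - (M.H z₀).2 - ε) (v.2 - (M.H z₀).2) (by linarith)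
  refine ⟨_, hmem (v.1 - (M.H z₀).1 - ℓ.1) ℓ hℓ, ?_⟩
  rw [dist_eq_norm, Prod.norm_def, max_lt_iff]
  constructor
  · have : (v - (M.H z₀ + (v.1 - (M.H z₀).1 - ℓ.1, 0) + ℓ)).1 = 0 := by simp; ring
    rw [this, norm_zero]; exact hε
  · simp only [Prod.snd_sub, Prod.snd_add, Real.norm_eq_abs, abs_lt]
    constructor <;> linarith

/-- The flow is minimal on the attractor. -/
theorem Λ_subset_of_invariant {K : Set Torus2} (hK : IsClosed K) (hne : K.Nonempty)
    (hinv : ∀ t, ∀ x ∈ K, M.φ t x ∈ K) : M.Λ ⊆ K := by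
  rintro _ ⟨z, hz, rfl⟩
  change z ∈ M.π ⁻¹' K
  rw [← (hK.preimage M.cover.continuous).closure_eq, Metric.mem_closure_iff]
  intro ε hε
  -- Since `K` maps onto the torus, it meets every fibre, and so contains every point that is alone
  -- in its fibre.
  obtain ⟨s, hs, hs1⟩ := M.exists_singleton_fibre hz hε
  refine ⟨(z.1, s), ?_, ?_⟩
  · obtain ⟨x, hx, hxs⟩ : M.π (M.H (z.1, s)) ∈ M.h '' K := by
      rw [M.h_image_eq_univ hK hne hinv]; trivial
    obtain ⟨ζ, rfl⟩ := M.cover.surjective x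
    rw [M.h_π, eq_comm, M.cover.eq_iff] at hxs
    have e := hs1 (ζ + (M.H (z.1, s) - M.H ζ)) (by rw [M.H_add hxs, add_sub_cancel])
    rw [← e, mem_preimage, M.cover.apply_add hxs]
    exact hx
  · rw [dist_eq_norm, Prod.norm_def, max_lt_iff]
    refine ⟨by simpa using hε, ?_⟩
    rw [Prod.snd_sub, Real.norm_eq_abs, abs_sub_comm]
    exact hs

/-- By minimality each orbit in `Λ` visits `O`; compactness of `Λ` makes the waiting time uniform.
-/
theorem exists_time {O : Set Torus2} (hO : IsOpen O) (hne : (O ∩ M.Λ).Nonempty) :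
    ∃ T : ℝ, ∀ y ∈ M.Λ, ∃ t, |t| ≤ T ∧ M.φ t y ∈ O := by
  have h1 : ∀ y ∈ M.Λ, ∃ t, M.φ t y ∈ O := by
    by_contra hcon
    push Not at hcon
    obtain ⟨y, -, hy⟩ := hcon
    obtain ⟨x, hxO, hxΛ⟩ := hne
    have := M.Λ_subset_of_invariant (K := {x | ∀ t, M.φ t x ∉ O})
      (by
        rw [ofPred_forall]
        exact isClosed_iInter fun t => (hO.preimage (M.φ t).continuous).isClosed_compl)
      ⟨y, hy⟩ (fun t x hx s => by
        have := hx (s + t)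
        rwa [M.φ_add] at this) hxΛ 0
    rw [M.φ_zero] at this
    exact this hxO
  set W : ℕ → Set Torus2 := fun n => ⋃ t ∈ {t : ℝ | |t| ≤ n}, M.φ t ⁻¹' O with hW
  obtain ⟨n, hn⟩ := M.isCompact_Λ.elim_directed_cover W
    (fun n => isOpen_biUnion fun t _ => hO.preimage (M.φ t).continuous)
    (fun y hy => by
      obtain ⟨t, ht⟩ := h1 y hy
      obtain ⟨n, hn⟩ := exists_nat_ge |t|
      exact mem_iUnion.2 ⟨n, mem_biUnion (show t ∈ {t : ℝ | |t| ≤ n} from hn) ht⟩)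
    (Monotone.directed_le fun m n hmn => biUnion_mono
      (fun t (ht : |t| ≤ m) => ht.trans (by exact_mod_cast hmn)) fun _ _ => le_rfl)
  refine ⟨n, fun y hy => ?_⟩
  obtain ⟨t, ht, hty⟩ := mem_iUnion₂.1 (hn hy)
  exact ⟨t, ht, hty⟩

/-- `f^[n]` stretches a short orbit segment in `U` to one of length larger than the uniform waiting
time for `O`. The conclusion `0 < n` is needed for the non-wandering set. -/
theorem transitive {U O : Set Torus2} (hU : IsOpen U) (hO : IsOpen O) (hUΛ : (U ∩ M.Λ).Nonempty)
    (hOΛ : (O ∩ M.Λ).Nonempty) : ∃ n : ℕ, 0 < n ∧ ((M.f^[n] '' (U ∩ M.Λ)) ∩ O).Nonempty := by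
  obtain ⟨T, hT⟩ := M.exists_time hO hOΛ
  obtain ⟨x, hxU, hxΛ⟩ := hUΛ
  have h1 : ∀ᶠ t in 𝓝 (0 : ℝ), M.φ t x ∈ U :=
    (M.continuous_φ_left x).continuousAt.eventually (hU.mem_nhds (by
      change M.φ 0 x ∈ U; rw [M.φ_zero]; exact hxU))
  obtain ⟨δ, hδ, h2⟩ := Metric.eventually_nhds_iff.1 h1
  obtain ⟨n, hn⟩ := pow_unbounded_of_one_lt (T / δ) M.pert.one_lt
  have hn1 : T / δ < M.lam ^ (n + 1) :=
    hn.trans (pow_lt_pow_right₀ M.pert.one_lt n.lt_succ_self)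
  obtain ⟨t, ht, htO⟩ := hT _ (M.f_iterate_mem_Λ hxΛ (n + 1))
  have hp : 0 < M.lam ^ (n + 1) := pow_pos M.lam_pos _
  refine ⟨n + 1, n.succ_pos, _, ⟨_, ⟨h2 (y := (M.lam ^ (n + 1))⁻¹ * t) ?_, (M.φ_mem_Λ _).2 hxΛ⟩, rfl⟩, ?_⟩
  · rw [dist_zero_right, Real.norm_eq_abs, abs_mul, abs_inv, abs_of_pos hp, inv_mul_lt_iff₀ hp]
    rw [div_lt_iff₀ hδ] at hn1
    exact ht.trans_lt hn1
  · rw [M.f_iterate_φ, mul_inv_cancel_left₀ hp.ne']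
    exact htO

theorem isTransitiveAttractor : IsTransitiveAttractor M.f M.Λ :=
  ⟨⟨M.VTᶜ, M.isOpen_VT.isClosed_compl.isCompact, M.f_image_subset_interior, M.Λ_eq_iInter⟩,
    fun _ _ hU hO h1 h2 => let ⟨n, _, h⟩ := M.transitive hU hO h1 h2; ⟨n, h⟩⟩

/-! #### The non-wandering set -/

theorem mem_nonwanderingSet_of_f {x : Torus2} (hx : M.f x ∈ nonwanderingSet M.f) :
    x ∈ nonwanderingSet M.f := by
  intro U hU
  obtain ⟨n, hn, y, ⟨a, ha, hay⟩, hy⟩ := hx _ (M.f.isOpenMap.image_mem_nhds hU)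
  obtain ⟨b, hb, rfl⟩ := ha
  obtain ⟨c, hc, rfl⟩ := hy
  rw [← Function.iterate_succ_apply, Function.iterate_succ_apply'] at hay
  exact ⟨n, hn, _, ⟨b, hb, M.f.injective hay⟩, hc⟩

theorem mem_nonwanderingSet_of_f_iterate {n : ℕ} {x : Torus2}
    (hx : M.f^[n] x ∈ nonwanderingSet M.f) : x ∈ nonwanderingSet M.f := by
  induction n with
  | zero => exact hx
  | succ n ih =>
    rw [Function.iterate_succ_apply'] at hx
    exact ih (M.mem_nonwanderingSet_of_f hx)

theorem f_mem_nonwanderingSet {x : Torus2} (hx : x ∈ nonwanderingSet M.f) :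
    M.f x ∈ nonwanderingSet M.f := by
  intro U hU
  obtain ⟨n, hn, y, ⟨a, ha, rfl⟩, hy⟩ := hx _ (M.f.continuous.continuousAt hU)
  refine ⟨n, hn, _, ⟨M.f a, ha, rfl⟩, ?_⟩
  rw [← Function.iterate_succ_apply, Function.iterate_succ_apply']
  exact hy

/-- Near such a point, the second and all later iterates lie outside `VT`, while the first is kept
away by separating `y` from `f y`. -/
theorem not_mem_nonwanderingSet {y : Torus2} (hy : y ∈ M.VT) (hfy : M.f y ∉ M.VT) :
    y ∉ nonwanderingSet M.f := by
  intro hcon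
  have hne : y ≠ M.f y := fun h => hfy (h ▸ hy)
  obtain ⟨A, B, hA, hB, hyA, hyB, hAB⟩ := t2_separation hne
  have h1 : {z | M.f (M.f z) ∉ closure M.VT} ∈ 𝓝 y :=
    (isClosed_closure.isOpen_compl.preimage (M.f.continuous.comp M.f.continuous)).mem_nhds
      (M.f_not_mem_closure hfy)
  obtain ⟨n, hn, _, ⟨z, ⟨⟨⟨hz1, hz2⟩, hz3⟩, hz4⟩, rfl⟩, ⟨⟨h3, -⟩, h4⟩, -⟩ :=
    hcon _ (inter_mem (inter_mem (inter_mem (M.isOpen_VT.mem_nhds hy) h1) (hA.mem_nhds hyA))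
      (M.f.continuous.continuousAt (hB.mem_nhds hyB)))
  obtain ⟨n, rfl⟩ : ∃ m, n = m + 1 := ⟨n - 1, by omega⟩
  cases n with
  | zero => exact hAB.ne_of_mem h4 hz4 rfl
  | succ n =>
    rw [Function.iterate_succ_apply, Function.iterate_succ_apply] at h3
    exact M.f_iterate_not_mem (fun h => hz2 (subset_closure h)) n h3

theorem f_π_zero : M.f (M.π 0) = M.π 0 := by rw [M.f_π, M.F_zero]

/-- A point outside `Λ` has a preimage in `VT`; unless it is the source, the forward orbit of this
preimage leaves `VT`. The last point of the orbit in `VT` is wandering, and the non-wandering set is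
invariant. -/
theorem nonwanderingSet_eq : nonwanderingSet M.f = {M.π 0} ∪ M.Λ := by
  refine Subset.antisymm (fun x hx => ?_) (union_subset ?_ fun x hx U hU => ?_)
  · by_contra hcon
    rw [mem_union, not_or, mem_singleton_iff, M.mem_Λ_iff] at hcon
    obtain ⟨hp, hcon⟩ := hcon
    push Not at hcon
    obtain ⟨n, hn⟩ := hcon
    set x' := M.f.symm^[n] x with hx'
    have hxx' : M.f^[n] x' = x := Function.LeftInverse.iterate M.f.apply_symm_apply n x
    have hx'p : x' ≠ M.π 0 := fun h => hp (by
      rw [← hxx', h]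
      exact Function.iterate_fixed M.f_π_zero n)
    have hΩ : x' ∈ nonwanderingSet M.f := by
      rw [← hxx'] at hx
      exact M.mem_nonwanderingSet_of_f_iterate hx
    classical
    have hex : ∃ m, M.f^[m] x' ∉ M.VT := by
      by_contra h
      push Not at h
      exact hx'p (M.eq_of_forall_mem_VT h)
    obtain ⟨m, hm⟩ : ∃ m, Nat.find hex = m + 1 :=
      ⟨Nat.find hex - 1, by
        have : Nat.find hex ≠ 0 := fun h => Nat.find_spec hex (by rw [h]; exact hn)
        omega⟩
    have h1 : M.f^[m] x' ∈ M.VT := not_not.1 (Nat.find_min hex (by omega))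
    have h2 := Nat.find_spec hex
    rw [hm, Function.iterate_succ_apply'] at h2
    refine M.not_mem_nonwanderingSet h1 h2 ?_
    clear h1 h2 hm
    induction m with
    | zero => exact hΩ
    | succ m ih => rw [Function.iterate_succ_apply']; exact M.f_mem_nonwanderingSet ih
  · rintro _ rfl U hU
    exact ⟨1, one_pos, M.π 0, ⟨_, mem_of_mem_nhds hU, M.f_π_zero⟩, mem_of_mem_nhds hU⟩
  · obtain ⟨O, hOU, hO, hxO⟩ := mem_nhds_iff.1 hU
    obtain ⟨n, hn, y, ⟨a, ha, hay⟩, hy⟩ := M.transitive hO hO ⟨x, hxO, hx⟩ ⟨x, hxO, hx⟩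
    exact ⟨n, hn, y, ⟨a, hOU ha.1, hay⟩, hOU hy⟩

end DAModel

namespace DAModel

variable (M : DAModel)

/-! ### Flow boxes -/

theorem exists_injOn_ball : ∃ δ > 0, ∀ z z', ‖z - z'‖ < δ → M.π z = M.π z' → z = z' := by
  obtain ⟨δ, hδ, h⟩ := M.lat.discrete
  refine ⟨δ, hδ, fun z z' hz he => ?_⟩
  by_contra hne
  exact hz.not_ge (h _ ((M.cover.eq_iff _ _).1 he) (sub_ne_zero.2 hne))

/-- Coordinates near `z₀` that straighten the unstable foliation. -/
def chart (z₀ : ℝ × ℝ) {ε : ℝ} (hε : ε ≠ 0) : (ℝ × ℝ) ≃ (ℝ × ℝ) where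
  toFun q := M.Φ (ε * q.1) (z₀ + (0, ε * q.2))
  invFun z := (ε⁻¹ * (z.1 - z₀.1), ε⁻¹ * ((M.Φ (-(z.1 - z₀.1)) z).2 - z₀.2))
  left_inv q := by
    have h1 : (M.Φ (ε * q.1) (z₀ + (0, ε * q.2))).1 - z₀.1 = ε * q.1 := by rw [M.Φ_fst]; simp
    simp only [h1, M.Φ_neg_cancel]
    ext <;> simp [hε]
  right_inv z := by
    have h1 : z₀ + (0, (M.Φ (-(z.1 - z₀.1)) z).2 - z₀.2) = M.Φ (-(z.1 - z₀.1)) z := by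
      ext
      · rw [M.Φ_fst]; simp
      · simp
    simp only [mul_inv_cancel_left₀ hε, h1, M.Φ_cancel_neg]

theorem chart_apply (z₀ : ℝ × ℝ) {ε : ℝ} (hε : ε ≠ 0) (q : ℝ × ℝ) :
    M.chart z₀ hε q = M.Φ (ε * q.1) (z₀ + (0, ε * q.2)) := rfl

theorem chart_zero (z₀ : ℝ × ℝ) {ε : ℝ} (hε : ε ≠ 0) : M.chart z₀ hε 0 = z₀ := by
  rw [chart_apply]
  simp [M.Φ_zero, ← Prod.zero_eq_mk]

theorem isC1HolderOn_chart (z₀ : ℝ × ℝ) {ε : ℝ} (hε : ε ≠ 0) :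
    IsC1HolderOn M.α (M.chart z₀ hε) univ := by
  have h1 : ContDiff ℝ 2 fun q : ℝ × ℝ => ((ε * q.1, z₀ + (0, ε * q.2)) : ℝ × (ℝ × ℝ)) := by
    fun_prop
  exact M.isC1HolderOn_Φ.comp (isC1HolderOn_of_contDiff M.α_lt_one.le h1)

theorem differentiable_chart_symm (z₀ : ℝ × ℝ) {ε : ℝ} (hε : ε ≠ 0) :
    Differentiable ℝ (M.chart z₀ hε).symm := by
  have h0 : Differentiable ℝ fun q : ℝ × (ℝ × ℝ) => M.Φ q.1 q.2 :=
    (isC1HolderOn_univ.1 M.isC1HolderOn_Φ).1.differentiable one_ne_zero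
  have h1 : Differentiable ℝ fun z : ℝ × ℝ => M.Φ (-(z.1 - z₀.1)) z :=
    h0.comp (by fun_prop : Differentiable ℝ fun z : ℝ × ℝ => (-(z.1 - z₀.1), z))
  change Differentiable ℝ fun z : ℝ × ℝ =>
    (ε⁻¹ * (z.1 - z₀.1), ε⁻¹ * ((M.Φ (-(z.1 - z₀.1)) z).2 - z₀.2))
  fun_prop

theorem bijective_fderiv_chart (z₀ : ℝ × ℝ) {ε : ℝ} (hε : ε ≠ 0) (q : ℝ × ℝ) :
    Function.Bijective (fderiv ℝ (M.chart z₀ hε) q) := by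
  have h1 : DifferentiableAt ℝ (M.chart z₀ hε) q :=
    (isC1HolderOn_univ.1 (M.isC1HolderOn_chart z₀ hε)).1.differentiable one_ne_zero q
  have h2 := M.differentiable_chart_symm z₀ hε (M.chart z₀ hε q)
  have e1 : (fderiv ℝ (M.chart z₀ hε).symm (M.chart z₀ hε q)).comp (fderiv ℝ (M.chart z₀ hε) q) =
      ContinuousLinearMap.id ℝ _ := by
    rw [← fderiv_comp _ h2 h1, (M.chart z₀ hε).symm_comp_self, fderiv_id]
  have hl : Function.LeftInverse (fderiv ℝ (M.chart z₀ hε).symm (M.chart z₀ hε q))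
      (fderiv ℝ (M.chart z₀ hε) q) := fun v => congrArg (fun T : _ →L[ℝ] _ => T v) e1
  exact ⟨hl.injective, (LinearMap.injective_iff_surjective
    (f := (fderiv ℝ (M.chart z₀ hε) q : (ℝ × ℝ) →ₗ[ℝ] (ℝ × ℝ)))).1 hl.injective⟩

/-- A flow box of small size `ε` has diameter below the injectivity radius of the covering. The
closed square is included because the boundary sides are needed for the dimension. -/
theorem exists_chart (z₀ : ℝ × ℝ) {O : Set (ℝ × ℝ)} (hO : O ∈ 𝓝 z₀) :
    ∃ (ε : ℝ) (hε : ε ≠ 0), MapsTo (M.chart z₀ hε) (Icc (-1) 1 ×ˢ Icc (-1) 1) O ∧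
      InjOn (M.π ∘ M.chart z₀ hε) (Icc (-1) 1 ×ˢ Icc (-1) 1) := by
  obtain ⟨δ, hδ, hinj⟩ := M.exists_injOn_ball
  obtain ⟨δ', hδ', hball⟩ := Metric.mem_nhds_iff.1 hO
  obtain ⟨C, hC⟩ := M.exists_Φ_bound
  have hC0 : 0 ≤ C := by simpa using (abs_nonneg _).trans (hC 1 0)
  set d := min δ' (δ / 2) with hd
  have hd0 : 0 < d := lt_min hδ' (half_pos hδ)
  set ε := d / (C + 2) with hεd
  have hε : 0 < ε := by positivity
  have hεC : ε * (C + 2) = d := div_mul_cancel₀ _ (by positivity)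
  have key : ∀ q ∈ Icc (-1 : ℝ) 1 ×ˢ Icc (-1 : ℝ) 1, ‖M.chart z₀ hε.ne' q - z₀‖ < d := by
    rintro q ⟨h1, h2⟩
    have hq1 : |ε * q.1| ≤ ε := by
      rw [abs_mul, abs_of_pos hε]; exact mul_le_of_le_one_right hε.le (abs_le.2 h1)
    have hq2 : |ε * q.2| ≤ ε := by
      rw [abs_mul, abs_of_pos hε]; exact mul_le_of_le_one_right hε.le (abs_le.2 h2)
    rw [Prod.norm_def, max_lt_iff, Real.norm_eq_abs, Real.norm_eq_abs, Prod.fst_sub, Prod.snd_sub,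
      chart_apply, M.Φ_fst]
    constructor
    · simp only [Prod.fst_add, add_zero, add_sub_cancel_left]
      nlinarith
    · have h3 := hC (ε * q.1) (z₀ + (0, ε * q.2))
      have h4 : C * |ε * q.1| ≤ C * ε := mul_le_mul_of_nonneg_left hq1 hC0
      simp only [Prod.snd_add] at h3
      rw [abs_le] at h3 hq2
      rw [abs_lt]
      constructor <;> nlinarith [h3.1, h3.2, hq2.1, hq2.2]
  refine ⟨ε, hε.ne', fun q hq => hball ?_, fun q hq q' hq' he => ?_⟩
  · rw [mem_ball_iff_norm]
    exact (key q hq).trans_le (min_le_left _ _)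
  · refine (M.chart z₀ hε.ne').injective (hinj _ _ ?_ he)
    have h1 := key q hq
    have h2 := key q' hq'
    have h3 : d ≤ δ / 2 := min_le_right _ _
    calc ‖M.chart z₀ hε.ne' q - M.chart z₀ hε.ne' q'‖
        = ‖(M.chart z₀ hε.ne' q - z₀) - (M.chart z₀ hε.ne' q' - z₀)‖ := by congr 1; abel
      _ ≤ _ := norm_sub_le _ _
      _ < δ := by linarith

theorem continuous_chart (z₀ : ℝ × ℝ) {ε : ℝ} (hε : ε ≠ 0) : Continuous (M.chart z₀ hε) :=
  (isC1HolderOn_univ.1 (M.isC1HolderOn_chart z₀ hε)).1.continuous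

theorem continuous_chart_symm (z₀ : ℝ × ℝ) {ε : ℝ} (hε : ε ≠ 0) :
    Continuous (M.chart z₀ hε).symm := (M.differentiable_chart_symm z₀ hε).continuous

theorem chart_eq_Φ (z₀ : ℝ × ℝ) {ε : ℝ} (hε : ε ≠ 0) (q : ℝ × ℝ) (r : ℝ) :
    M.chart z₀ hε (r, q.2) = M.Φ (ε * r - ε * q.1) (M.chart z₀ hε q) := by
  rw [chart_apply, chart_apply, ← M.Φ_add, sub_add_cancel]

/-- In a flow box, the components of the traces of the orbits are the horizontal segments. -/
theorem connectedComponentIn_chart (z₀ : ℝ × ℝ) {ε : ℝ} (hε : ε ≠ 0) {q : ℝ × ℝ}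
    (hq : q ∈ openSquare) :
    connectedComponentIn (openSquare ∩ {q' | M.π (M.chart z₀ hε q') ∈
      range fun t => M.φ t (M.π (M.chart z₀ hε q))}) q = Ioo (-1) 1 ×ˢ {q.2} := by
  set S := openSquare ∩ {q' | M.π (M.chart z₀ hε q') ∈
      range fun t => M.φ t (M.π (M.chart z₀ hε q))} with hS
  have hqS : q ∈ S := ⟨hq, 0, by simp [M.φ_zero]⟩
  -- The trace of an orbit in the box has at most one height for each lattice vector. A connected
  -- subset of it has connected countable projection, hence constant height.
  have hcount : (Prod.snd '' S).Countable := by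
    refine (M.lat.countable.image fun ℓ => ε⁻¹ * ((M.Φ (-ℓ.1) (z₀ + (0, ε * q.2) + ℓ)).2 - z₀.2)).mono
      ?_
    rintro _ ⟨q', ⟨-, t, ht⟩, rfl⟩
    simp only [M.φ_π] at ht
    rw [eq_comm, M.cover.eq_iff] at ht
    refine ⟨_, ht, ?_⟩
    set ℓ := M.chart z₀ hε q' - M.Φ t (M.chart z₀ hε q) with hℓ
    have h1 : M.chart z₀ hε q' = M.Φ (t + ε * q.1) (z₀ + (0, ε * q.2) + ℓ) := by
      rw [M.Φ_add_lattice ht, M.Φ_add, ← M.chart_apply z₀ hε, hℓ, add_sub_cancel]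
    rw [chart_apply] at h1
    have h2 : z₀ + (0, ε * q'.2) = M.Φ (t + ε * q.1 - ε * q'.1) (z₀ + (0, ε * q.2) + ℓ) := by
      rw [sub_eq_neg_add, M.Φ_add, ← h1, M.Φ_neg_cancel]
    have h3 : t + ε * q.1 - ε * q'.1 = -ℓ.1 := by
      have := congrArg Prod.fst h2
      rw [M.Φ_fst] at this
      simp only [Prod.fst_add] at this
      linarith
    simp only
    rw [← h3, ← h2, Prod.snd_add, add_sub_cancel_left, inv_mul_cancel_left₀ hε]
  refine Subset.antisymm (fun q' hq' => ?_) ?_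
  · have hsub := connectedComponentIn_subset S q
    have h1 : (Prod.snd '' connectedComponentIn S q).Subsingleton :=
      hcount.isTotallyDisconnected _ (image_mono hsub)
        (isPreconnected_connectedComponentIn.image _ continuous_snd.continuousOn)
    exact ⟨(hsub hq').1.1, h1 ⟨_, hq', rfl⟩ ⟨_, mem_connectedComponentIn hqS, rfl⟩⟩
  · refine (isPreconnected_Ioo.prod isPreconnected_singleton).subset_connectedComponentIn
      ⟨hq.1, rfl⟩ ?_
    rintro ⟨r, s⟩ ⟨h1, rfl⟩
    refine ⟨⟨h1, hq.2⟩, ε * r - ε * q.1, ?_⟩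
    simp only [M.φ_π]
    rw [M.chart_eq_Φ z₀ hε q r]

/-! #### The dimension of the attractor -/

theorem isClosed_attr : IsClosed M.attr := by
  have : M.attr = M.π ⁻¹' M.Λ := by ext z; exact M.π_mem_Λ.symm
  rw [this]
  exact M.isCompact_Λ.isClosed.preimage M.cover.continuous

/-- The two sides of the box lie over two values of the first coordinate, so a connected subset is
vertical, and the attractor contains no vertical segment. -/
theorem isTotallyDisconnected_section (z₀ : ℝ × ℝ) {ε : ℝ} (hε : ε ≠ 0) :
    IsTotallyDisconnected (M.attr ∩ M.chart z₀ hε '' ({-1, 1} ×ˢ Icc (-1) 1)) := by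
  intro t ht hc a ha b hb
  have hfst : ∀ c ∈ t, c.1 = a.1 := by
    intro c hc'
    have hcount : ({z₀.1 - ε, z₀.1 + ε} : Set ℝ).Countable := by simp
    refine hcount.isTotallyDisconnected (Prod.fst '' t) ?_ (hc.image _ continuous_fst.continuousOn)
      ⟨c, hc', rfl⟩ ⟨a, ha, rfl⟩
    rintro _ ⟨z, hz, rfl⟩
    obtain ⟨-, q, ⟨hq, -⟩, rfl⟩ := ht hz
    rw [chart_apply, M.Φ_fst]
    rcases hq with hq | hq
    · left; rw [hq]; simp [sub_eq_add_neg]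
    · right; rw [mem_singleton_iff.1 hq]; simp
  have key : ∀ x ∈ t, ∀ y ∈ t, ¬ x.2 < y.2 := by
    intro x hx y hy hlt
    obtain ⟨s, hs, hsn⟩ := M.exists_not_mem_attr a.1 hlt
    have hord := (hc.image _ continuous_snd.continuousOn).ordConnected
    obtain ⟨c, hc', rfl⟩ := hord.out ⟨x, hx, rfl⟩ ⟨y, hy, rfl⟩ (Ioo_subset_Icc_self hs)
    rw [← hfst c hc'] at hsn
    exact hsn (ht hc').1
  exact Prod.ext (hfst b hb).symm (le_antisymm (not_lt.1 (key b hb a ha)) (not_lt.1 (key a ha b hb)))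

theorem isTotallyDisconnected_image_section (z₀ : ℝ × ℝ) {ε : ℝ} (hε : ε ≠ 0)
    (hinj : InjOn (M.π ∘ M.chart z₀ hε) (Icc (-1) 1 ×ˢ Icc (-1) 1)) :
    IsTotallyDisconnected (M.π '' (M.attr ∩ M.chart z₀ hε '' ({-1, 1} ×ˢ Icc (-1) 1))) := by
  set E := M.attr ∩ M.chart z₀ hε '' ({-1, 1} ×ˢ Icc (-1) 1) with hE
  have hEc : IsCompact E := by
    refine IsCompact.inter_left ?_ M.isClosed_attr
    exact ((toFinite _).isCompact.prod isCompact_Icc).image (M.continuous_chart z₀ hε)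
  have hEi : InjOn M.π E := by
    have hsub : ({-1, 1} : Set ℝ) ⊆ Icc (-1) 1 := by
      rintro x (rfl | rfl) <;> norm_num
    rintro _ ⟨-, q, hq, rfl⟩ _ ⟨-, q', hq', rfl⟩ he
    rw [hinj ⟨hsub hq.1, hq.2⟩ ⟨hsub hq'.1, hq'.2⟩ he]
  intro t ht hc x hx y hy
  have := isCompact_iff_compactSpace.1 hEc
  set g : E → Torus2 := fun e => M.π e with hg
  have hgc : Continuous g := M.cover.continuous.comp continuous_subtype_val
  have h1 : IsPreconnected (g ⁻¹' t) := by
    refine hc.preimage_of_isClosedMap (fun a b h => Subtype.ext (hEi a.2 b.2 h)) hgc.isClosedMap ?_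
    intro x hx
    obtain ⟨e, he, rfl⟩ := ht hx
    exact ⟨⟨e, he⟩, rfl⟩
  have h2 := M.isTotallyDisconnected_section z₀ hε (Subtype.val '' (g ⁻¹' t))
    (by rintro _ ⟨e, -, rfl⟩; exact e.2) (h1.image _ continuous_subtype_val.continuousOn)
  obtain ⟨a, ha, rfl⟩ := ht hx
  obtain ⟨b, hb, rfl⟩ := ht hy
  have : a = b := h2 ⟨⟨a, ha⟩, hx, rfl⟩ ⟨⟨b, hb⟩, hy, rfl⟩
  rw [this]

theorem hasSmallInductiveDimensionLT_one_of_totallyDisconnected {X : Type*} [TopologicalSpace X]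
    [CompactSpace X] [T2Space X] [TotallyDisconnectedSpace X] : HasSmallInductiveDimensionLT X 1 :=
  hasSmallInductiveDimensionLT_one_iff.2 isTopologicalBasis_isClopen

/-- Each point has small flow-box neighbourhoods whose horizontal sides miss the attractor. The
frontier in `Λ` then lies in the two vertical sides; it is compact and totally disconnected, hence
of dimension at most zero. -/
theorem hasSmallInductiveDimensionLE_Λ : HasSmallInductiveDimensionLE M.Λ 1 := by
  have hΛc := isCompact_iff_compactSpace.1 M.isCompact_Λ
  refine .succ 1 {W : Set M.Λ | IsOpen W ∧ HasSmallInductiveDimensionLT (frontier W) 1} ?_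
    fun W hW => hW.2
  refine TopologicalSpace.isTopologicalBasis_of_isOpen_of_nhds (fun W hW => hW.1) ?_
  rintro ⟨x, hx⟩ O hxO hO
  obtain ⟨O', hO', rfl⟩ := isOpen_induced_iff.1 hO
  obtain ⟨z₀, rfl⟩ := M.cover.surjective x
  obtain ⟨ε, hε, hmaps, hinj⟩ := M.exists_chart z₀
    (M.cover.continuous.continuousAt.preimage_mem_nhds (hO'.mem_nhds hxO))
  -- One point of the vertical line outside the attractor suffices: by flow invariance its whole
  -- horizontal line is outside.
  have hsec : ∀ a b : ℝ, a < b → ∃ s ∈ Ioo a b, ∀ r, M.chart z₀ hε (r, s) ∉ M.attr := by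
    intro a b hab
    rcases lt_or_gt_of_ne hε with h | h
    · obtain ⟨s, hs, hn⟩ := M.exists_not_mem_attr z₀.1
        (s₁ := z₀.2 + ε * b) (s₂ := z₀.2 + ε * a) (by nlinarith)
      refine ⟨ε⁻¹ * (s - z₀.2), ⟨?_, ?_⟩, fun r hr => hn ?_⟩
      · rw [inv_mul_eq_div, lt_div_iff_of_neg h]; linarith [hs.2]
      · rw [inv_mul_eq_div, div_lt_iff_of_neg h]; linarith [hs.1]
      · rw [chart_apply, M.Φ_mem_attr_iff] at hr
        convert hr using 1
        ext <;> simp [hε]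
    · obtain ⟨s, hs, hn⟩ := M.exists_not_mem_attr z₀.1
        (s₁ := z₀.2 + ε * a) (s₂ := z₀.2 + ε * b) (by nlinarith)
      refine ⟨ε⁻¹ * (s - z₀.2), ⟨?_, ?_⟩, fun r hr => hn ?_⟩
      · rw [inv_mul_eq_div, lt_div_iff₀ h]; linarith [hs.1]
      · rw [inv_mul_eq_div, div_lt_iff₀ h]; linarith [hs.2]
      · rw [chart_apply, M.Φ_mem_attr_iff] at hr
        convert hr using 1
        ext <;> simp [hε]
  obtain ⟨s₁, hs₁, hn₁⟩ := hsec (-1) 0 (by norm_num)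
  obtain ⟨s₂, hs₂, hn₂⟩ := hsec 0 1 (by norm_num)
  set P : ℝ × ℝ → Torus2 := M.π ∘ M.chart z₀ hε with hP
  have hPc : Continuous P := M.cover.continuous.comp (M.continuous_chart z₀ hε)
  have hPo : IsOpenMap P := M.cover.isOpenMap.comp
    (Homeomorph.mk (M.chart z₀ hε) (M.continuous_chart z₀ hε)
      (M.continuous_chart_symm z₀ hε)).isOpenMap
  set Q : Set (ℝ × ℝ) := Ioo (-1) 1 ×ˢ Ioo s₁ s₂ with hQ
  set Q' : Set (ℝ × ℝ) := Icc (-1) 1 ×ˢ Icc s₁ s₂ with hQ'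
  have hQQ' : Q ⊆ Q' := prod_mono Ioo_subset_Icc_self Ioo_subset_Icc_self
  have hQ1 : Q' ⊆ Icc (-1) 1 ×ˢ Icc (-1) 1 :=
    prod_mono le_rfl (Icc_subset_Icc hs₁.1.le hs₂.2.le)
  have hWo : IsOpen (P '' Q) := hPo _ (isOpen_Ioo.prod isOpen_Ioo)
  have hPQ'c : IsClosed (P '' Q') := ((isCompact_Icc.prod isCompact_Icc).image hPc).isClosed
  refine ⟨Subtype.val ⁻¹' (P '' Q), ⟨hWo.preimage continuous_subtype_val, ?_⟩,
    ⟨0, ⟨by norm_num, hs₁.2, hs₂.1⟩, by simp [hP, M.chart_zero]⟩, ?_⟩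
  · have hfr : ∀ y ∈ frontier (Subtype.val ⁻¹' (P '' Q) : Set M.Λ), (y : Torus2) ∈
        M.π '' (M.attr ∩ M.chart z₀ hε '' ({-1, 1} ×ˢ Icc (-1) 1)) := by
      intro y hy
      rw [(hWo.preimage continuous_subtype_val).frontier_eq] at hy
      have h1 : (y : Torus2) ∈ P '' Q' :=
        closure_minimal (preimage_mono (image_mono hQQ'))
          (hPQ'c.preimage continuous_subtype_val) hy.1
      obtain ⟨⟨r, s⟩, hrs, he⟩ := h1
      have hattr : M.chart z₀ hε (r, s) ∈ M.attr := by
        rw [← M.π_mem_Λ]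
        change P (r, s) ∈ M.Λ
        rw [he]; exact y.2
      refine ⟨_, ⟨hattr, _, ⟨?_, (hQ1 hrs).2⟩, rfl⟩, he⟩
      have hns : s ∈ Ioo s₁ s₂ :=
        ⟨lt_of_le_of_ne hrs.2.1 fun h => hn₁ r (by rw [h]; exact hattr),
          lt_of_le_of_ne hrs.2.2 fun h => hn₂ r (by rw [← h]; exact hattr)⟩
      by_contra hr
      have hr' : r ≠ -1 ∧ r ≠ 1 := by simpa [not_or] using hr
      exact hy.2 ⟨(r, s), ⟨⟨lt_of_le_of_ne hrs.1.1 hr'.1.symm, lt_of_le_of_ne hrs.1.2 hr'.2⟩, hns⟩,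
        he⟩
    have htd : IsTotallyDisconnected (frontier (Subtype.val ⁻¹' (P '' Q) : Set M.Λ)) := by
      refine isTotallyDisconnected_of_image continuous_subtype_val.continuousOn
        Subtype.val_injective fun t ht hc => M.isTotallyDisconnected_image_section z₀ hε hinj t
          (ht.trans ?_) hc
      rintro _ ⟨y, hy, rfl⟩
      exact hfr y hy
    have := totallyDisconnectedSpace_subtype_iff.2 htd
    have : CompactSpace (frontier (Subtype.val ⁻¹' (P '' Q) : Set M.Λ)) :=
      isCompact_iff_compactSpace.1 isClosed_frontier.isCompact
    exact hasSmallInductiveDimensionLT_one_of_totallyDisconnected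
  · rintro ⟨y, hy⟩ ⟨q, hq, he⟩
    simp only at he
    subst he
    exact hmaps (hQ1 (hQQ' hq))

/-- On the cover the flow moves the first coordinate by exactly `t`, and short displacements are not
identified by the covering. -/
theorem exists_φ_ne : ∃ τ > 0, ∀ t, |t| < τ → ∀ x, M.φ t x = x → t = 0 := by
  obtain ⟨δ, hδ, hinj⟩ := M.exists_injOn_ball
  obtain ⟨C, hC⟩ := M.exists_Φ_bound
  have hC0 : 0 ≤ C := by simpa using (abs_nonneg _).trans (hC 1 0)
  refine ⟨δ / (C + 1), by positivity, fun t ht x hx => ?_⟩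
  obtain ⟨z, rfl⟩ := M.cover.surjective x
  rw [M.φ_π] at hx
  rw [lt_div_iff₀ (by positivity)] at ht
  have h1 := hinj _ _ (by
    rw [Prod.norm_def, max_lt_iff, Prod.fst_sub, Prod.snd_sub, M.Φ_fst, add_sub_cancel_left]
    have h2 := hC t z
    have h3 := abs_nonneg t
    simp only [Real.norm_eq_abs]
    constructor <;> nlinarith) hx
  have := congrArg Prod.fst h1
  rw [M.Φ_fst] at this
  linarith

/-- `Λ` contains flow orbits, which are connected and have more than one point, so clopen sets
cannot form a basis. -/
theorem not_hasSmallInductiveDimensionLT_Λ : ¬ HasSmallInductiveDimensionLT M.Λ 1 := by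
  rw [hasSmallInductiveDimensionLT_one_iff]
  intro hb
  obtain ⟨x, hx⟩ := M.nonempty_Λ
  obtain ⟨τ, hτ, h⟩ := M.exists_φ_ne
  set c : ℝ → M.Λ := fun t => ⟨M.φ t x, (M.φ_mem_Λ t).2 hx⟩ with hc
  have hcc : Continuous c := (M.continuous_φ_left x).subtype_mk _
  have hne : c 0 ∈ ({c (τ / 2)}ᶜ : Set M.Λ) := fun he => by
    have e := congrArg Subtype.val (mem_singleton_iff.1 he)
    simp only [hc, M.φ_zero] at e
    have := h (τ / 2) (by rw [abs_of_pos (half_pos hτ)]; linarith) x e.symm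
    linarith
  obtain ⟨W, hW, h0W, hWs⟩ := hb.exists_subset_of_mem_open hne isOpen_compl_singleton
  have huniv : c ⁻¹' W = univ := by
    rcases isClopen_iff.1 (IsClopen.preimage hW hcc) with h | h
    · exact absurd (show (0 : ℝ) ∈ c ⁻¹' W from h0W) (by rw [h]; simp)
    · exact h
  have : τ / 2 ∈ c ⁻¹' W := by rw [huniv]; trivial
  exact hWs this rfl

theorem smallInductiveDimension_Λ : smallInductiveDimension M.Λ = 1 := by
  have := smallInductiveDimension_eq 1 M.hasSmallInductiveDimensionLE_Λ
    M.not_hasSmallInductiveDimensionLT_Λ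
  exact_mod_cast this

/-! ### The action -/

/-- The action of `ℤ ⋉ ℝ` generated by the diffeomorphism and by the flow. -/
def ρ {lam : Set.Ioi (1 : ℝ)} (hl : M.lam = lam) : SolvGroup lam →* (Torus2 ≃ₜ Torus2) where
  toFun g := M.φ g.t * M.f ^ g.m
  map_one' := by simp [SolvGroup.one_def, M.φ_zero]
  map_mul' g g' := by
    rw [SolvGroup.mul_def]
    simp only
    rw [← hl, add_comm, M.φ_add, zpow_add, mul_assoc, mul_assoc, ← mul_assoc _ (M.f ^ g.m),
      ← M.f_zpow_mul_φ]
    simp only [mul_assoc]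

theorem ρ_apply {lam : Set.Ioi (1 : ℝ)} (hl : M.lam = lam) (m : ℤ) (t : ℝ) :
    M.ρ hl ⟨m, t⟩ = M.φ t * M.f ^ m := rfl

theorem isLocallyFree_ρ {lam : Set.Ioi (1 : ℝ)} (hl : M.lam = lam) : IsLocallyFree (M.ρ hl) := by
  intro x
  obtain ⟨τ, hτ, h⟩ := M.exists_φ_ne
  have hc : Continuous fun g : SolvGroup lam => (g.m, g.t) := continuous_induced_dom
  have h1 : ∀ᶠ g in 𝓝 (1 : SolvGroup lam), g.m = 0 := by
    have : Continuous fun g : SolvGroup lam => g.m := continuous_fst.comp hc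
    exact this.continuousAt.preimage_mem_nhds (t := {0}) (by simp [SolvGroup.one_def])
  have h2 : ∀ᶠ g in 𝓝 (1 : SolvGroup lam), |g.t| < τ := by
    have : Continuous fun g : SolvGroup lam => |g.t| := (continuous_snd.comp hc).abs
    exact this.continuousAt.eventually_lt_const (by simpa [SolvGroup.one_def] using hτ)
  filter_upwards [h1, h2] with g hm ht hx
  obtain ⟨m, t⟩ := g
  simp only at hm ht
  subst hm
  rw [ρ_apply, zpow_zero, mul_one] at hx
  rw [h t ht x hx]
  rfl

/-! ### Derivatives of the iterates -/

theorem contDiff_F_iterate (n : ℕ) : ContDiff ℝ (⊤ : ℕ∞) M.F^[n] := by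
  induction n with
  | zero => exact contDiff_id
  | succ n ih => rw [Function.iterate_succ]; exact ih.comp M.contDiff_F

theorem fderiv_F_iterate_succ (n : ℕ) (z v : ℝ × ℝ) :
    fderiv ℝ M.F^[n + 1] z v = (M.lam * (fderiv ℝ M.F^[n] z v).1,
      M.dk (M.F^[n] z) * (fderiv ℝ M.F^[n] z v).1 +
        M.jac (M.F^[n] z) * (fderiv ℝ M.F^[n] z v).2) := by
  rw [Function.iterate_succ', fderiv_comp _ (M.hasFDerivAt_F _).differentiableAt
    ((M.contDiff_F_iterate n).differentiable (by simp) z), (M.hasFDerivAt_F _).fderiv]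
  rfl

/-- The derivative of the iterates in the stable direction. -/
def jacIter (n : ℕ) (z : ℝ × ℝ) : ℝ := ∏ i ∈ Finset.range n, M.jac (M.F^[i] z)

theorem fderiv_F_iterate_vertical (n : ℕ) (z : ℝ × ℝ) :
    fderiv ℝ M.F^[n] z (0, 1) = (0, M.jacIter n z) := by
  induction n with
  | zero => simp [jacIter]
  | succ n ih =>
    rw [M.fderiv_F_iterate_succ, ih]
    simp [jacIter, Finset.prod_range_succ, mul_comm]

theorem fderiv_F_iterate_slope (n : ℕ) (z : ℝ × ℝ) :
    fderiv ℝ M.F^[n] z (1, M.slope z) = (M.lam ^ n, M.lam ^ n * M.slope (M.F^[n] z)) := by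
  induction n with
  | zero => simp
  | succ n ih =>
    rw [M.fderiv_F_iterate_succ, ih, Function.iterate_succ_apply', pow_succ', mul_assoc,
      mul_left_comm M.lam, M.slope_F]
    ext <;> simp only; ring

theorem abs_jacIter_le {θ : ℝ} {z : ℝ × ℝ} (h : ∀ n, |M.jac (M.F^[n] z)| ≤ θ) (n : ℕ) :
    |M.jacIter n z| ≤ θ ^ n := by
  rw [jacIter, Finset.abs_prod]
  exact (Finset.prod_le_prod (fun _ _ => abs_nonneg _) fun i _ => h i).trans_eq (by simp)

theorem abs_jacIter_le_of_mem_attr {z : ℝ × ℝ} (hz : z ∈ M.attr) (n : ℕ) :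
    |M.jacIter n z| ≤ M.η ^ n := by
  refine M.abs_jacIter_le (fun i => M.pert.contract _ ?_) n
  have : M.F^[i] z ∈ M.attr := by
    induction i with
    | zero => exact hz
    | succ i ih => rw [Function.iterate_succ_apply']; exact M.F_mem_attr ih
  exact this 0

theorem eta_pos : 0 < M.η := by
  obtain ⟨x, hx⟩ := M.nonempty_compl_VT
  obtain ⟨z, rfl⟩ := M.cover.surjective x
  exact (abs_pos.2 (M.jac_ne_zero z)).trans_le
    (M.pert.contract z fun h => hx (M.π_mem_VT.2 h))

/-- At the fixed point the invariance equation reads `(λ - jac 0) slope = 0`, and `jac 0 < λ` by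
domination. -/
theorem slope_lattice {ℓ : ℝ × ℝ} (hℓ : ℓ ∈ M.L) : M.slope ℓ = 0 := by
  have h := M.slope_add hℓ 0
  rw [zero_add] at h
  rw [h]
  have h1 := M.slope_F 0
  rw [M.F_zero, dk, M.pert.slope_zero, zero_add] at h1
  have h2 := (le_abs_self _).trans (M.pert.jac_le 0)
  have h3 := M.pert.one_lt
  have h4 : (M.lam - M.jac 0) * M.slope 0 = 0 := by linarith
  refine (mul_eq_zero.1 h4).resolve_left (ne_of_gt ?_)
  have : M.jac 0 ≤ (1 + M.lam) / 2 := h2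
  linarith

theorem F_iterate_mem {ℓ : ℝ × ℝ} (hℓ : ℓ ∈ M.L) (n : ℕ) : M.F^[n] ℓ ∈ M.L := by
  induction n with
  | zero => exact hℓ
  | succ n ih =>
    rw [Function.iterate_succ_apply']
    have := M.F_add ih 0
    rw [zero_add, M.F_zero, zero_add] at this
    rw [this]
    exact M.diag_mem ih

theorem jacIter_lattice {ℓ : ℝ × ℝ} (hℓ : ℓ ∈ M.L) (n : ℕ) : M.jacIter n ℓ = M.jac 0 ^ n := by
  rw [jacIter]
  have : ∀ i, M.jac (M.F^[i] ℓ) = M.jac 0 := fun i => by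
    have := M.jac_periodic _ (M.F_iterate_mem hℓ i) 0
    rwa [zero_add] at this
  simp [this]

theorem fderiv_F_iterate_lattice {ℓ : ℝ × ℝ} (hℓ : ℓ ∈ M.L) (n : ℕ) (v : ℝ × ℝ) :
    fderiv ℝ M.F^[n] ℓ v = (M.lam ^ n * v.1, M.jac 0 ^ n * v.2) := by
  have h1 := M.fderiv_F_iterate_slope n ℓ
  have h2 := M.fderiv_F_iterate_vertical n ℓ
  rw [M.slope_lattice hℓ, M.slope_lattice (M.F_iterate_mem hℓ n)] at h1
  rw [M.jacIter_lattice hℓ] at h2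
  have h3 : v = v.1 • ((1, 0) : ℝ × ℝ) + v.2 • ((0, 1) : ℝ × ℝ) := by ext <;> simp
  rw [h3, map_add, map_smul, map_smul, h1, h2]
  ext <;> simp [mul_comm]

end DAModel

/-! ### Hyperbolic integer matrices -/

theorem plane_ext {x y : Plane} (h0 : x 0 = y 0) (h1 : x 1 = y 1) : x = y := by
  ext i; fin_cases i <;> assumption

/-- The second eigenvalue is `det A / λ`, with `det A = ±1`. By Cayley–Hamilton `(A - μ)(A - λ) =
0`, so any nonzero column of `A - λ` is an eigenvector; the columns cannot both vanish, since `A =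
λ` would have determinant `λ ^ 2 > 1`. -/
theorem exists_eigenframe {lam : ℝ} (hlam : 1 < lam) (A : GL (Fin 2) ℤ) {w : Plane} (hw : w ≠ 0)
    (hA : linMap A.val w = lam • w) :
    ∃ (mu : ℝ) (T : (ℝ × ℝ) ≃L[ℝ] Plane), |mu| = lam⁻¹ ∧ T (1, 0) = w ∧
      ∀ z, linMap A.val (T z) = T (lam * z.1, mu * z.2) := by
  have hl0 : 0 < lam := by linarith
  set a : ℝ := ((A.val 0 0 : ℤ) : ℝ) with ha
  set b : ℝ := ((A.val 0 1 : ℤ) : ℝ) with hb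
  set c : ℝ := ((A.val 1 0 : ℤ) : ℝ) with hc
  set d : ℝ := ((A.val 1 1 : ℤ) : ℝ) with hd
  have hdet : |a * d - b * c| = 1 := by
    have h1 : IsUnit A.val.det := (Matrix.isUnit_iff_isUnit_det _).1 A.isUnit
    rw [Matrix.det_fin_two] at h1
    have h2 := Int.isUnit_iff_abs_eq.1 h1
    rw [ha, hb, hc, hd]
    exact_mod_cast h2
  have e0 : a * w 0 + b * w 1 = lam * w 0 := by
    have := congrArg (fun v : Plane => v 0) hA
    simpa [linMap_apply] using this
  have e1 : c * w 0 + d * w 1 = lam * w 1 := by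
    have := congrArg (fun v : Plane => v 1) hA
    simpa [linMap_apply] using this
  have hchar : lam ^ 2 - (a + d) * lam + (a * d - b * c) = 0 := by
    have h0 : (lam ^ 2 - (a + d) * lam + (a * d - b * c)) * w 0 = 0 := by
      linear_combination (d - lam) * e0 - b * e1
    have h1 : (lam ^ 2 - (a + d) * lam + (a * d - b * c)) * w 1 = 0 := by
      linear_combination (a - lam) * e1 - c * e0
    by_contra hne
    exact hw (plane_ext ((mul_eq_zero.1 h0).resolve_left hne) ((mul_eq_zero.1 h1).resolve_left hne))
  set mu := (a * d - b * c) / lam with hmu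
  have hmul : mu * lam = a * d - b * c := div_mul_cancel₀ _ hl0.ne'
  have hsum : mu + lam = a + d := by
    have : lam * (mu + lam - (a + d)) = 0 := by linear_combination hmul + hchar
    have := (mul_eq_zero.1 this).resolve_left hl0.ne'
    linarith
  have habs : |mu| = lam⁻¹ := by rw [hmu, abs_div, hdet, abs_of_pos hl0, one_div]
  have hne : mu ≠ lam := fun h => by
    rw [h, abs_of_pos hl0] at habs
    have := inv_lt_one_of_one_lt₀ hlam
    linarith
  obtain ⟨e, he, hAe⟩ : ∃ e : Plane, e ≠ 0 ∧ linMap A.val e = mu • e := by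
    by_cases h : a - lam = 0 ∧ c = 0
    · have hbd : b ≠ 0 ∨ d - lam ≠ 0 := by
        by_contra hcon
        push Not at hcon
        rw [h.2, hcon.1, show a = lam by linarith [h.1], show d = lam by linarith [hcon.2]] at hdet
        rw [mul_zero, sub_zero, abs_of_pos (mul_pos hl0 hl0)] at hdet
        nlinarith
      refine ⟨!₂[b, d - lam], fun h0 => ?_, plane_ext ?_ ?_⟩
      · have h1 := congrArg (fun v : Plane => v 0) h0
        have h2 := congrArg (fun v : Plane => v 1) h0
        simp only [PiLp.zero_apply, Matrix.cons_val_zero, Matrix.cons_val_one]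
          at h1 h2
        exact hbd.elim (fun h => h h1) (fun h => h h2)
      · simp only [linMap_apply, Fin.sum_univ_two, PiLp.smul_apply, smul_eq_mul,
          Matrix.cons_val_zero, Matrix.cons_val_one]
        linear_combination -b * hsum
      · simp only [linMap_apply, Fin.sum_univ_two, PiLp.smul_apply, smul_eq_mul,
          Matrix.cons_val_zero, Matrix.cons_val_one]
        linear_combination hmul - d * hsum
    · refine ⟨!₂[a - lam, c], fun h0 => ?_, plane_ext ?_ ?_⟩
      · have h1 := congrArg (fun v : Plane => v 0) h0
        have h2 := congrArg (fun v : Plane => v 1) h0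
        simp only [PiLp.zero_apply, Matrix.cons_val_zero, Matrix.cons_val_one]
          at h1 h2
        exact h ⟨h1, h2⟩
      · simp only [linMap_apply, Fin.sum_univ_two, PiLp.smul_apply, smul_eq_mul,
          Matrix.cons_val_zero, Matrix.cons_val_one]
        linear_combination hmul - a * hsum
      · simp only [linMap_apply, Fin.sum_univ_two, PiLp.smul_apply, smul_eq_mul,
          Matrix.cons_val_zero, Matrix.cons_val_one]
        linear_combination -c * hsum
  set T₀ : (ℝ × ℝ) →ₗ[ℝ] Plane :=
    (LinearMap.toSpanSingleton ℝ Plane w).coprod (LinearMap.toSpanSingleton ℝ Plane e) with hT₀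
  have hT₀a : ∀ z, T₀ z = z.1 • w + z.2 • e := fun z => by simp [hT₀]
  have hAT : ∀ z, linMap A.val (T₀ z) = T₀ (lam * z.1, mu * z.2) := fun z => by
    rw [hT₀a, hT₀a, map_add, map_smul, map_smul, hA, hAe]
    module
  have hinj : Function.Injective T₀ := by
    rw [injective_iff_map_eq_zero]
    intro z hz
    have h1 : T₀ (lam * z.1, mu * z.2) = 0 := by rw [← hAT, hz, map_zero]
    rw [hT₀a] at hz h1
    have h2 : ((lam - mu) * z.1) • w = 0 := by
      have : ((lam - mu) * z.1) • w =
          ((lam * z.1) • w + (mu * z.2) • e) - mu • (z.1 • w + z.2 • e) := by module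
      rw [this, hz, h1, smul_zero, sub_zero]
    have h3 : ((mu - lam) * z.2) • e = 0 := by
      have : ((mu - lam) * z.2) • e =
          ((lam * z.1) • w + (mu * z.2) • e) - lam • (z.1 • w + z.2 • e) := by module
      rw [this, hz, h1, smul_zero, sub_zero]
    ext
    · exact (mul_eq_zero.1 ((smul_eq_zero.1 h2).resolve_right hw)).resolve_left
        (sub_ne_zero.2 hne.symm)
    · exact (mul_eq_zero.1 ((smul_eq_zero.1 h3).resolve_right he)).resolve_left
        (sub_ne_zero.2 hne)
  refine ⟨mu, (LinearEquiv.ofInjectiveOfFinrankEq T₀ hinj (by simp)).toContinuousLinearEquiv,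
    habs, ?_, hAT⟩
  change T₀ (1, 0) = w
  rw [hT₀a]; simp

/-! ### The covering projection -/

theorem torusProj_neg (x : Plane) : torusProj (-x) = -torusProj x := by
  funext i; simp [torusProj]

theorem torusProj_sub (x y : Plane) : torusProj (x - y) = torusProj x - torusProj y := by
  rw [sub_eq_add_neg, torusProj_add, torusProj_neg, sub_eq_add_neg]

theorem continuous_torusProj : Continuous torusProj := by
  unfold torusProj
  exact continuous_pi fun i => (AddCircle.continuous_mk' 1).comp (by fun_prop)

theorem isOpenMap_torusProj : IsOpenMap torusProj := by
  have h1 : IsOpenMap (Pi.map fun (_ : Fin 2) (r : ℝ) => (r : UnitAddCircle)) :=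
    IsOpenMap.piMap (fun _ => QuotientAddGroup.isOpenMap_coe) (by simp)
  exact h1.comp (EuclideanSpace.equiv (Fin 2) ℝ).toHomeomorph.isOpenMap

theorem surjective_torusProj : Function.Surjective torusProj := fun x => by
  choose r hr using fun i => QuotientAddGroup.mk_surjective (x i)
  exact ⟨WithLp.toLp 2 r, funext hr⟩

theorem torusProj_eq_zero {x : Plane} : torusProj x = 0 ↔ ∀ i, ∃ n : ℤ, (n : ℝ) = x i := by
  rw [funext_iff]
  refine forall_congr' fun i => ?_
  change ((x i : ℝ) : UnitAddCircle) = 0 ↔ _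
  rw [AddCircle.coe_eq_zero_iff]
  simp

theorem one_le_norm_of_torusProj_eq_zero {x : Plane} (hx : torusProj x = 0) (h0 : x ≠ 0) :
    1 ≤ ‖x‖ := by
  rw [torusProj_eq_zero] at hx
  obtain ⟨i, hi⟩ : ∃ i, x i ≠ 0 := by
    by_contra h
    push Not at h
    exact h0 (by ext i; exact h i)
  obtain ⟨n, hn⟩ := hx i
  have h1 : (1 : ℝ) ≤ |x i| := by
    rw [← hn] at hi ⊢
    have h2 : n ≠ 0 := fun h => hi (by rw [h, Int.cast_zero])
    rw [← Int.cast_abs, ← Int.cast_one, Int.cast_le]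
    exact Int.one_le_abs h2
  exact h1.trans (PiLp.norm_apply_le x i)

/-- The lattice of periods of the covering projection, in linear coordinates. -/
def periodLattice (T : (ℝ × ℝ) ≃L[ℝ] Plane) : AddSubgroup (ℝ × ℝ) where
  carrier := {z | torusProj (T z) = 0}
  zero_mem' := by simp [torusProj_zero]
  add_mem' {a b} ha hb := by
    change torusProj (T a) = 0 at ha
    change torusProj (T b) = 0 at hb
    change torusProj (T (a + b)) = 0
    rw [map_add, torusProj_add, ha, hb, add_zero]
  neg_mem' {a} ha := by
    change torusProj (T a) = 0 at ha
    change torusProj (T (-a)) = 0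
    rw [map_neg, torusProj_neg, ha, neg_zero]

theorem mem_periodLattice {T : (ℝ × ℝ) ≃L[ℝ] Plane} {z : ℝ × ℝ} :
    z ∈ periodLattice T ↔ torusProj (T z) = 0 := Iff.rfl

theorem isInvLattice_periodLattice {lam mu : ℝ} {A : GL (Fin 2) ℤ} {T : (ℝ × ℝ) ≃L[ℝ] Plane}
    (hT : ∀ z, linMap A.val (T z) = T (lam * z.1, mu * z.2)) :
    IsInvLattice lam mu (periodLattice T) where
  discrete := by
    refine ⟨(‖(T : (ℝ × ℝ) →L[ℝ] Plane)‖ + 1)⁻¹, by positivity, fun ℓ hℓ h0 => ?_⟩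
    have h1 := one_le_norm_of_torusProj_eq_zero hℓ (by simpa using h0)
    have h2 := (T : (ℝ × ℝ) →L[ℝ] Plane).le_opNorm ℓ
    rw [inv_le_iff_one_le_mul₀ (by positivity)]
    have h3 : ‖T ℓ‖ ≤ ‖(T : (ℝ × ℝ) →L[ℝ] Plane)‖ * ‖ℓ‖ := h2
    nlinarith [norm_nonneg ℓ]
  map_mem ℓ := by
    rw [mem_periodLattice, mem_periodLattice, ← hT, ← torusMul_torusProj]
    have h0 : torusAut A 0 = 0 := by rw [torusAut_apply]; funext i; simp [torusMul]
    have h1 : torusMul A.val (torusProj (T ℓ)) = torusAut A (torusProj (T ℓ)) := rfl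
    rw [h1]
    exact ⟨fun h => (torusAut A).injective (h.trans h0.symm), fun h => by rw [h, h0]⟩
  nontrivial := by
    refine ⟨T.symm (EuclideanSpace.single 0 1), ?_, ?_⟩
    · rw [mem_periodLattice, T.apply_symm_apply, torusProj_eq_zero]
      intro i
      fin_cases i
      · exact ⟨1, by simp⟩
      · exact ⟨0, by simp⟩
    · simp
  countable := by
    refine (countable_range fun q : ℤ × ℤ => T.symm !₂[(q.1 : ℝ), (q.2 : ℝ)]).mono ?_
    intro z hz
    obtain ⟨m, hm⟩ := torusProj_eq_zero.1 hz 0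
    obtain ⟨n, hn⟩ := torusProj_eq_zero.1 hz 1
    refine ⟨(m, n), ?_⟩
    rw [ContinuousLinearEquiv.symm_apply_eq]
    exact plane_ext hm hn

theorem isTorusCover_torusProj (T : (ℝ × ℝ) ≃L[ℝ] Plane) (p' : Plane) :
    IsTorusCover (periodLattice T) fun z => torusProj (p' + T z) where
  continuous := continuous_torusProj.comp (by fun_prop)
  isOpenMap := isOpenMap_torusProj.comp
    ((Homeomorph.addLeft p').isOpenMap.comp T.toHomeomorph.isOpenMap)
  surjective x := by
    obtain ⟨y, rfl⟩ := surjective_torusProj x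
    exact ⟨T.symm (y - p'), by simp⟩
  eq_iff z z' := by
    rw [mem_periodLattice, map_sub, torusProj_sub, torusProj_add, torusProj_add,
      add_right_inj, sub_eq_zero]

/-! ### The model attached to the automorphism and its fixed point -/

/-- The model together with the linear coordinates in which it is derived from the automorphism
given by `A`. -/
structure DAData (l : Set.Ioi (1 : ℝ)) (A : GL (Fin 2) ℤ) extends DAModel where
  lam_eq : toDAModel.lam = l
  T : (ℝ × ℝ) ≃L[ℝ] Plane
  p' : Plane
  map_T : ∀ z, linMap A.val (T z) = T (toDAModel.lam * z.1, toDAModel.mu * z.2)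
  π_eq : toDAModel.π = fun z => torusProj (p' + T z)
  fixed : torusAut A (torusProj p') = torusProj p'

theorem DAData.torusAut_π {lam : Set.Ioi (1 : ℝ)} {A : GL (Fin 2) ℤ} (D : DAData lam A)
    (z : ℝ × ℝ) : torusAut A (D.π z) = D.π (D.lam * z.1, D.mu * z.2) := by
  simp only [D.π_eq, torusProj_add, ← D.map_T, ← torusMul_torusProj]
  rw [torusAut_apply, torusMul_add, ← torusAut_apply, D.fixed]

theorem exists_DAData (lam : Set.Ioi (1 : ℝ)) (A : GL (Fin 2) ℤ) {w : Plane} (hw : w ≠ 0)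
    (hA : linMap A.val w = (lam : ℝ) • w) {p : Torus2} (hp : torusAut A p = p) {U : Set Torus2}
    (hU : U ∈ 𝓝 p) : ∃ D : DAData lam A, D.T (1, 0) = w ∧ D.π 0 = p ∧
      ∀ x ∉ U, D.f x = torusAut A x := by
  obtain ⟨mu, T, hmu, hTw, hT⟩ := exists_eigenframe lam.2 A hw hA
  obtain ⟨p', rfl⟩ := surjective_torusProj p
  have hcov := isTorusCover_torusProj T p'
  have hlat := isInvLattice_periodLattice hT
  obtain ⟨δ, hδ, hL⟩ := hlat.discrete
  obtain ⟨δ₀, hδ₀, hball⟩ := Metric.mem_nhds_iff.1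
    (hcov.continuous.continuousAt (x := 0) (by simpa using hU))
  obtain ⟨k, R, q, η, hk, hk0⟩ := exists_isDAPerturbation lam.2 hmu (periodLattice T) hδ hL hδ₀
  let M : DAModel := ⟨lam, mu, periodLattice T, k, R, q, η, _, hk, hlat, hcov⟩
  let D : DAData lam A := ⟨M, rfl, T, p', hT, rfl, hp⟩
  have hπ0 : D.π 0 = torusProj p' := by
    change torusProj (p' + T 0) = _
    rw [map_zero, add_zero]
  refine ⟨D, hTw, hπ0, fun x hx => ?_⟩
  obtain ⟨z, rfl⟩ := D.cover.surjective x
  rw [D.f_π, D.torusAut_π, D.F_apply]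
  have : D.k z = 0 := hk0 z fun ℓ hℓ => by
    by_contra hlt
    refine hx ?_
    have h1 := hball (show z - ℓ ∈ Metric.ball 0 δ₀ by simpa using hlt)
    have h2 := D.cover.apply_add (ℓ := ℓ) hℓ (z - ℓ)
    rw [sub_add_cancel] at h2
    rw [h2]
    exact h1
  rw [this, add_zero]

namespace DAData

variable {lam : Set.Ioi (1 : ℝ)} {A : GL (Fin 2) ℤ} (D : DAData lam A)

/-! ### Linear coordinates -/

/-- The point of the plane with given coordinates. -/
def lift (z : ℝ × ℝ) : Plane := D.p' + D.T z

/-- The coordinates of a point of the plane. -/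
def coord (x : Plane) : ℝ × ℝ := D.T.symm (x - D.p')

theorem coord_lift (z : ℝ × ℝ) : D.coord (D.lift z) = z := by simp [coord, lift]

theorem lift_coord (x : Plane) : D.lift (D.coord x) = x := by simp [coord, lift]

theorem torusProj_lift (z : ℝ × ℝ) : torusProj (D.lift z) = D.π z := by rw [D.π_eq]; rfl

theorem π_coord (x : Plane) : D.π (D.coord x) = torusProj x := by
  rw [← torusProj_lift, lift_coord]

theorem contDiff_lift {n : WithTop ℕ∞} : ContDiff ℝ n D.lift := by unfold lift; fun_prop

theorem contDiff_coord {n : WithTop ℕ∞} : ContDiff ℝ n D.coord := by unfold coord; fun_prop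

theorem hasFDerivAt_lift (z : ℝ × ℝ) : HasFDerivAt D.lift (D.T : (ℝ × ℝ) →L[ℝ] Plane) z :=
  D.T.hasFDerivAt.const_add D.p'

theorem hasFDerivAt_coord (x : Plane) :
    HasFDerivAt D.coord (D.T.symm : Plane →L[ℝ] (ℝ × ℝ)) x :=
  D.T.symm.hasFDerivAt.comp x ((hasFDerivAt_id x).sub_const D.p')

/-- The self-map of the plane given in coordinates by `g`. -/
def conj (g : ℝ × ℝ → ℝ × ℝ) (x : Plane) : Plane := D.lift (g (D.coord x))

theorem fderiv_conj {g : ℝ × ℝ → ℝ × ℝ} {x : Plane} (hg : DifferentiableAt ℝ g (D.coord x))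
    (v : Plane) : fderiv ℝ (D.conj g) x v = D.T (fderiv ℝ g (D.coord x) (D.T.symm v)) := by
  have h1 : HasFDerivAt (D.conj g) _ x :=
    (D.hasFDerivAt_lift _).comp x (hg.hasFDerivAt.comp x (D.hasFDerivAt_coord x))
  rw [h1.fderiv]; rfl

theorem conj_iterate (g : ℝ × ℝ → ℝ × ℝ) (n : ℕ) : (D.conj g)^[n] = D.conj g^[n] := by
  funext x
  induction n with
  | zero => exact (D.lift_coord x).symm
  | succ n ih =>
    rw [Function.iterate_succ_apply', ih, conj, conj, coord_lift, conj,
      Function.iterate_succ_apply']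

theorem fderiv_iterate (n : ℕ) (x v : Plane) : fderiv ℝ (D.conj D.F)^[n] x v =
    D.T (fderiv ℝ D.F^[n] (D.coord x) (D.T.symm v)) := by
  rw [conj_iterate, D.fderiv_conj ((D.contDiff_F_iterate n).differentiable (by simp) _)]

theorem torusProj_conj {g : ℝ × ℝ → ℝ × ℝ} (x : Plane) :
    torusProj (D.conj g x) = D.π (g (D.coord x)) := D.torusProj_lift _

theorem isC1HolderOn_conj {V : Type*} [NormedAddCommGroup V] [NormedSpace ℝ V] {α : ℝ≥0}
    {g : V → ℝ × ℝ} (hα : α ≤ 1) (hg : IsC1HolderOn α g univ) :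
    IsC1HolderOn α (fun x => D.lift (g x)) univ :=
  (isC1HolderOn_of_contDiff hα D.contDiff_lift).comp hg

/-! #### The stable direction of the automorphism -/

theorem linMap_pow (n : ℕ) (z : ℝ × ℝ) :
    (linMap A.val ^ n) (D.T z) = D.T (D.lam ^ n * z.1, D.mu ^ n * z.2) := by
  induction n with
  | zero => simp
  | succ n ih =>
    rw [pow_succ', mul_apply_eq_comp, ih, D.map_T]
    simp only [pow_succ', mul_assoc]

theorem mem_stableSpace {v : Plane} :
    v ∈ stableSpace (linMap A.val) ↔ (D.T.symm v).1 = 0 := by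
  have key : v ∈ stableSpace (linMap A.val) ↔ Tendsto (fun n : ℕ =>
      (D.lam ^ n * (D.T.symm v).1, D.mu ^ n * (D.T.symm v).2)) atTop (𝓝 0) := by
    have h1 : ∀ n : ℕ, (linMap A.val ^ n) v =
        D.T (D.lam ^ n * (D.T.symm v).1, D.mu ^ n * (D.T.symm v).2) := fun n => by
      rw [← D.linMap_pow, D.T.apply_symm_apply]
    change Tendsto (fun n : ℕ => (linMap A.val ^ n) v) atTop (𝓝 0) ↔ _
    simp only [h1]
    constructor
    · intro h
      have := (D.T.symm.continuous.tendsto 0).comp h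
      simpa [Function.comp_def] using this
    · intro h
      have := (D.T.continuous.tendsto 0).comp h
      simpa [Function.comp_def] using this
  rw [key]
  constructor
  · intro h
    by_contra hne
    have h1 : Tendsto (fun n : ℕ => |D.lam ^ n * (D.T.symm v).1|) atTop (𝓝 0) := by
      simpa using ((continuous_fst.tendsto _).comp h).abs
    have h2 : ∀ n : ℕ, |(D.T.symm v).1| ≤ |D.lam ^ n * (D.T.symm v).1| := fun n => by
      rw [abs_mul, abs_pow, abs_of_pos D.lam_pos]
      exact le_mul_of_one_le_left (abs_nonneg _) (one_le_pow₀ D.pert.one_lt.le)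
    exact hne (abs_nonpos_iff.1 (ge_of_tendsto' h1 h2))
  · intro h
    have h1 : Tendsto (fun n : ℕ => D.mu ^ n * (D.T.symm v).2) atTop (𝓝 0) := by
      simpa using (tendsto_pow_atTop_nhds_zero_of_abs_lt_one D.abs_mu_lt_one).mul_const
        (D.T.symm v).2
    simp only [h, mul_zero]
    exact tendsto_const_nhds.prodMk_nhds h1

theorem stableSpace_eq_span : stableSpace (linMap A.val) = Submodule.span ℝ {D.T (0, 1)} := by
  ext v
  rw [D.mem_stableSpace, Submodule.mem_span_singleton]
  constructor
  · intro h
    refine ⟨(D.T.symm v).2, ?_⟩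
    rw [← map_smul, ← ContinuousLinearEquiv.eq_symm_apply]
    ext
    · simp [h]
    · simp
  · rintro ⟨a, rfl⟩
    simp

theorem mem_linearLeaf {z : ℝ × ℝ} {y : Torus2} :
    y ∈ linearLeaf (stableSpace (linMap A.val)) (D.π z) ↔ ∃ z', z'.1 = z.1 ∧ y = D.π z' := by
  constructor
  · rintro ⟨v, hv, rfl⟩
    rw [D.mem_stableSpace] at hv
    refine ⟨z + D.T.symm v, by simp [hv], ?_⟩
    rw [← torusProj_lift, ← torusProj_lift, ← torusProj_add, lift, lift, map_add,
      D.T.apply_symm_apply, add_assoc]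
  · rintro ⟨z', h, rfl⟩
    refine ⟨D.T (z' - z), ?_, ?_⟩
    · rw [D.mem_stableSpace]; simp [h]
    · rw [← torusProj_lift, ← torusProj_lift, ← torusProj_add, lift, lift, map_sub]
      congr 1; abel

theorem image_linearLeaf {G : Torus2 → Torus2} {g : ℝ × ℝ → ℝ × ℝ} (hg : Function.Surjective g)
    (hG : ∀ z, G (D.π z) = D.π (g z)) (hfst : ∀ z z', (g z').1 = (g z).1 ↔ z'.1 = z.1)
    (x : Torus2) : G '' linearLeaf (stableSpace (linMap A.val)) x =
      linearLeaf (stableSpace (linMap A.val)) (G x) := by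
  obtain ⟨z, rfl⟩ := D.cover.surjective x
  ext y
  rw [hG, D.mem_linearLeaf]
  constructor
  · rintro ⟨y', hy', rfl⟩
    obtain ⟨z', h, rfl⟩ := D.mem_linearLeaf.1 hy'
    exact ⟨_, (hfst _ _).2 h, hG z'⟩
  · rintro ⟨z', h, rfl⟩
    obtain ⟨z'', rfl⟩ := hg z'
    exact ⟨_, D.mem_linearLeaf.2 ⟨z'', (hfst _ _).1 h, rfl⟩, hG z''⟩

theorem f_image_linearLeaf (x : Torus2) : D.f '' linearLeaf (stableSpace (linMap A.val)) x =
    linearLeaf (stableSpace (linMap A.val)) (D.f x) :=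
  D.image_linearLeaf D.F.surjective D.f_π
    (fun z z' => by rw [D.F_apply, D.F_apply]; exact mul_right_inj' D.lam_pos.ne') x

theorem φ_image_linearLeaf (t : ℝ) (x : Torus2) :
    D.φ t '' linearLeaf (stableSpace (linMap A.val)) x =
      linearLeaf (stableSpace (linMap A.val)) (D.φ t x) :=
  D.image_linearLeaf (Function.LeftInverse.surjective (D.Φ_cancel_neg t)) (D.φ_π t)
    (fun z z' => by rw [D.Φ_fst, D.Φ_fst, add_left_inj]) x

/-! #### The unstable vector field -/

/-- The unstable vector field. -/
def X (x : Torus2) : Plane := D.T (1, D.slope (Function.surjInv D.cover.surjective x))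

theorem X_π (z : ℝ × ℝ) : D.X (D.π z) = D.T (1, D.slope z) := by
  have h1 : Function.surjInv D.cover.surjective (D.π z) - z ∈ D.L :=
    (D.cover.eq_iff _ _).1 (Function.surjInv_eq D.cover.surjective (D.π z))
  have h2 := D.slope_add h1 z
  rw [add_sub_cancel] at h2
  rw [X, h2]

theorem X_torusProj (x : Plane) : D.X (torusProj x) = D.T (1, D.slope (D.coord x)) := by
  rw [← π_coord, X_π]

theorem X_ne_zero (x : Torus2) : D.X x ≠ 0 := by
  rw [X, Ne, map_eq_zero_iff _ D.T.injective]
  exact fun h => one_ne_zero (congrArg Prod.fst h)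

theorem continuous_X : Continuous D.X := by
  refine D.cover.isQuotientMap.continuous_iff.2 ?_
  have h : D.X ∘ D.π = fun z => D.T (1, D.slope z) := funext D.X_π
  rw [h]
  have := D.continuous_slope
  fun_prop

theorem isC1HolderOn_X : IsC1HolderOn D.α (fun x : Plane => D.X (torusProj x)) univ := by
  simp only [X_torusProj]
  have h1 : ContDiff ℝ 2 fun s : ℝ => D.T (1, s) := by fun_prop
  exact (isC1HolderOn_of_contDiff D.α_lt_one.le h1).comp
    (D.isC1HolderOn_slope.comp (isC1HolderOn_of_contDiff D.α_lt_one.le D.contDiff_coord))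

theorem generates : Generates D.X (fun t => D.φ t) := by
  intro x
  refine ⟨fun t => D.lift (D.Φ t (D.coord x)), ?_, fun t => ⟨?_, ?_⟩⟩
  · simp only [D.Φ_zero, lift_coord]
  · rw [torusProj_lift, ← D.π_coord x]
    exact (D.φ_π t _).symm
  · rw [torusProj_lift, X_π]
    exact (D.hasFDerivAt_lift _).comp_hasDerivAt t (D.isSlopeFlow.hasDerivAt (D.coord x) t)

theorem fderiv_iterate_X (n : ℕ) (x : Plane) : fderiv ℝ (D.conj D.F)^[n] x (D.X (torusProj x)) =
    D.lam ^ n • D.X (torusProj ((D.conj D.F)^[n] x)) := by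
  rw [D.fderiv_iterate, X_torusProj, D.T.symm_apply_apply, D.fderiv_F_iterate_slope, conj_iterate,
    torusProj_conj, X_π, ← map_smul]
  simp

theorem fderiv_iterate_stable (n : ℕ) (x : Plane) : fderiv ℝ (D.conj D.F)^[n] x (D.T (0, 1)) =
    D.jacIter n (D.coord x) • D.T (0, 1) := by
  rw [D.fderiv_iterate, D.T.symm_apply_apply, D.fderiv_F_iterate_vertical, ← map_smul]
  simp

theorem isLift : IsLift (D.conj D.F) D.f := by
  refine ⟨?_, fun x => ?_⟩
  · exact (D.contDiff_lift (n := 0)).continuous.comp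
      (D.F.continuous.comp (D.contDiff_coord (n := 0)).continuous)
  · rw [torusProj_conj, ← D.f_π, π_coord]

theorem isInvariantBundle_stable (S : Set Torus2) :
    IsInvariantBundle (D.conj D.F) S (fun _ => stableSpace (linMap A.val)) := by
  intro x _
  have h := D.fderiv_iterate_stable 1 x
  rw [Function.iterate_one] at h
  simp only [D.stableSpace_eq_span, Submodule.map_span, image_singleton,
    ContinuousLinearMap.coe_coe, h]
  refine Submodule.span_singleton_smul_eq (IsUnit.mk0 _ ?_) _
  simpa [DAModel.jacIter] using D.jac_ne_zero _

theorem isInvariantBundle_unstable (S : Set Torus2) :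
    IsInvariantBundle (D.conj D.F) S (fun x => Submodule.span ℝ {D.X x}) := by
  intro x _
  have h := D.fderiv_iterate_X 1 x
  rw [Function.iterate_one, pow_one] at h
  simp only [Submodule.map_span, image_singleton, ContinuousLinearMap.coe_coe, h]
  exact Submodule.span_singleton_smul_eq (IsUnit.mk0 _ D.lam_pos.ne') _

theorem isCompl_bundles (x : Torus2) :
    IsCompl (stableSpace (linMap A.val)) (Submodule.span ℝ {D.X x}) := by
  obtain ⟨z, rfl⟩ := D.cover.surjective x
  rw [D.X_π]
  constructor
  · rw [Submodule.disjoint_def]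
    intro v h1 h2
    obtain ⟨a, rfl⟩ := Submodule.mem_span_singleton.1 h2
    rw [D.mem_stableSpace] at h1
    have : a = 0 := by simpa using h1
    rw [this, zero_smul]
  · rw [codisjoint_iff, eq_top_iff]
    intro v _
    rw [Submodule.mem_sup]
    refine ⟨D.T (0, (D.T.symm v).2 - (D.T.symm v).1 * D.slope z), ?_,
      (D.T.symm v).1 • D.T (1, D.slope z),
      Submodule.smul_mem _ _ (Submodule.mem_span_singleton_self _), ?_⟩
    · rw [D.mem_stableSpace]; simp
    · rw [← map_smul, ← map_add, ← ContinuousLinearEquiv.eq_symm_apply]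
      ext <;> simp

theorem exists_bounds_X : ∃ m > 0, ∃ K > 0, ∀ x, m ≤ ‖D.X x‖ ∧ ‖D.X x‖ ≤ K := by
  obtain ⟨x₀, -, h₀⟩ := isCompact_univ.exists_isMinOn (univ_nonempty (α := Torus2))
    D.continuous_X.norm.continuousOn
  obtain ⟨x₁, -, h₁⟩ := isCompact_univ.exists_isMaxOn (univ_nonempty (α := Torus2))
    D.continuous_X.norm.continuousOn
  exact ⟨_, norm_pos_iff.2 (D.X_ne_zero x₀), _, norm_pos_iff.2 (D.X_ne_zero x₁),
    fun x => ⟨h₀ (mem_univ x), h₁ (mem_univ x)⟩⟩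

theorem isClosed_unstable : IsClosed {q : Torus2 × Plane | q.2 ∈ Submodule.span ℝ {D.X q.1}} := by
  have h : ∀ q : Torus2 × Plane, q.2 ∈ Submodule.span ℝ {D.X q.1} ↔
      q.2 = (D.T.symm q.2).1 • D.X q.1 := by
    intro q
    rw [Submodule.mem_span_singleton]
    constructor
    · rintro ⟨a, ha⟩
      have : (D.T.symm q.2).1 = a := by rw [← ha, map_smul, X]; simp
      rw [this, ha]
    · exact fun h => ⟨_, h.symm⟩
  simp only [h]
  have := D.continuous_X
  exact isClosed_eq continuous_snd (by fun_prop)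

theorem isPartiallyHyperbolic : IsPartiallyHyperbolic (D.conj D.F)
    (fun _ => stableSpace (linMap A.val)) (fun x => Submodule.span ℝ {D.X x}) := by
  refine ⟨fun x => ⟨D.isCompl_bundles x, ?_, finrank_span_singleton (D.X_ne_zero x)⟩, ?_,
    D.isClosed_unstable, D.isInvariantBundle_stable _, D.isInvariantBundle_unstable _, ?_⟩
  · rw [D.stableSpace_eq_span]
    refine finrank_span_singleton ?_
    rw [Ne, map_eq_zero_iff _ D.T.injective]
    exact fun h => one_ne_zero (congrArg Prod.snd h)
  · simp only [D.mem_stableSpace]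
    exact isClosed_eq (by fun_prop) continuous_const
  obtain ⟨m, hm, K, hK, hX⟩ := D.exists_bounds_X
  have hl := D.pert.one_lt
  have hl0 := D.lam_pos
  set θ := (1 + D.lam) / 2 with hθ
  have hθ0 : 0 < θ := by positivity
  have hmK : m ≤ K := (hX 0).1.trans (hX 0).2
  -- `K / m` compares the norms of the unstable field at two points. On that field the derivative of
  -- `f^[n]` is exactly `λ ^ n`, against at most `θ ^ n` vertically; since `θ ≥ 1`, the same rate
  -- also bounds the expansion.
  refine ⟨K / m, by positivity, θ / D.lam, ⟨by positivity, ?_⟩, fun n x u hu => ?_⟩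
  · rw [div_lt_one hl0]; linarith
  obtain ⟨a, rfl⟩ := Submodule.mem_span_singleton.1 hu
  rw [map_smul, D.fderiv_iterate_X, norm_smul, norm_smul, norm_smul, norm_pow,
    Real.norm_of_nonneg hl0.le]
  set x₁ := torusProj x
  set x₂ := torusProj ((D.conj D.F)^[n] x)
  have hratio : ‖D.X x₁‖ ≤ K / m * ‖D.X x₂‖ := by
    calc ‖D.X x₁‖ ≤ K := (hX x₁).2
      _ = K / m * m := by field_simp
      _ ≤ K / m * ‖D.X x₂‖ := by gcongr; exact (hX x₂).1
  have hpow : (θ / D.lam) ^ n * D.lam ^ n = θ ^ n := by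
    rw [← mul_pow, div_mul_cancel₀ _ hl0.ne']
  constructor
  · intro v hv
    rw [D.stableSpace_eq_span] at hv
    obtain ⟨c, rfl⟩ := Submodule.mem_span_singleton.1 hv
    rw [map_smul, D.fderiv_iterate_stable, norm_smul, norm_smul, norm_smul]
    have hj : ‖D.jacIter n (D.coord x)‖ ≤ θ ^ n :=
      D.abs_jacIter_le (fun i => D.pert.jac_le _) n
    calc ‖c‖ * (‖D.jacIter n (D.coord x)‖ * ‖D.T (0, 1)‖) * (‖a‖ * ‖D.X x₁‖)
        ≤ ‖c‖ * (θ ^ n * ‖D.T (0, 1)‖) * (‖a‖ * (K / m * ‖D.X x₂‖)) := by gcongr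
      _ = _ := by rw [← hpow]; ring
  · have h1 : (1 : ℝ) ≤ θ ^ n := one_le_pow₀ (by linarith)
    calc ‖a‖ * ‖D.X x₁‖ ≤ ‖a‖ * (K / m * ‖D.X x₂‖) := by gcongr
      _ ≤ θ ^ n * (‖a‖ * (K / m * ‖D.X x₂‖)) := le_mul_of_one_le_left (by positivity) h1
      _ = _ := by rw [← hpow]; ring

theorem isHyperbolicSet_Λ : IsHyperbolicSet D.f (D.conj D.F) D.Λ
    (fun _ => stableSpace (linMap A.val)) (fun x => Submodule.span ℝ {D.X x}) := by
  refine ⟨D.nonempty_Λ, D.isCompact_Λ, D.f_image_Λ, fun x _ => D.isCompl_bundles x,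
    D.isInvariantBundle_stable _, D.isInvariantBundle_unstable _, ?_⟩
  obtain ⟨m, hm, K, hK, hX⟩ := D.exists_bounds_X
  have hl := D.pert.one_lt
  have hl0 := D.lam_pos
  have hη := D.eta_pos
  have hmK : m ≤ K := (hX 0).1.trans (hX 0).2
  set θ := max D.η D.lam⁻¹ with hθ
  have hθ0 : 0 < θ := hη.trans_le (le_max_left _ _)
  refine ⟨K / m, by positivity, θ, ⟨hθ0, max_lt D.pert.eta_lt (inv_lt_one_of_one_lt₀ hl)⟩,
    fun n x hx => ⟨fun v hv => ?_, fun u hu => ?_⟩⟩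
  · rw [D.stableSpace_eq_span] at hv
    obtain ⟨c, rfl⟩ := Submodule.mem_span_singleton.1 hv
    rw [← D.π_coord, D.π_mem_Λ] at hx
    rw [map_smul, D.fderiv_iterate_stable, norm_smul, norm_smul, norm_smul]
    have hj : ‖D.jacIter n (D.coord x)‖ ≤ θ ^ n :=
      (D.abs_jacIter_le_of_mem_attr hx n).trans (pow_le_pow_left₀ hη.le (le_max_left _ _) n)
    calc ‖c‖ * (‖D.jacIter n (D.coord x)‖ * ‖D.T (0, 1)‖)
        ≤ ‖c‖ * (θ ^ n * ‖D.T (0, 1)‖) := by gcongr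
      _ = 1 * (θ ^ n * (‖c‖ * ‖D.T (0, 1)‖)) := by ring
      _ ≤ K / m * (θ ^ n * (‖c‖ * ‖D.T (0, 1)‖)) := by
        gcongr
        rwa [one_le_div hm]
      _ = _ := by ring
  · obtain ⟨a, rfl⟩ := Submodule.mem_span_singleton.1 hu
    rw [map_smul, D.fderiv_iterate_X, norm_smul, norm_smul, norm_smul, norm_pow,
      Real.norm_of_nonneg hl0.le]
    set x₁ := torusProj x
    set x₂ := torusProj ((D.conj D.F)^[n] x)
    have hpow : 1 ≤ θ ^ n * D.lam ^ n := by
      rw [← mul_pow]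
      refine one_le_pow₀ ?_
      rw [← inv_le_iff_one_le_mul₀ hl0]
      exact le_max_right _ _
    calc ‖a‖ * ‖D.X x₁‖ ≤ ‖a‖ * (K / m * ‖D.X x₂‖) := by
          gcongr
          calc ‖D.X x₁‖ ≤ K := (hX x₁).2
            _ = K / m * m := by field_simp
            _ ≤ K / m * ‖D.X x₂‖ := by gcongr; exact (hX x₂).1
      _ ≤ (θ ^ n * D.lam ^ n) * (‖a‖ * (K / m * ‖D.X x₂‖)) :=
        le_mul_of_one_le_left (by positivity) hpow
      _ = _ := by ring

theorem isHyperbolicExpandingAttractor :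
    IsHyperbolicExpandingAttractor D.f (D.conj D.F) D.Λ :=
  ⟨D.isTransitiveAttractor, _, _, D.isHyperbolicSet_Λ, fun x _ => by
    rw [D.smallInductiveDimension_Λ, finrank_span_singleton (D.X_ne_zero x)]; rfl⟩

theorem isSource : IsSource D.f (D.conj D.F) (D.π 0) := by
  have hmem : ∀ x, torusProj x ∈ ({D.π 0} : Set Torus2) → D.coord x ∈ D.L := fun x hx => by
    rw [mem_singleton_iff, ← D.π_coord, D.cover.eq_iff, sub_zero] at hx
    exact hx
  have hj := D.pert.source
  have hjle := D.pert.jac_le 0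
  have hl := D.pert.one_lt
  -- At the source the derivative is diagonal with rates `λ` and `j`, where `1 < j ≤ (1 + λ) / 2 <
  -- λ`, so `j` is the weaker expansion.
  set j := |daJac D.mu D.k 0| with hjd
  have hj0 : 0 < j := by linarith
  refine ⟨D.f_π_zero, singleton_nonempty _, isCompact_singleton, by
    rw [image_singleton, D.f_π_zero], fun _ _ => isCompl_bot_top, fun x _ => Submodule.map_bot _,
    fun x hx => ?_, ‖(D.T : (ℝ × ℝ) →L[ℝ] Plane)‖ * ‖(D.T.symm : Plane →L[ℝ] (ℝ × ℝ))‖ + 1,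
    by positivity, j⁻¹, ⟨inv_pos.2 hj0, inv_lt_one_of_one_lt₀ hj⟩, fun n x hx => ⟨?_, ?_⟩⟩
  · rw [Submodule.map_top, LinearMap.range_eq_top]
    intro v
    have h1 := D.fderiv_iterate 1 x
    simp only [Function.iterate_one] at h1
    have h2 := D.fderiv_F_iterate_lattice (hmem x hx) 1
    simp only [Function.iterate_one, pow_one] at h2
    refine ⟨D.T (D.lam⁻¹ * (D.T.symm v).1, (D.jac 0)⁻¹ * (D.T.symm v).2), ?_⟩
    rw [ContinuousLinearMap.coe_coe, h1, h2, D.T.symm_apply_apply]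
    simp [D.lam_pos.ne', D.jac_ne_zero 0]
  · intro v hv
    rw [Submodule.mem_bot] at hv
    simp [hv]
  · intro v _
    set y := D.T.symm v with hy
    have hv : v = D.T y := (D.T.apply_symm_apply v).symm
    have h1 : fderiv ℝ (D.conj D.F)^[n] x v = D.T (D.lam ^ n * y.1, D.jac 0 ^ n * y.2) := by
      rw [D.fderiv_iterate, D.fderiv_F_iterate_lattice (hmem x hx)]
    rw [h1]
    set y' : ℝ × ℝ := (D.lam ^ n * y.1, D.jac 0 ^ n * y.2) with hy'
    have h2 : j ^ n * ‖y‖ ≤ ‖y'‖ := by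
      rw [Prod.norm_def, Prod.norm_def, mul_max_of_nonneg _ _ (by positivity)]
      refine max_le_max ?_ ?_
      · rw [norm_mul, norm_pow, Real.norm_of_nonneg D.lam_pos.le]
        gcongr
        linarith
      · rw [norm_mul, norm_pow]
        rfl
    have h3 : ‖y'‖ ≤ ‖(D.T.symm : Plane →L[ℝ] (ℝ × ℝ))‖ * ‖D.T y'‖ := by
      have := (D.T.symm : Plane →L[ℝ] (ℝ × ℝ)).le_opNorm (D.T y')
      simpa using this
    have h4 : ‖v‖ ≤ ‖(D.T : (ℝ × ℝ) →L[ℝ] Plane)‖ * ‖y‖ := by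
      rw [hv]; exact (D.T : (ℝ × ℝ) →L[ℝ] Plane).le_opNorm y
    have h5 : ‖y‖ ≤ j⁻¹ ^ n * ‖y'‖ := by
      rw [inv_pow, ← div_eq_inv_mul, le_div_iff₀ (by positivity), mul_comm]; exact h2
    calc ‖v‖ ≤ ‖(D.T : (ℝ × ℝ) →L[ℝ] Plane)‖ * (j⁻¹ ^ n *
          (‖(D.T.symm : Plane →L[ℝ] (ℝ × ℝ))‖ * ‖D.T y'‖)) := by
          refine h4.trans ?_
          gcongr
          refine h5.trans ?_
          gcongr
      _ = ‖(D.T : (ℝ × ℝ) →L[ℝ] Plane)‖ * ‖(D.T.symm : Plane →L[ℝ] (ℝ × ℝ))‖ *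
          j⁻¹ ^ n * ‖D.T y'‖ := by ring
      _ ≤ _ := by gcongr; linarith

/-! #### The unstable foliation -/

theorem isC1HolderFoliation :
    IsC1HolderFoliation D.α (fun x => range fun t : ℝ => D.φ t x) := by
  refine ⟨fun x => ⟨⟨0, by simp [D.φ_zero]⟩, ?_⟩, ?_, fun x => ?_⟩
  · exact isConnected_range (D.continuous_φ_left x)
  · rintro x _ ⟨t, rfl⟩
    ext y
    constructor
    · rintro ⟨s, rfl⟩
      exact ⟨s + t, by simp [D.φ_add]⟩
    · rintro ⟨s, rfl⟩
      refine ⟨s - t, ?_⟩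
      have : D.φ s = D.φ (s - t) * D.φ t := by rw [← D.φ_add, sub_add_cancel]
      simp only [this]
      rfl
  · obtain ⟨z₀, rfl⟩ := D.cover.surjective x
    obtain ⟨ε, hε, -, hinj⟩ := D.exists_chart z₀ univ_mem
    have hproj : ∀ q, torusProj (D.lift (D.chart z₀ hε q)) = D.π (D.chart z₀ hε q) :=
      fun q => D.torusProj_lift _
    refine ⟨fun q => D.lift (D.chart z₀ hε q), ?_, ?_, ?_, fun q _ => ?_, fun q hq => ?_⟩
    · rw [hproj, D.chart_zero]
    · exact (D.isC1HolderOn_conj D.α_lt_one.le (D.isC1HolderOn_chart z₀ hε)).mono_univ _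
    · refine (hinj.mono (Set.prod_mono Ioo_subset_Icc_self Ioo_subset_Icc_self)).congr fun q _ => ?_
      exact (hproj q).symm
    · have h1 : DifferentiableAt ℝ (D.chart z₀ hε) q :=
        (isC1HolderOn_univ.1 (D.isC1HolderOn_chart z₀ hε)).1.differentiable one_ne_zero q
      have h2 : HasFDerivAt (fun q => D.lift (D.chart z₀ hε q)) _ q :=
        (D.hasFDerivAt_lift _).comp q h1.hasFDerivAt
      rw [h2.fderiv]
      exact D.T.bijective.comp (D.bijective_fderiv_chart z₀ hε q)
    · simp only [hproj]
      exact D.connectedComponentIn_chart z₀ hε hq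

/-! #### The action -/

theorem contDiff_zpow (m : ℤ) : ContDiff ℝ (⊤ : ℕ∞) (D.F ^ m : (ℝ × ℝ) ≃ₜ (ℝ × ℝ)) := by
  induction m with
  | zero => exact contDiff_id
  | succ n ih =>
    rw [zpow_add_one]
    exact ih.comp D.contDiff_F
  | pred n ih =>
    rw [zpow_sub_one]
    exact ih.comp D.contDiff_F_symm

theorem f_zpow_π (m : ℤ) (z : ℝ × ℝ) : (D.f ^ m) (D.π z) = D.π ((D.F ^ m) z) := by
  induction m generalizing z with
  | zero => rfl
  | succ n ih => rw [zpow_add_one, zpow_add_one, Homeomorph.mul_apply, D.f_π, ih]; rfl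
  | pred n ih =>
    rw [zpow_sub_one, zpow_sub_one, Homeomorph.mul_apply]
    change (D.f ^ (-n : ℤ)) (D.f.symm (D.π z)) = _
    rw [D.f_symm_π, ih]; rfl

theorem isC1HolderAction : IsC1HolderAction D.α (D.ρ D.lam_eq) := by
  intro m
  refine ⟨fun q => D.lift (D.Φ q.1 ((D.F ^ m) (D.coord q.2))), ?_, fun t x => ?_⟩
  · refine D.isC1HolderOn_conj D.α_lt_one.le ?_
    have h1 : ContDiff ℝ 2 fun q : ℝ × Plane => (q.1, (D.F ^ m) (D.coord q.2)) :=
      contDiff_fst.prodMk ((contDiff_infty.1 (D.contDiff_zpow m) 2).comp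
        (D.contDiff_coord.comp contDiff_snd))
    exact D.isC1HolderOn_Φ.comp (isC1HolderOn_of_contDiff D.α_lt_one.le h1)
  · rw [torusProj_lift, D.ρ_apply, Homeomorph.mul_apply, ← D.π_coord x, D.f_zpow_π, D.φ_π]

/-! ### Semiconjugacy to the affine action, and non-conjugacy -/

theorem h_f (x : Torus2) : D.h (D.f x) = torusAut A (D.h x) := by
  obtain ⟨z, rfl⟩ := D.cover.surjective x
  rw [D.f_π, D.h_π, D.h_π, D.torusAut_π, D.H_F]

theorem h_f_zpow (m : ℤ) (x : Torus2) : D.h ((D.f ^ m) x) = (torusAut A ^ m) (D.h x) := by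
  induction m generalizing x with
  | zero => rfl
  | succ n ih => rw [zpow_add_one, zpow_add_one, Homeomorph.mul_apply, ih, D.h_f]; rfl
  | pred n ih =>
    rw [zpow_sub_one, zpow_sub_one, Homeomorph.mul_apply, ih, Homeomorph.mul_apply]
    congr 1
    rw [Homeomorph.inv_apply, Homeomorph.inv_apply, Homeomorph.eq_symm_apply, ← D.h_f,
      Homeomorph.apply_symm_apply]

theorem h_φ (t : ℝ) (x : Torus2) : D.h (D.φ t x) = D.h x + torusProj (t • D.T (1, 0)) := by
  obtain ⟨z, rfl⟩ := D.cover.surjective x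
  rw [D.φ_π, D.h_π, D.h_π, D.H_Φ, ← torusProj_lift, ← torusProj_lift, ← torusProj_add, lift, lift,
    map_add, add_assoc, ← map_smul]
  simp

theorem semiConjugateTo {w : Plane} (hw : D.T (1, 0) = w) (hA : linMap A.val w = (lam : ℝ) • w) :
    SemiConjugateTo (D.ρ D.lam_eq) (affineAction A w hA) := by
  refine ⟨D.h, D.continuous_h, D.surjective_h, ?_⟩
  rintro ⟨m, t⟩ x
  rw [D.ρ_apply, Homeomorph.mul_apply, D.h_φ, D.h_f_zpow, hw]
  rfl

/-- A conjugacy `g` would send the source to a fixed point `c` of a hyperbolic automorphism. The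
points of a short stable arc through `c` keep their forward orbits near `c`, so their preimages
under `g` stay in `VT` for ever and must equal the source. The arc would then be constant,
contradicting discreteness of the lattice. -/
theorem not_topConjugateTo {σ : SolvGroup lam →* (Torus2 ≃ₜ Torus2)} (hσ : IsAffineAction σ) :
    ¬ TopConjugateTo (D.ρ D.lam_eq) σ := by
  rintro ⟨g, hg⟩
  obtain ⟨B, w, hB, hw, rfl⟩ := hσ
  obtain ⟨mu, T, hmu, -, hT⟩ := exists_eigenframe lam.2 B hw hB
  have hmu1 : |mu| ≤ 1 := by rw [hmu]; exact (inv_lt_one_of_one_lt₀ lam.2).le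
  have hgf : ∀ x, g (D.f x) = torusAut B (g x) := fun x => by
    have := hg ⟨1, 0⟩ x
    rw [D.ρ_apply, D.φ_zero, zpow_one, one_mul] at this
    rw [this]
    change (torusAut B ^ (1 : ℤ)) (g x) + torusProj ((0 : ℝ) • w) = _
    rw [zero_smul, torusProj_zero, add_zero, zpow_one]
  set c := g (D.π 0) with hc
  have hBc : torusAut B c = c := by rw [hc, ← hgf, D.f_π_zero]
  set ℓ : ℝ → Torus2 := fun s => c + torusProj (T (0, s)) with hℓ
  have hℓc : Continuous ℓ := by
    have := continuous_torusProj.comp (by fun_prop : Continuous fun s : ℝ => T (0, s))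
    exact continuous_const.add this
  have hℓ0 : ℓ 0 = c := by
    have : T ((0 : ℝ), (0 : ℝ)) = 0 := map_zero T
    simp [hℓ, this, torusProj_zero]
  have hBℓ : ∀ s, torusAut B (ℓ s) = ℓ (mu * s) := fun s => by
    rw [hℓ]
    simp only [torusAut_apply, torusMul_add, torusMul_torusProj, hT, mul_zero]
    rw [← torusAut_apply, hBc]
  have h1 : {s | g.symm (ℓ s) ∈ D.VT} ∈ 𝓝 (0 : ℝ) := by
    refine (g.symm.continuous.comp hℓc).continuousAt.preimage_mem_nhds
      (D.isOpen_VT.mem_nhds ?_)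
    rw [Function.comp_apply, hℓ0, hc, g.symm_apply_apply, D.π_mem_VT]
    exact D.lattice_mem_V D.L.zero_mem
  obtain ⟨δ, hδ, hball⟩ := Metric.mem_nhds_iff.1 h1
  have h2 : ∀ s, |s| < δ → ℓ s = c := by
    intro s hs
    have hiter : ∀ n : ℕ, D.f^[n] (g.symm (ℓ s)) = g.symm (ℓ (mu ^ n * s)) := by
      intro n
      induction n with
      | zero => simp
      | succ n ih =>
        rw [Function.iterate_succ_apply', ih, Homeomorph.eq_symm_apply, hgf, g.apply_symm_apply,
          hBℓ, pow_succ', mul_assoc]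
    have h3 : g.symm (ℓ s) = D.π 0 := D.eq_of_forall_mem_VT fun n => by
      rw [hiter]
      refine hball ?_
      rw [mem_ball_zero_iff, Real.norm_eq_abs, abs_mul, abs_pow]
      exact (mul_le_of_le_one_left (abs_nonneg _)
        (pow_le_one₀ (abs_nonneg _) hmu1)).trans_lt hs
    rw [hc, ← h3, g.apply_symm_apply]
  obtain ⟨δ', hδ', hd⟩ := (isInvLattice_periodLattice hT).discrete
  set s := min δ δ' / 2 with hs
  have hs0 : 0 < s := half_pos (lt_min hδ hδ')
  have hsδ : s < δ := (half_lt_self (lt_min hδ hδ')).trans_le (min_le_left _ _)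
  have hsδ' : s < δ' := (half_lt_self (lt_min hδ hδ')).trans_le (min_le_right _ _)
  have h4 : (0, s) ∈ periodLattice T := by
    have := h2 s (by rwa [abs_of_pos hs0])
    rw [mem_periodLattice]
    simpa [hℓ] using this
  have h5 := hd _ h4 fun h => hs0.ne' (congrArg Prod.snd h)
  rw [Prod.norm_def, norm_zero, Real.norm_of_nonneg hs0.le, max_eq_right hs0.le] at h5
  linarith

end DAData

end

/-! ### The main theorem -/

theorem mainTheorem6 (lam : Set.Ioi (1 : ℝ)) (A : GL (Fin 2) ℤ) (w : Plane) (hw : w ≠ 0)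
    (hA : linMap A.val w = (lam : ℝ) • w)
    (p : Torus2) (hp : torusAut A p = p) (U : Set Torus2) (hU : U ∈ 𝓝 p) :
    ∃ (α : ℝ≥0) (ρ : SolvGroup lam →* (Torus2 ≃ₜ Torus2)) (f : Torus2 ≃ₜ Torus2)
      (φ : ℝ → Torus2 ≃ₜ Torus2) (F : Plane → Plane) (X : Torus2 → Plane) (Λ : Set Torus2),
      0 < α ∧ α < 1 ∧
      -- the action and its generators
      f = ρ ⟨1, 0⟩ ∧ (∀ t, φ t = ρ ⟨0, t⟩) ∧ (∀ t x, f (φ t x) = φ ((lam : ℝ) * t) (f x)) ∧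
      IsC1HolderAction α ρ ∧ IsLocallyFree ρ ∧
      -- `f` is a DA-diffeomorphism, derived from `A` near the fixed point `p`
      IsLift F f ∧ IsC1HolderOn α F univ ∧ (∀ x ∉ U, f x = torusAut A x) ∧
      IsPartiallyHyperbolic F (fun _ => stableSpace (linMap A.val))
        (fun x => Submodule.span ℝ {X x}) ∧
      (∀ x, f '' linearLeaf (stableSpace (linMap A.val)) x =
        linearLeaf (stableSpace (linMap A.val)) (f x)) ∧
      IsSource f F p ∧ IsHyperbolicExpandingAttractor f F Λ ∧ nonwanderingSet f = {p} ∪ Λ ∧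
      -- `φ` flows along the `C^{1+α}` unstable foliation, with constant speed transversally to
      -- the stable foliation of `A`, which it preserves
      IsC1HolderOn α (fun x : Plane => X (torusProj x)) univ ∧ Generates X (fun t => φ t) ∧
      IsC1HolderFoliation α (fun x => range fun t : ℝ => φ t x) ∧
      (∀ x, X x - w ∈ stableSpace (linMap A.val)) ∧
      (∀ t x, φ t '' linearLeaf (stableSpace (linMap A.val)) x =
        linearLeaf (stableSpace (linMap A.val)) (φ t x)) ∧
      (∀ x, fderiv ℝ F x (X (torusProj x)) = (lam : ℝ) • X (torusProj (F x))) ∧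
      -- semi-conjugacy to the given affine action, non-conjugacy to all affine actions
      SemiConjugateTo ρ (affineAction A w hA) ∧
      ∀ σ : SolvGroup lam →* (Torus2 ≃ₜ Torus2), IsAffineAction σ → ¬ TopConjugateTo ρ σ := by
  obtain ⟨D, hDw, hDp, hDU⟩ := exists_DAData lam A hw hA hp hU
  have hl := D.lam_eq
  refine ⟨D.α, D.ρ hl, D.f, D.φ, D.conj D.F, D.X, D.Λ, D.α_pos, D.α_lt_one, ?_, fun t => ?_,
    fun t x => ?_, D.isC1HolderAction, D.isLocallyFree_ρ hl, D.isLift, ?_, hDU,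
    D.isPartiallyHyperbolic, D.f_image_linearLeaf, hDp ▸ D.isSource,
    D.isHyperbolicExpandingAttractor, hDp ▸ D.nonwanderingSet_eq, D.isC1HolderOn_X, D.generates,
    D.isC1HolderFoliation, fun x => ?_, D.φ_image_linearLeaf, fun x => ?_,
    D.semiConjugateTo hDw hA, fun σ hσ => D.not_topConjugateTo hσ⟩
  · rw [D.ρ_apply, D.φ_zero, zpow_one, one_mul]
  · rw [D.ρ_apply, zpow_zero, mul_one]
  · rw [← hl]; exact D.f_φ t x
  · exact isC1HolderOn_of_contDiff D.α_lt_one.le (D.contDiff_lift.comp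
      ((contDiff_infty.1 D.contDiff_F 2).comp D.contDiff_coord))
  · rw [← hDw, D.mem_stableSpace, map_sub, DAData.X]; simp
  · rw [← hl]
    simpa using D.fderiv_iterate_X 1 x
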